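/- Let $k$ be a commutative ring and let $\bar A$ be a commutative, not necessarily unital, $k$-algebra. Write $[n]=\{0,\dots,n\}$. *Bar homology.* $H^{\mathrm{bar}}_*(\bar A)$ is the homology of the complex $C^{\mathrm{bar}}_*(\bar A)$ with $C^{\mathrm{bar}}_n(\bar A)=\bar A^{\otimes (n+1)}$ and differential $b'=\sum_{i=0}^{n-1}(-1)^i d_i$, where $d_i(a_0\otimes\dots\otimes a_n)=a_0\otimes\dots\otimes a_ia_{i+1}\otimes\dots\otimes a_n$. *$E_2$-homology.* Let $C_{(p,q)}=\bigoplus_f \bar A^{\otimes(p+1)}$, where $f$ runs over the order-preserving surjections $[p]\to[q]$ (planar trees with two levels, having $p+1$ leaves and $q+1$ vertices of height one). For $0\le i\le n-1$ let $d_i\colon[n]\to[n-1]$ be the order-preserving surjection with $d_i(i)=d_i(i+1)$, and for a surjection $\sigma\colon[p]\to[p']$ let $\sigma_*(a_0\otimes\dots\otimes a_p)=b_0\otimes\dots\otimes b_{p'}$ with $b_i=\prod_{\sigma(j)=i}a_j$. There are two differentials, given for $x$ in the summand of $f$ by $$\partial_2(x)=\sum_{i:\,f(i)=f(i+1)}(-1)^{(i+1)+(f(i)+1)}(d_i)_*x\in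 C_{(p-1,q)},$$ $$\partial_1(x)=\sum_{i=0}^{q-1}(-1)^{(i+1)+|f^{-1}(\{0,\dots,i\})|}\sum_{\tau}\operatorname{sgn}(\tau)\,\tau_*x\in C_{(p,q-1)},$$ where $(d_i)_*x$ lies in the summand of the unique $g$ with $g\circ d_i=f$, where $\tau$ runs over the shuffles of the fibres $f^{-1}(i)$ and $f^{-1}(i+1)$ (extended by the identity to permutations of $[p]$), and where $\tau_*x$ lies in the summand of $d_i\circ f$. These anticommute and square to zero, and $H^{E_2}_*(\bar A)$ is the homology of the total complex $\bigoplus_{p+q=n}C_{(p,q)}$ with differential $\partial_1+\partial_2$. The map $\partial_1$ is called the shuffle differential. **Proposition.** Suppose that the $k$-modules $\bar A$ and $H^{\mathrm{bar}}_n(\bar A)$, $n\ge 0$, are flat. Then there is a first quadrant homological spectral sequence of $k$-modules, with differentials $d^r\colon E^r_{p,q}\to E^r_{p+r-1,q-r}$ for $r\ge 1$, $$E^1_{p,q}\cong\bigoplus_{\ell_0+\dots+\ell_q=p-q}H^{\mathrm{bar}}_{\ell_0}(\bar A)\otimes\dots\otimes H^{\mathrm{bar}}_{\ell_q}(\bar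 A)\ \Longrightarrow\ H^{E_2}_{p+q}(\bar A),$$ in the following sense. 1. There are isomorphisms $\kappa\colon\bigoplus_{\ell_0+\dots+\ell_q=p-q}H^{\mathrm{bar}}_{\ell_0}(\bar A)\otimes\dots\otimes H^{\mathrm{bar}}_{\ell_q}(\bar A)\to H_p(C_{(*,q)},\partial_2)$ and $e\colon H_p(C_{(*,q)},\partial_2)\to E^1_{p,q}$ for all $p,q\ge 0$. If $z_i$ is a cycle of degree $\ell_i$ in $C^{\mathrm{bar}}_*(\bar A)$, $0\le i\le q$, then $\kappa([z_0]\otimes\dots\otimes[z_q])$ is the class of the $\partial_2$-cycle $z_0\otimes\dots\otimes z_q\in\bar A^{\otimes(p+1)}$ in the summand of the $f$ with $|f^{-1}(i)|=\ell_i+1$ for all $i$. 2. The differential $d^1\colon E^1_{p,q+1}\to E^1_{p,q}$ is induced by the shuffle differential: for each $\partial_2$-cycle $z\in C_{(p,q+1)}$, the element $\partial_1z$ is a $\partial_2$-cycle and $d^1(e[z])=e[\partial_1z]$. 3. Let $F_sH^{E_2}_n(\bar A)$ be the submodule of the classes that are represented by cycles in $\bigoplus_{p+q=n,\,q\le s}C_{(p,q)}$.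 Then $0=F_{-1}\subseteq F_0\subseteq\dots\subseteq F_n=H^{E_2}_n(\bar A)$, and $E^\infty_{p,q}\cong F_qH^{E_2}_{p+q}(\bar A)/F_{q-1}H^{E_2}_{p+q}(\bar A)$ for all $p,q\ge0$, where $E^\infty_{p,q}=E^r_{p,q}$ for $r\ge\max(p+2,q+1)$. -/

import Mathlib

open CategoryTheory
open scoped TensorProduct DirectSum

universe u v

namespace E2Homology

section Push
variable (k : Type u) [CommRing k] {A : Type v} [NonUnitalCommRing A] [Module k A]
  [IsScalarTower k A A] [SMulCommClass k A A]

/-- `b_i = ∏_{σ j = i} a_j`; the product, over a nonempty fibre when `σ` is onto, is computed in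
the unitalization `k ⊕ A`. -/
noncomputable def fibreProd {m n : ℕ} (σ : Fin m → Fin n) (a : Fin m → A) (i : Fin n) : A :=
  (∏ j with σ j = i, (Unitization.inr (a j) : Unitization k A)).snd

theorem inr_fibreProd {m n : ℕ} {σ : Fin m → Fin n} (hσ : Function.Surjective σ)
    (a : Fin m → A) (i : Fin n) :
    (Unitization.inr (fibreProd k σ a i) : Unitization k A) =
      ∏ j with σ j = i, (Unitization.inr (a j) : Unitization k A) := by
  obtain ⟨j, hj⟩ := hσ i
  ext
  · rw [Unitization.fst_inr]
    change _ = Unitization.fstHom k A _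
    rw [map_prod]
    exact (Finset.prod_eq_zero (Finset.mem_filter.2 ⟨Finset.mem_univ j, hj⟩) (by simp)).symm
  · rfl

theorem fibreProd_update_ne {m n : ℕ} (σ : Fin m → Fin n) (a : Fin m → A) (j : Fin m) (x : A)
    (i : Fin n) (h : σ j ≠ i) :
    fibreProd k σ (Function.update a j x) i = fibreProd k σ a i := by
  unfold fibreProd
  refine congrArg (fun z : Unitization k A => z.snd) (Finset.prod_congr rfl fun l hl => ?_)
  rw [Function.update_of_ne]
  rintro rfl
  exact h (Finset.mem_filter.1 hl).2

theorem fibreProd_update_self {m n : ℕ} (σ : Fin m → Fin n) (a : Fin m → A) (j : Fin m) (x : A) :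
    fibreProd k σ (Function.update a j x) (σ j) =
      ((Unitization.inr x : Unitization k A) *
        ∏ l ∈ (Finset.univ.filter fun l => σ l = σ j).erase j, Unitization.inr (a l)).snd := by
  unfold fibreProd
  rw [← Finset.mul_prod_erase (Finset.univ.filter fun l => σ l = σ j) _
    (Finset.mem_filter.2 ⟨Finset.mem_univ j, rfl⟩)]
  rw [Function.update_self]
  refine congrArg (fun z : Unitization k A => (Unitization.inr x * z).snd)
    (Finset.prod_congr rfl fun l hl => ?_)
  rw [Function.update_of_ne (Finset.ne_of_mem_erase hl)]

theorem fibreProd_update {m n : ℕ} (σ : Fin m → Fin n) (a : Fin m → A) (j : Fin m) (x : A) :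
    fibreProd k σ (Function.update a j x) =
      Function.update (fibreProd k σ a) (σ j) (fibreProd k σ (Function.update a j x) (σ j)) := by
  funext i
  by_cases h : i = σ j
  · subst h; simp
  · rw [Function.update_of_ne h, fibreProd_update_ne k σ a j x i (Ne.symm h)]

/-- The map `A^{⊗m} → A^{⊗n}`, `a_1 ⊗ ⋯ ⊗ a_m ↦ b_1 ⊗ ⋯ ⊗ b_n` with `b_i = ∏_{σ j = i} a_j`,
induced by a surjection `σ`. -/
noncomputable def push {m n : ℕ} (σ : Fin m → Fin n) : (⨂[k]^m A) →ₗ[k] (⨂[k]^n A) :=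
  PiTensorProduct.lift
    { toFun := fun a => PiTensorProduct.tprod k (fibreProd k σ a)
      map_update_add' := by
        intro inst a j x y
        obtain rfl : inst = instDecidableEqFin m := Subsingleton.elim _ _
        rw [fibreProd_update k σ a j (x + y), fibreProd_update k σ a j x,
          fibreProd_update k σ a j y]
        simp only [fibreProd_update_self, Unitization.inr_add, add_mul, Unitization.snd_add]
        exact (PiTensorProduct.tprod k).map_update_add _ _ _ _
      map_update_smul' := by
        intro inst a j c x
        obtain rfl : inst = instDecidableEqFin m := Subsingleton.elim _ _
        rw [fibreProd_update k σ a j (c • x), fibreProd_update k σ a j x]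
        simp only [fibreProd_update_self, Unitization.inr_smul, smul_mul_assoc,
          Unitization.snd_smul]
        exact (PiTensorProduct.tprod k).map_update_smul _ _ _ _ }

theorem push_tprod {m n : ℕ} (σ : Fin m → Fin n) (a : Fin m → A) :
    push k σ (PiTensorProduct.tprod k a) = PiTensorProduct.tprod k (fibreProd k σ a) :=
  PiTensorProduct.lift.tprod _

theorem push_push {m n l : ℕ} {σ : Fin m → Fin n} (hσ : Function.Surjective σ)
    {σ' : Fin n → Fin l} (hσ' : Function.Surjective σ') :
    push k σ' ∘ₗ push k (A := A) σ = push k (σ' ∘ σ) := by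
  ext a
  simp only [LinearMap.compMultilinearMap_apply, LinearMap.comp_apply, push_tprod]
  congr 1
  funext i
  apply Unitization.inr_injective (R := k)
  rw [inr_fibreProd k hσ', inr_fibreProd k (hσ'.comp hσ),
    ← Finset.prod_fiberwise_of_maps_to (t := Finset.univ.filter fun j => σ' j = i) (g := σ)
      (by intro x hx; simpa using hx)]
  refine Finset.prod_congr rfl fun j hj => ?_
  rw [inr_fibreProd k hσ]
  refine Finset.prod_congr ?_ fun _ _ => rfl
  ext x
  simp only [Finset.mem_filter, Finset.mem_univ, true_and, Function.comp] at hj ⊢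
  constructor
  · rintro rfl; exact ⟨hj, rfl⟩
  · exact fun h => h.2

end Push

theorem sum_cancel {M : Type*} [AddCommGroup M] (n : ℕ) (T : Fin (n + 2) → Fin (n + 1) → M)
    (h : ∀ i j : Fin (n + 1), i ≤ j → T i.castSucc j + T j.succ i = 0) :
    ∑ i, ∑ j, T i j = 0 := by
  classical
  rw [← Finset.sum_product' Finset.univ Finset.univ T]
  rw [← Finset.sum_filter_add_sum_filter_not _ (fun x : Fin (n+2) × Fin (n+1) => x.1 ≤ x.2.castSucc)]
  rw [← eq_neg_iff_add_eq_zero, ← Finset.sum_neg_distrib]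
  refine Finset.sum_bij (fun x hx => (x.2.succ, x.1.castPred (by
      rintro h'
      have := (Finset.mem_filter.1 hx).2
      rw [h'] at this
      exact absurd this (by simp [Fin.le_def]; omega)))) ?_ ?_ ?_ ?_
  · rintro ⟨i, j⟩ hx
    simp [Fin.le_def] at hx ⊢
    omega
  · rintro ⟨i, j⟩ hx ⟨i', j'⟩ hx' e
    simp [Fin.ext_iff] at e ⊢
    omega
  · rintro ⟨i, j⟩ hx
    simp [Fin.le_def] at hx
    refine ⟨(j.castSucc, i.pred (by rintro rfl; simp at hx)), ?_, ?_⟩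
    · simp [Fin.le_def]; omega
    · simp
  · rintro ⟨i, j⟩ hx
    simp [Fin.le_def] at hx
    have := h (i.castPred (by rintro rfl; simp at hx; omega)) j (by simpa [Fin.le_def] using hx)
    rw [Fin.castSucc_castPred] at this
    exact eq_neg_of_add_eq_zero_left this

/-! ### Two-level trees -/

theorem val_predAbove {n : ℕ} (i : Fin n) (x : Fin (n + 1)) :
    (i.predAbove x : ℕ) = if (i : ℕ) < x then (x : ℕ) - 1 else x := by
  rcases lt_or_ge i.castSucc x with h | h
  · rw [Fin.predAbove_of_castSucc_lt _ _ h, if_pos (by simpa [Fin.lt_def] using h)]; simp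
  · rw [Fin.predAbove_of_le_castSucc _ _ h, if_neg (by simpa [Fin.le_def] using h)]; simp

theorem predAbove_monotone {n : ℕ} (i : Fin n) : Monotone i.predAbove :=
  Fin.predAbove_right_monotone i

theorem predAbove_surjective {n : ℕ} (i : Fin n) : Function.Surjective i.predAbove :=
  Fin.predAbove_surjective i

/-- The order-preserving surjections `[p] → [q]`, that is, the planar trees with two levels,
`p + 1` leaves and `q + 1` vertices of height one. -/
abbrev TwoTree (p q : ℕ) : Type :=
  {f : Fin (p + 1) → Fin (q + 1) // Monotone f ∧ Function.Surjective f}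

theorem predAbove_succAbove_eq {n : ℕ} (i : Fin (n + 1)) (x : Fin (n + 2)) :
    i.succ.succAbove (i.predAbove x) = x ∨ (x = i.succ ∧ i.succ.succAbove (i.predAbove x) = i.castSucc) := by
  rcases eq_or_ne x i.succ with rfl | h
  · right; simp [Fin.succAbove, Fin.lt_def]
  · left
    obtain ⟨y, rfl⟩ := Fin.exists_succAbove_eq h
    congr 1
    rcases lt_or_ge y.castSucc i.succ with h' | h'
    · rw [Fin.succAbove_of_castSucc_lt _ _ h']
      rw [Fin.predAbove_castSucc_of_le _ _ (by rw [Fin.lt_def] at h'; rw [Fin.le_def]; simp at h'; omega)]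
    · rw [Fin.succAbove_of_le_castSucc _ _ h']
      rw [Fin.predAbove_succ_of_le _ _ (by rw [Fin.le_def] at h' ⊢; simp at h' ⊢; omega)]

theorem predAbove_succAbove {n : ℕ} (i : Fin (n + 1)) (x : Fin (n + 1)) :
    i.predAbove (i.succ.succAbove x) = x := by
  rcases predAbove_succAbove_eq i (i.succ.succAbove x) with h | h
  · exact Fin.succAbove_right_injective h
  · exact absurd h.1 (Fin.succAbove_ne _ _)

theorem comp_succAbove_comp_predAbove {n : ℕ} {α : Type*} (f : Fin (n + 2) → α) (i : Fin (n + 1))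
    (h : f i.castSucc = f i.succ) : (f ∘ i.succ.succAbove) ∘ i.predAbove = f := by
  funext x
  rcases predAbove_succAbove_eq i x with h' | ⟨rfl, h'⟩ <;> simp only [Function.comp, h']
  exact h

/-- For `f(i) = f(i+1)`, the tree `f|_{i=i+1}` obtained by gluing the leaves `i` and `i+1`: the
unique `g` with `g ∘ d_i = f`. -/
def TwoTree.glueLeaves {p q : ℕ} (f : TwoTree (p + 1) q) (i : Fin (p + 1))
    (h : f.1 i.castSucc = f.1 i.succ) : TwoTree p q :=
  ⟨f.1 ∘ i.succ.succAbove, f.2.1.comp (Fin.strictMono_succAbove _).monotone, by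
    refine Function.Surjective.of_comp (g := i.predAbove) ?_
    rw [comp_succAbove_comp_predAbove _ _ h]
    exact f.2.2⟩

theorem TwoTree.glueLeaves_comp {p q : ℕ} (f : TwoTree (p + 1) q) (i : Fin (p + 1))
    (h : f.1 i.castSucc = f.1 i.succ) : (f.glueLeaves i h).1 ∘ i.predAbove = f.1 :=
  comp_succAbove_comp_predAbove _ _ h

/-- The tree `d_i ∘ f` obtained by gluing the height-one vertices `i` and `i+1`. -/
def TwoTree.glueVertices {p q : ℕ} (f : TwoTree p (q + 1)) (i : Fin (q + 1)) : TwoTree p q :=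
  ⟨i.predAbove ∘ f.1, (predAbove_monotone i).comp f.2.1, (predAbove_surjective i).comp f.2.2⟩

/-- The permutations of the source that preserve the fibres of `g` and are order-preserving on
the fibres of `f`. -/
def fibreShuffles {m a b : ℕ} (f : Fin m → Fin a) (g : Fin m → Fin b) :
    Finset (Equiv.Perm (Fin m)) :=
  Finset.univ.filter fun τ => (∀ x y, x < y → f x = f y → τ x < τ y) ∧ ∀ x, g (τ x) = g x

theorem mem_fibreShuffles {m a b : ℕ} {f : Fin m → Fin a} {g : Fin m → Fin b}
    {τ : Equiv.Perm (Fin m)} : τ ∈ fibreShuffles f g ↔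
      (∀ x y, x < y → f x = f y → τ x < τ y) ∧ ∀ x, g (τ x) = g x := by
  simp [fibreShuffles]

/-- The shuffles of the fibres `f⁻¹(i)` and `f⁻¹(i+1)`, extended by the identity. -/
def TwoTree.shuffles {p q : ℕ} (f : TwoTree p (q + 1)) (i : Fin (q + 1)) :
    Finset (Equiv.Perm (Fin (p + 1))) :=
  fibreShuffles f.1 (f.glueVertices i).1

/-- Edges are labelled from `1` on, from bottom to top and from left to right. The label of the
`i`-th leaf is `(i + 1) + (f(i) + 1)`. -/
def TwoTree.leafLabel {p q : ℕ} (f : TwoTree p q) (i : Fin (p + 1)) : ℕ :=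
  ((i : ℕ) + 1) + ((f.1 i : ℕ) + 1)

/-- The label of the rightmost top edge over the height-one vertex `i`. -/
def TwoTree.vertexLabel {p q : ℕ} (f : TwoTree p q) (i : Fin (q + 1)) : ℕ :=
  ((i : ℕ) + 1) + (Finset.univ.filter fun x => f.1 x ≤ i).card

/-! Combinatorics -/

theorem predAbove_predAbove {n : ℕ} {i j : Fin (n + 1)} (h : i ≤ j) (x : Fin (n + 3)) :
    j.predAbove (i.castSucc.predAbove x) = i.predAbove (j.succ.predAbove x) := by
  ext
  simp only [val_predAbove, Fin.val_castSucc, Fin.val_succ]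
  rw [Fin.le_def] at h
  split_ifs <;> omega

theorem shuffle_mul_inj {m a b c : ℕ} {f : Fin m → Fin a} {g : Fin m → Fin b} {h : Fin m → Fin c}
    (hg : Monotone g) {τ₁ τ₂ τ₁' τ₂' : Equiv.Perm (Fin m)}
    (h₁ : τ₁ ∈ fibreShuffles f g) (h₂ : τ₂ ∈ fibreShuffles f g)
    (h₁' : τ₁' ∈ fibreShuffles g h) (h₂' : τ₂' ∈ fibreShuffles g h)
    (e : τ₁' * τ₁ = τ₂' * τ₂) : τ₁ = τ₂ := by
  rw [mem_fibreShuffles] at h₁ h₂ h₁' h₂'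
  set ω := τ₂ * τ₁⁻¹ with hω
  have hgω : ∀ u, g (ω u) = g u := fun u => by
    rw [hω, Equiv.Perm.mul_apply, h₂.2, ← h₁.2]; simp
  have hτ : ∀ u, τ₂' (ω u) = τ₁' u := fun u => by
    have := congrArg (fun σ => (σ * τ₁⁻¹) u) e
    simpa [hω, mul_assoc] using this.symm
  have hmono : StrictMono ω := by
    intro u v huv
    rcases (hg huv.le).lt_or_eq with hlt | heq
    · by_contra hc
      have := hg (not_lt.1 hc)
      rw [hgω, hgω] at this
      exact absurd hlt (not_lt.2 this)
    · have h3 := h₁'.1 u v huv heq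
      rw [← hτ, ← hτ] at h3
      rcases lt_trichotomy (ω u) (ω v) with h4 | h4 | h4
      · exact h4
      · exact absurd (ω.injective h4) huv.ne
      · exact absurd (h₂'.1 _ _ h4 (by rw [hgω, hgω, heq])) (not_lt.2 h3.le)
  have : ω = 1 := by
    have hid : (ω : Fin m → Fin m) = id := by
      have := Tuple.unique_monotone (f := (id : Fin m → Fin m)) (σ := ω) (τ := 1)
        hmono.monotone monotone_id
      simpa using this
    ext x; simp [hid]
  rw [hω, mul_inv_eq_one] at this
  exact this.symm

theorem sum_shuffles_mul {m a b c : ℕ} {M : Type*} [AddCommMonoid M]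
    {f : Fin m → Fin a} {g : Fin m → Fin b} {h : Fin m → Fin c} (s : Fin a → Fin b)
    (s' : Fin b → Fin c) (hgf : g = s ∘ f) (hhg : h = s' ∘ g) (hg : Monotone g)
    (F : Equiv.Perm (Fin m) → M) :
    ∑ τ ∈ fibreShuffles f g, ∑ τ' ∈ fibreShuffles g h, F (τ' * τ) =
      ∑ ρ ∈ fibreShuffles f h, F ρ := by
  rw [← Finset.sum_product' _ _ fun τ τ' => F (τ' * τ)]
  refine Finset.sum_bij (fun x _ => x.2 * x.1) ?_ ?_ ?_ ?_
  · rintro ⟨τ, τ'⟩ hx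
    obtain ⟨h1, h2⟩ := Finset.mem_product.1 hx
    rw [mem_fibreShuffles] at h1 h2 ⊢
    refine ⟨fun x y hxy hf => h2.1 _ _ (h1.1 x y hxy hf) ?_, fun x => ?_⟩
    · rw [h1.2, h1.2, hgf]; exact congrArg s hf
    · rw [Equiv.Perm.mul_apply, h2.2, hhg]; exact congrArg s' (h1.2 x)
  · rintro ⟨τ₁, τ₁'⟩ hx ⟨τ₂, τ₂'⟩ hy e
    obtain ⟨h1, h2⟩ := Finset.mem_product.1 hx
    obtain ⟨h3, h4⟩ := Finset.mem_product.1 hy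
    have := shuffle_mul_inj hg h1 h3 h2 h4 e
    subst this
    simpa using e
  · intro ρ hρ
    rw [mem_fibreShuffles] at hρ
    let K : Fin m → Lex (Fin b × Fin m) := fun x => toLex (g x, ρ x)
    have hK : Function.Injective K := fun x y e => by
      have := congrArg (fun z => (ofLex z).2) e
      exact ρ.injective this
    set π := Tuple.sort K with hπ
    have hKπ : StrictMono (K ∘ π) :=
      (Tuple.monotone_sort K).strictMono_of_injective (hK.comp π.injective)
    have hKlt : ∀ x y, π⁻¹ x < π⁻¹ y ↔ K x < K y := fun x y => by
      have := hKπ.lt_iff_lt (a := π⁻¹ x) (b := π⁻¹ y)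
      simpa using this.symm
    have hgπ : ∀ x, g (π x) = g x := by
      have hm : Monotone (g ∘ π) := fun x y hxy => by
        have := (hKπ.monotone hxy)
        exact Prod.Lex.monotone_fst _ _ this
      have := Tuple.unique_monotone (f := g) (σ := π) (τ := 1) hm (by simpa using hg)
      exact fun x => congrFun this x
    refine ⟨(π⁻¹, ρ * π), Finset.mem_product.2 ⟨?_, ?_⟩, by simp [mul_assoc]⟩
    · rw [mem_fibreShuffles]
      refine ⟨fun x y hxy hf => (hKlt x y).2 ?_, fun x => ?_⟩
      · refine Prod.Lex.toLex_lt_toLex.2 (Or.inr ⟨?_, hρ.1 x y hxy hf⟩)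
        rw [hgf]; exact congrArg s hf
      · rw [← hgπ]; simp
    · rw [mem_fibreShuffles]
      refine ⟨fun x y hxy hf => ?_, fun x => ?_⟩
      · have := hKπ hxy
        rcases Prod.Lex.toLex_lt_toLex.1 this with h1 | h1
        · simp only [hgπ, hf, lt_irrefl] at h1
        · exact h1.2
      · rw [Equiv.Perm.mul_apply, hρ.2, hhg]
        exact congrArg s' (hgπ x)
  · intros; rfl

/-- The permutation sending `a` to `b` and, away from `a` and `b`, given by `τ`. -/
def insertPerm {n : ℕ} (a b : Fin (n + 1)) (τ : Equiv.Perm (Fin n)) : Equiv.Perm (Fin (n + 1)) :=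
  ((finSuccEquiv' a).trans (Equiv.optionCongr τ)).trans (finSuccEquiv' b).symm

theorem insertPerm_self {n : ℕ} (a b : Fin (n + 1)) (τ : Equiv.Perm (Fin n)) :
    insertPerm a b τ a = b := by simp [insertPerm]

theorem insertPerm_succAbove {n : ℕ} (a b : Fin (n + 1)) (τ : Equiv.Perm (Fin n)) (x : Fin n) :
    insertPerm a b τ (a.succAbove x) = b.succAbove (τ x) := by simp [insertPerm]

theorem exists_insertPerm {n : ℕ} (a : Fin (n + 1)) (ρ : Equiv.Perm (Fin (n + 1))) :
    ∃ τ, ρ = insertPerm a (ρ a) τ := by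
  let e : Option (Fin n) ≃ Option (Fin n) :=
    ((finSuccEquiv' a).symm.trans ρ).trans (finSuccEquiv' (ρ a))
  refine ⟨Equiv.removeNone e, ?_⟩
  have he : Equiv.optionCongr (Equiv.removeNone e) = e := by
    have hn : e none = none := by simp [e]
    ext1 x
    cases x with
    | none => simp [hn]
    | some x =>
      have : e (some x) ≠ none := fun h => by
        have := e.injective (h.trans hn.symm)
        cases this
      obtain ⟨y, hy⟩ := Option.ne_none_iff_exists'.1 this
      simp [hn]
  ext x
  simp [insertPerm, he, e]

theorem sign_insertPerm {n : ℕ} (a b : Fin (n + 1)) (τ : Equiv.Perm (Fin n)) :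
    ((Equiv.Perm.sign (insertPerm a b τ) : ℤˣ) : ℤ) =
      (-1) ^ ((a : ℕ) + b) * (Equiv.Perm.sign τ : ℤˣ) := by
  have h : b.cycleRange * insertPerm a b τ = insertPerm 0 0 τ * a.cycleRange := by
    ext x
    rcases eq_or_ne x a with rfl | hx
    · simp [insertPerm_self]
    · obtain ⟨y, rfl⟩ := Fin.exists_succAbove_eq hx
      have := insertPerm_succAbove 0 0 τ y
      simp only [Fin.succAbove_zero] at this
      simp [insertPerm_succAbove, this]
  have h0 : insertPerm 0 0 τ = Equiv.Perm.decomposeFin.symm (0, τ) := by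
    ext x
    refine Fin.cases ?_ (fun y => ?_) x
    · simp [insertPerm_self]
    · have := insertPerm_succAbove 0 0 τ y
      simp only [Fin.succAbove_zero] at this
      simp [this]
  have hs := congrArg (fun σ => ((Equiv.Perm.sign σ : ℤˣ) : ℤ)) h
  simp only [h0, Equiv.Perm.sign_mul, Fin.sign_cycleRange, Equiv.Perm.decomposeFin.symm_sign,
    Units.val_mul, Units.val_pow_eq_pow_val, Units.val_neg, Units.val_one] at hs
  have hb : ((-1 : ℤ) ^ (b : ℕ)) * (-1) ^ (b : ℕ) = 1 := by
    rw [← mul_pow]; simp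
  calc ((Equiv.Perm.sign (insertPerm a b τ) : ℤˣ) : ℤ)
      = ((-1) ^ (b : ℕ) * (-1) ^ (b : ℕ)) * (Equiv.Perm.sign (insertPerm a b τ) : ℤˣ) := by
        rw [hb, one_mul]
    _ = _ := by rw [mul_assoc, hs, pow_add]; simp; ring

theorem two_trees_eq {p : ℕ} {b : ℕ} {g : Fin (p + 1) → Fin b} (hg : Monotone g)
    {a j : Fin (p + 1)} (h : g j = g a) : g ∘ j.predAbove = g ∘ a.predAbove := by
  have key : ∀ {a j : Fin (p + 1)}, a ≤ j → g j = g a → g ∘ j.predAbove = g ∘ a.predAbove := by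
    intro a j haj h
    funext x
    simp only [Function.comp]
    rw [Fin.le_def] at haj
    by_cases hx : (a : ℕ) < x ∧ (x : ℕ) ≤ j
    · have h1 : a ≤ a.predAbove x := by
        rw [Fin.le_def, val_predAbove]; split_ifs <;> omega
      have h2 : a.predAbove x ≤ j.predAbove x := by
        rw [Fin.le_def, val_predAbove, val_predAbove]; split_ifs <;> omega
      have h3 : j.predAbove x ≤ j := by
        rw [Fin.le_def, val_predAbove]; split_ifs <;> omega
      exact le_antisymm (((hg h3).trans h.le).trans (hg h1)) (hg h2)
    · congr 1
      ext
      rw [val_predAbove, val_predAbove]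
      split_ifs <;> omega
  rcases le_total a j with h' | h'
  · exact key h' h
  · exact (key h' h.symm).symm

theorem predAbove_comp_insertPerm {p : ℕ} (a : Fin (p + 1)) (τ' : Equiv.Perm (Fin (p + 1))) :
    (τ' a).predAbove ∘ insertPerm a.succ (τ' a).succ τ' = τ' ∘ a.predAbove := by
  funext x
  rcases eq_or_ne x a.succ with rfl | hx
  · simp [insertPerm_self]
  · obtain ⟨y, rfl⟩ := Fin.exists_succAbove_eq hx
    simp only [Function.comp, insertPerm_succAbove, predAbove_succAbove]

theorem insertPerm_castSucc {p : ℕ} (a : Fin (p + 1)) (τ' : Equiv.Perm (Fin (p + 1))) :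
    insertPerm a.succ (τ' a).succ τ' a.castSucc = (τ' a).castSucc := by
  have h : ∀ i : Fin (p + 1), i.succ.succAbove i = i.castSucc := fun i => by
    simp [Fin.succAbove, Fin.lt_def]
  rw [← h a, insertPerm_succAbove, h]

theorem predAbove_lt {p : ℕ} {a : Fin (p + 1)} {x y : Fin (p + 2)} (hxy : x < y) :
    a.predAbove x < a.predAbove y ∨ (x = a.castSucc ∧ y = a.succ) := by
  rw [Fin.lt_def] at *
  simp only [val_predAbove, Fin.ext_iff, Fin.val_castSucc, Fin.val_succ]
  split_ifs <;> omega

theorem glue_forward {p b c : ℕ} {f : Fin (p + 2) → Fin b} (hf : Monotone f) {s : Fin b → Fin c}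
    (hs : Monotone s) {a : Fin (p + 1)} (h : f a.castSucc = f a.succ)
    {τ' : Equiv.Perm (Fin (p + 1))}
    (hτ' : τ' ∈ fibreShuffles (f ∘ a.succ.succAbove) (s ∘ f ∘ a.succ.succAbove)) :
    insertPerm a.succ (τ' a).succ τ' ∈ fibreShuffles f (s ∘ f) ∧
      (s ∘ f) (τ' a).castSucc = (s ∘ f) (τ' a).succ ∧
      s ∘ f ∘ a.succ.succAbove = (s ∘ f) ∘ (τ' a).succ.succAbove := by
  rw [mem_fibreShuffles] at hτ'
  set f' := f ∘ a.succ.succAbove with hf'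
  have hff : f' ∘ a.predAbove = f := comp_succAbove_comp_predAbove f a h
  have hf'm : Monotone f' := hf.comp (Fin.strictMono_succAbove _).monotone
  have hg' : Monotone (s ∘ f') := hs.comp hf'm
  have hja : (s ∘ f') (τ' a) = (s ∘ f') a := hτ'.2 a
  have hgj : (s ∘ f') ∘ (τ' a).predAbove = s ∘ f := by
    rw [two_trees_eq hg' hja, Function.comp_assoc, hff]
  have hpt := fun x => congrFun (predAbove_comp_insertPerm a τ') x
  simp only [Function.comp] at hpt
  refine ⟨?_, ?_, ?_⟩
  · rw [mem_fibreShuffles]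
    refine ⟨fun x y hxy hfxy => ?_, fun x => ?_⟩
    · rcases predAbove_lt (a := a) hxy with h1 | ⟨rfl, rfl⟩
      · have h2 := hτ'.1 _ _ h1 (by
          have hx := congrFun hff x
          have hy := congrFun hff y
          simp only [Function.comp] at hx hy ⊢
          rw [hx, hy, hfxy])
        rw [← hpt, ← hpt] at h2
        exact (predAbove_monotone _).reflect_lt h2
      · rw [insertPerm_castSucc, insertPerm_self]
        exact Fin.castSucc_lt_succ
    · rw [← hgj]
      have h1 := hτ'.2 (a.predAbove x)
      simp only [Function.comp] at h1 ⊢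
      rw [hpt, h1]
      exact (congrArg s (congrFun hff x)).trans (congrFun hgj x).symm
  · rw [← hgj]; simp
  · rw [← hgj]
    funext x
    simp [predAbove_succAbove]

theorem glue_backward {p b c : ℕ} {f : Fin (p + 2) → Fin b} (hf : Monotone f) {s : Fin b → Fin c}
    (hs : Monotone s) {j : Fin (p + 1)} {τ : Equiv.Perm (Fin (p + 2))}
    (hτ : τ ∈ fibreShuffles f (s ∘ f)) (hj : (s ∘ f) j.castSucc = (s ∘ f) j.succ)
    (hfj : f (τ⁻¹ j.castSucc) = f (τ⁻¹ j.succ)) :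
    ∃ (a : Fin (p + 1)) (τ' : Equiv.Perm (Fin (p + 1))), f a.castSucc = f a.succ ∧
      τ' ∈ fibreShuffles (f ∘ a.succ.succAbove) (s ∘ f ∘ a.succ.succAbove) ∧
      τ' a = j ∧ insertPerm a.succ (τ' a).succ τ' = τ := by
  rw [mem_fibreShuffles] at hτ
  obtain ⟨x, hx⟩ : ∃ x, τ x = j.castSucc := ⟨τ⁻¹ j.castSucc, by simp⟩
  obtain ⟨y, hy⟩ : ∃ y, τ y = j.succ := ⟨τ⁻¹ j.succ, by simp⟩
  have hx' : τ⁻¹ j.castSucc = x := by rw [← hx]; simp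
  have hy' : τ⁻¹ j.succ = y := by rw [← hy]; simp
  rw [hx', hy'] at hfj
  have hxy : x < y := by
    rcases lt_trichotomy x y with h | h | h
    · exact h
    · rw [h, hy] at hx; simp [Fin.ext_iff] at hx
    · have := hτ.1 y x h hfj.symm
      rw [hx, hy, Fin.lt_def] at this
      simp at this
  have hyx : (y : ℕ) = x + 1 := by
    by_contra hne
    rw [Fin.lt_def] at hxy
    have hlt : (x : ℕ) + 1 < y := by omega
    let z : Fin (p + 2) := ⟨x + 1, by omega⟩
    have h1 : x < z := by rw [Fin.lt_def]; simp [z]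
    have h2 : z < y := by rw [Fin.lt_def]; exact hlt
    have h3 : f x = f z := le_antisymm (hf h1.le) ((hf h2.le).trans hfj.ge)
    have h4 := hτ.1 x z h1 h3
    have h5 := hτ.1 z y h2 (h3.symm.trans hfj)
    rw [hx, Fin.lt_def] at h4
    rw [hy, Fin.lt_def] at h5
    simp at h4 h5; omega
  obtain ⟨a, rfl, rfl⟩ : ∃ a : Fin (p + 1), x = a.castSucc ∧ y = a.succ :=
    ⟨⟨x, by have := y.2; omega⟩, by ext; rfl, by ext; simp [hyx]⟩
  obtain ⟨τ', hτ'⟩ := exists_insertPerm a.succ τ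
  rw [hy] at hτ'
  have haa : ∀ i : Fin (p + 1), i.succ.succAbove i = i.castSucc := fun i => by
    simp [Fin.succAbove, Fin.lt_def]
  have hja : τ' a = j := by
    have h1 := insertPerm_succAbove a.succ j.succ τ' a
    rw [← hτ', haa, hx, ← haa j] at h1
    exact (Fin.succAbove_right_injective h1).symm
  refine ⟨a, τ', hfj, ?_, hja, by rw [hja, ← hτ']⟩
  have hval : ∀ u, τ (a.succ.succAbove u) = j.succ.succAbove (τ' u) := fun u => by
    rw [hτ', insertPerm_succAbove]
  rw [mem_fibreShuffles]
  refine ⟨fun u v huv hf' => ?_, fun u => ?_⟩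
  · have h1 := hτ.1 _ _ (Fin.strictMono_succAbove a.succ huv) hf'
    rw [hval, hval] at h1
    exact (Fin.strictMono_succAbove _).lt_iff_lt.1 h1
  · have hff : (f ∘ a.succ.succAbove) ∘ a.predAbove = f := comp_succAbove_comp_predAbove f a hfj
    have hm : Monotone (s ∘ f ∘ a.succ.succAbove) :=
      hs.comp (hf.comp (Fin.strictMono_succAbove _).monotone)
    have hga : (s ∘ f) j.castSucc = (s ∘ f) a.castSucc := by
      have := hτ.2 a.castSucc; rwa [hx] at this
    have hga' : (s ∘ f) a.castSucc = (s ∘ f) a.succ := congrArg s hfj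
    have hg : (s ∘ f ∘ a.succ.succAbove) j = (s ∘ f ∘ a.succ.succAbove) a := by
      change (s ∘ f) (a.succ.succAbove j) = (s ∘ f) (a.succ.succAbove a)
      rw [haa]
      rcases lt_or_ge j.castSucc a.succ with h | h
      · rw [Fin.succAbove_of_castSucc_lt _ _ h]; exact hga
      · rw [Fin.succAbove_of_le_castSucc _ _ h, ← hj]; exact hga
    have hgj : (s ∘ f ∘ a.succ.succAbove) ∘ j.predAbove = s ∘ f := by
      rw [two_trees_eq hm hg]
      exact congrArg (s ∘ ·) hff
    have h1 := hτ.2 (a.succ.succAbove u)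
    rw [hval] at h1
    have h2 := congrFun hgj (j.succ.succAbove (τ' u))
    simp only [Function.comp, predAbove_succAbove] at h1 h2 ⊢
    rw [h2, h1]

theorem lin_comp_sum {R M N P ι : Type*} [CommRing R] [AddCommGroup M] [AddCommGroup N]
    [AddCommGroup P] [Module R M] [Module R N] [Module R P] (s : Finset ι) (g : N →ₗ[R] P)
    (f : ι → M →ₗ[R] N) : g ∘ₗ ∑ i ∈ s, f i = ∑ i ∈ s, g ∘ₗ f i := by
  ext x; simp

theorem lin_sum_comp {R M N P ι : Type*} [CommRing R] [AddCommGroup M] [AddCommGroup N]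
    [AddCommGroup P] [Module R M] [Module R N] [Module R P] (s : Finset ι) (g : ι → N →ₗ[R] P)
    (f : M →ₗ[R] N) : (∑ i ∈ s, g i) ∘ₗ f = ∑ i ∈ s, g i ∘ₗ f := by
  ext x; simp

section Complexes
variable (k : Type u) [CommRing k] (A : Type v) [NonUnitalCommRing A] [Module k A]
  [IsScalarTower k A A] [SMulCommClass k A A]

/-- `b' = ∑_{i=0}^{n} (-1)^i d_i : A^{⊗(n+2)} → A^{⊗(n+1)}`, where `d_i` multiplies the factors
`i` and `i+1`. -/
noncomputable def barD (n : ℕ) : (⨂[k]^(n + 2) A) →ₗ[k] (⨂[k]^(n + 1) A) :=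
  ∑ i : Fin (n + 1), (-1 : k) ^ (i : ℕ) • push k i.predAbove

theorem barD_comp (n : ℕ) : barD k A n ∘ₗ barD k A (n + 1) = 0 := by
  rw [barD, barD, lin_comp_sum]
  simp only [lin_sum_comp, LinearMap.smul_comp, LinearMap.comp_smul,
    push_push k (predAbove_surjective _) (predAbove_surjective _), Finset.smul_sum]
  apply sum_cancel
  intro i j hij
  have : (j.predAbove ∘ i.castSucc.predAbove : Fin (n + 3) → _) =
      i.predAbove ∘ j.succ.predAbove := funext fun x => predAbove_predAbove hij x
  rw [this, Fin.val_castSucc, Fin.val_succ, pow_succ, smul_smul, smul_smul, ← add_smul]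
  convert zero_smul k _ using 2
  ring

/-- The bar complex, with `A^{⊗(n+1)}` in degree `n`. -/
noncomputable def barComplex : ChainComplex (ModuleCat.{max u v} k) ℕ :=
  ChainComplex.of (fun n => ModuleCat.of k (⨂[k]^(n + 1) A))
    (fun n => ModuleCat.ofHom (barD k A n)) fun n => by
      rw [← ModuleCat.ofHom_comp, barD_comp]; rfl

/-- The `(p, q)` spot `⨁_{[p] → [q]} A^{⊗(p+1)}` of the double complex. -/
abbrev BiModule (p q : ℕ) : Type (max u v) := ⨁ _ : TwoTree p q, ⨂[k]^(p + 1) A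

/-- The map `A^{⊗m} → A^{⊗(p+1)}` induced by `σ`, with target the summand of `f`. -/
noncomputable def pushTo {m p q : ℕ} (f : TwoTree p q) (σ : Fin m → Fin (p + 1)) :
    (⨂[k]^m A) →ₗ[k] BiModule k A p q :=
  DirectSum.lof k (TwoTree p q) (fun _ => ⨂[k]^(p + 1) A) f ∘ₗ push k σ

/-- The differential that multiplies neighbouring leaves over the same height-one vertex. -/
noncomputable def leafD (p q : ℕ) : BiModule k A (p + 1) q →ₗ[k] BiModule k A p q :=
  DirectSum.toModule k _ _ fun f => ∑ i : Fin (p + 1),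
    if h : f.1 i.castSucc = f.1 i.succ then
      (-1 : k) ^ f.leafLabel i.castSucc • pushTo k A (f.glueLeaves i h) i.predAbove
    else 0

/-- The shuffle differential, which glues neighbouring height-one vertices and shuffles the leaves
over them. -/
noncomputable def shuffleD (p q : ℕ) : BiModule k A p (q + 1) →ₗ[k] BiModule k A p q :=
  DirectSum.toModule k _ _ fun f => ∑ i : Fin (q + 1),
    (-1 : k) ^ f.vertexLabel i.castSucc •
      ∑ τ ∈ f.shuffles i, ((Equiv.Perm.sign τ : ℤ) : k) • pushTo k A (f.glueVertices i) τ

variable {A} in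
theorem leafD_lof {p q : ℕ} (f : TwoTree (p + 1) q) :
    leafD k A p q ∘ₗ DirectSum.lof k _ (fun _ => ⨂[k]^(p + 2) A) f = ∑ i : Fin (p + 1),
    if h : f.1 i.castSucc = f.1 i.succ then
      (-1 : k) ^ f.leafLabel i.castSucc • pushTo k A (f.glueLeaves i h) i.predAbove
    else 0 := by
  ext1; ext1 x
  simp [leafD, DirectSum.toModule_lof]

theorem shuffleD_lof {p q : ℕ} (f : TwoTree p (q + 1)) :
    shuffleD k A p q ∘ₗ DirectSum.lof k _ (fun _ => ⨂[k]^(p + 1) A) f = ∑ i : Fin (q + 1),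
    (-1 : k) ^ f.vertexLabel i.castSucc •
      ∑ τ ∈ f.shuffles i, ((Equiv.Perm.sign τ : ℤ) : k) • pushTo k A (f.glueVertices i) τ := by
  ext1; ext1 x
  simp [shuffleD, DirectSum.toModule_lof]

theorem leafD_pushTo {m p q : ℕ} (f : TwoTree (p + 1) q) {σ : Fin m → Fin (p + 2)}
    (hσ : Function.Surjective σ) :
    leafD k A p q ∘ₗ pushTo k A f σ = ∑ i : Fin (p + 1),
    if h : f.1 i.castSucc = f.1 i.succ then
      (-1 : k) ^ f.leafLabel i.castSucc • pushTo k A (f.glueLeaves i h) (i.predAbove ∘ σ)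
    else 0 := by
  rw [pushTo, ← LinearMap.comp_assoc, leafD_lof, lin_sum_comp]
  refine Finset.sum_congr rfl fun i _ => ?_
  split_ifs with h
  · rw [LinearMap.smul_comp, pushTo, LinearMap.comp_assoc,
      push_push k hσ (predAbove_surjective i)]; rfl
  · rfl

theorem shuffleD_pushTo {m p q : ℕ} (f : TwoTree p (q + 1)) {σ : Fin m → Fin (p + 1)}
    (hσ : Function.Surjective σ) :
    shuffleD k A p q ∘ₗ pushTo k A f σ = ∑ i : Fin (q + 1),
    (-1 : k) ^ f.vertexLabel i.castSucc •
      ∑ τ ∈ f.shuffles i, ((Equiv.Perm.sign τ : ℤ) : k) •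
        pushTo k A (f.glueVertices i) (τ ∘ σ) := by
  rw [pushTo, ← LinearMap.comp_assoc, shuffleD_lof, lin_sum_comp]
  refine Finset.sum_congr rfl fun i _ => ?_
  rw [LinearMap.smul_comp, lin_sum_comp]
  congr 1
  refine Finset.sum_congr rfl fun τ _ => ?_
  rw [LinearMap.smul_comp, pushTo, LinearMap.comp_assoc, push_push k hσ τ.surjective]; rfl

theorem leafD_comp (p q : ℕ) : leafD k A p q ∘ₗ leafD k A (p + 1) q = 0 := by
  refine DirectSum.linearMap_ext _ fun f => ?_
  rw [LinearMap.comp_assoc, leafD_lof, lin_comp_sum]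
  rw [LinearMap.zero_comp]
  have : ∀ i : Fin (p + 2), (leafD k A p q ∘ₗ
      if h : f.1 i.castSucc = f.1 i.succ then
      (-1 : k) ^ f.leafLabel i.castSucc • pushTo k A (f.glueLeaves i h) i.predAbove else 0) =
      ∑ j : Fin (p + 1), if h : f.1 i.castSucc = f.1 i.succ then
        if h' : (f.glueLeaves i h).1 j.castSucc = (f.glueLeaves i h).1 j.succ then
        ((-1 : k) ^ f.leafLabel i.castSucc * (-1) ^ (f.glueLeaves i h).leafLabel j.castSucc) •
          pushTo k A ((f.glueLeaves i h).glueLeaves j h') (j.predAbove ∘ i.predAbove)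
        else 0 else 0 := by
    intro i
    split_ifs with h
    · rw [LinearMap.comp_smul, leafD_pushTo _ _ _ (predAbove_surjective _), Finset.smul_sum]
      refine Finset.sum_congr rfl fun j _ => ?_
      split_ifs
      · rw [smul_smul]
      · rw [smul_zero]
    · simp
  rw [Finset.sum_congr rfl fun i _ => this i]
  refine sum_cancel (M := (⨂[k]^(p + 3) A) →ₗ[k] BiModule k A p q) p _ ?_
  intro i j hij
  have hij' : (i : ℕ) ≤ j := hij
  have e1 : i.castSucc.succ.succAbove j.castSucc = if i = j then j.castSucc.castSucc else j.castSucc.succ := by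
    ext; simp only [Fin.succAbove, Fin.lt_def, Fin.ext_iff]; split_ifs  <;> (simp at *; try omega)
  have e2 : i.castSucc.succ.succAbove j.succ = j.succ.succ := by
    ext; simp only [Fin.succAbove, Fin.lt_def]; split_ifs  <;> (simp at *; try omega)
  have e3 : j.succ.succ.succAbove i.castSucc = i.castSucc.castSucc := by
    ext; simp only [Fin.succAbove, Fin.lt_def]; split_ifs  <;> (simp at *; try omega)
  have e4 : j.succ.succ.succAbove i.succ = i.castSucc.succ := by
    ext; simp only [Fin.succAbove, Fin.lt_def]; split_ifs  <;> (simp at *; try omega)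
  by_cases h1 : f.1 i.castSucc.castSucc = f.1 i.castSucc.succ
  swap
  · have h2 : ∀ h, ¬ (f.glueLeaves j.succ h).1 i.castSucc = (f.glueLeaves j.succ h).1 i.succ := by
      intro h
      simpa only [TwoTree.glueLeaves, Function.comp, e3, e4] using h1
    simp [h1, h2]
  have e5 : (f.glueLeaves i.castSucc h1).1 j.castSucc = f.1 j.succ.castSucc := by
    simp only [TwoTree.glueLeaves, Function.comp, e1]
    split_ifs with h
    · subst h; rw [h1]; rfl
    · rfl
  by_cases h3 : f.1 j.succ.castSucc = f.1 j.succ.succ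
  swap
  · have h2 : ¬ (f.glueLeaves i.castSucc h1).1 j.castSucc = (f.glueLeaves i.castSucc h1).1 j.succ := by
      rw [e5]
      simpa only [TwoTree.glueLeaves, Function.comp, e2] using h3
    rw [dif_pos h1, dif_neg h2, dif_neg h3, add_zero]
  have h2 : (f.glueLeaves i.castSucc h1).1 j.castSucc = (f.glueLeaves i.castSucc h1).1 j.succ := by
      rw [e5]
      simpa only [TwoTree.glueLeaves, Function.comp, e2] using h3
  have h4 : (f.glueLeaves j.succ h3).1 i.castSucc = (f.glueLeaves j.succ h3).1 i.succ := by
      simpa only [TwoTree.glueLeaves, Function.comp, e3, e4] using h1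
  rw [dif_pos h1, dif_pos h2, dif_pos h3, dif_pos h4]
  have hσ : (j.predAbove ∘ i.castSucc.predAbove : Fin (p + 3) → _) =
      i.predAbove ∘ j.succ.predAbove := funext fun x => predAbove_predAbove hij x
  have ht : (f.glueLeaves i.castSucc h1).glueLeaves j h2 =
      (f.glueLeaves j.succ h3).glueLeaves i h4 := by
    apply Subtype.ext
    have hs : Function.Surjective (j.predAbove ∘ i.castSucc.predAbove : Fin (p + 3) → _) :=
      (predAbove_surjective _).comp (predAbove_surjective _)
    apply hs.injective_comp_right
    change _ ∘ _ = _ ∘ _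
    rw [← Function.comp_assoc, TwoTree.glueLeaves_comp, TwoTree.glueLeaves_comp, hσ,
      ← Function.comp_assoc, TwoTree.glueLeaves_comp, TwoTree.glueLeaves_comp]
  rw [hσ, ht, ← add_smul]
  convert zero_smul k _ using 2
  have e6 : (f.glueLeaves j.succ h3).1 i.castSucc = f.1 i.castSucc.castSucc := by
    simp only [TwoTree.glueLeaves, Function.comp, e3]
  simp only [TwoTree.leafLabel, e5, e6, Fin.val_castSucc, Fin.val_succ]
  ring

theorem shuffleD_comp (p q : ℕ) : shuffleD k A p q ∘ₗ shuffleD k A p (q + 1) = 0 := by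
  refine DirectSum.linearMap_ext _ fun f => ?_
  rw [LinearMap.comp_assoc, shuffleD_lof, lin_comp_sum, LinearMap.zero_comp]
  have : ∀ i : Fin (q + 2), (shuffleD k A p q ∘ₗ ((-1 : k) ^ f.vertexLabel i.castSucc •
      ∑ τ ∈ f.shuffles i, ((Equiv.Perm.sign τ : ℤ) : k) • pushTo k A (f.glueVertices i) τ)) =
      ∑ j : Fin (q + 1), ((-1 : k) ^ f.vertexLabel i.castSucc *
        (-1) ^ (f.glueVertices i).vertexLabel j.castSucc) •
        ∑ ρ ∈ fibreShuffles f.1 ((f.glueVertices i).glueVertices j).1,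
          ((Equiv.Perm.sign ρ : ℤ) : k) • pushTo k A ((f.glueVertices i).glueVertices j) ρ := by
    intro i
    have : ∀ j : Fin (q + 1), ∑ ρ ∈ fibreShuffles f.1 ((f.glueVertices i).glueVertices j).1,
          ((Equiv.Perm.sign ρ : ℤ) : k) • pushTo k A ((f.glueVertices i).glueVertices j) ρ =
        ∑ τ ∈ f.shuffles i, ∑ τ' ∈ (f.glueVertices i).shuffles j,
          ((Equiv.Perm.sign (τ' * τ) : ℤ) : k) •
            pushTo k A ((f.glueVertices i).glueVertices j) (τ' * τ) := fun j =>
      (sum_shuffles_mul (f := f.1) (g := (f.glueVertices i).1)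
        (h := ((f.glueVertices i).glueVertices j).1) i.predAbove j.predAbove rfl rfl
        (f.glueVertices i).2.1 (fun ρ : Equiv.Perm (Fin (p + 1)) => ((Equiv.Perm.sign ρ : ℤ) : k) •
          pushTo k A ((f.glueVertices i).glueVertices j) ρ)).symm
    simp only [this]
    simp only [LinearMap.comp_smul, lin_comp_sum, shuffleD_pushTo _ _ _ (Equiv.surjective _),
      Finset.smul_sum]
    rw [Finset.sum_comm]
    refine Finset.sum_congr rfl fun j _ => Finset.sum_congr rfl fun τ _ =>
      Finset.sum_congr rfl fun τ' _ => ?_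
    rw [smul_smul, smul_smul, smul_smul, smul_smul]
    congr 1
    simp only [Equiv.Perm.sign_mul, Units.val_mul, Int.cast_mul]
    ring
  rw [Finset.sum_congr rfl fun i _ => this i]
  refine sum_cancel (M := (⨂[k]^(p + 1) A) →ₗ[k] BiModule k A p q) q _ ?_
  intro i j hij
  have hij' : (i : ℕ) ≤ j := hij
  have ht : (f.glueVertices i.castSucc).glueVertices j =
      (f.glueVertices j.succ).glueVertices i :=
    Subtype.ext (funext fun x => predAbove_predAbove hij _)
  rw [ht, ← add_smul]
  convert zero_smul k _ using 2
  have c1 : ∀ x : Fin (p + 1), (f.glueVertices i.castSucc).1 x ≤ j.castSucc ↔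
      f.1 x ≤ j.succ.castSucc := by
    intro x
    simp only [TwoTree.glueVertices, Function.comp, Fin.le_def, val_predAbove, Fin.val_castSucc,
      Fin.val_succ]
    split_ifs <;> omega
  have c2 : ∀ x : Fin (p + 1), (f.glueVertices j.succ).1 x ≤ i.castSucc ↔
      f.1 x ≤ i.castSucc.castSucc := by
    intro x
    simp only [TwoTree.glueVertices, Function.comp, Fin.le_def, val_predAbove, Fin.val_castSucc,
      Fin.val_succ]
    split_ifs <;> omega
  simp only [TwoTree.vertexLabel, c1, c2, Fin.val_castSucc, Fin.val_succ]
  ring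


theorem sum_add_sum_eq_zero {ι κ M : Type*} [AddCommGroup M] {s : Finset ι} {t : Finset κ}
    {f : ι → M} {g : κ → M} (e : ∀ a ∈ s, κ) (he : ∀ a ha, e a ha ∈ t)
    (hinj : ∀ a₁ h₁ a₂ h₂, e a₁ h₁ = e a₂ h₂ → a₁ = a₂) (hsurj : ∀ b ∈ t, ∃ a ha, e a ha = b)
    (h : ∀ a ha, f a = -g (e a ha)) : ∑ b ∈ t, g b + ∑ a ∈ s, f a = 0 := by
  have := Finset.sum_bij (f := f) (g := fun b => -g b) e he hinj hsurj h
  rw [this, Finset.sum_neg_distrib, add_neg_cancel]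

theorem smul_eq_neg_smul {R M : Type*} [Ring R] [AddCommGroup M] [Module R M] {c d : R}
    (h : c = -d) (x : M) : c • x = -(d • x) := by
  rw [h, neg_smul]

theorem sum_split_zero {p b c : ℕ} {M : Type*} [AddCommGroup M] [Module k M]
    (f : Fin (p + 2) → Fin b) (g : Fin (p + 2) → Fin c) (j : Fin (p + 1))
    (hj : g j.castSucc = g j.succ) (F : (Fin (p + 2) → Fin (p + 1)) → M) :
    ∑ τ ∈ (fibreShuffles f g).filter (fun τ => ¬ f (τ⁻¹ j.castSucc) = f (τ⁻¹ j.succ)),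
      ((Equiv.Perm.sign τ : ℤ) : k) • F (j.predAbove ∘ τ) = 0 := by
  have hne : j.castSucc ≠ j.succ := by simp [Fin.ext_iff]
  refine Finset.sum_involution (fun τ _ => Equiv.swap j.castSucc j.succ * τ) ?_ ?_ ?_ ?_
  · intro τ _
    have h1 : j.predAbove ∘ (Equiv.swap j.castSucc j.succ * τ : Equiv.Perm (Fin (p + 2))) =
        j.predAbove ∘ τ := by
      funext x
      simp only [Function.comp, Equiv.Perm.mul_apply]
      rcases Equiv.swap_apply_eq_iff.1 (rfl : Equiv.swap j.castSucc j.succ (τ x) = _) with _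
      by_cases h2 : τ x = j.castSucc
      · rw [h2, Equiv.swap_apply_left]; simp
      · by_cases h3 : τ x = j.succ
        · rw [h3, Equiv.swap_apply_right]; simp
        · rw [Equiv.swap_apply_of_ne_of_ne h2 h3]
    rw [h1, Equiv.Perm.sign_mul, Equiv.Perm.sign_swap hne]
    simp
  · intro τ _ _ h
    have : Equiv.swap j.castSucc j.succ = 1 := mul_eq_right.1 h
    exact hne (Equiv.swap_eq_one_iff.1 this)
  · intro τ hτ
    obtain ⟨h1, h2⟩ := Finset.mem_filter.1 hτ
    rw [mem_fibreShuffles] at h1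
    rw [Finset.mem_filter, mem_fibreShuffles]
    refine ⟨⟨fun x y hxy hf => ?_, fun x => ?_⟩, ?_⟩
    · have h3 := h1.1 x y hxy hf
      rw [Equiv.Perm.mul_apply, Equiv.Perm.mul_apply]
      have h4 : ¬ (τ x = j.castSucc ∧ τ y = j.succ) := by
        rintro ⟨h5, h6⟩
        apply h2
        rw [← h5, ← h6]; simpa using hf
      rw [Fin.lt_def] at h3 ⊢
      simp only [Equiv.swap_apply_def, Fin.ext_iff, Fin.val_castSucc, Fin.val_succ] at h4 ⊢
      split_ifs <;> (try simp only [Fin.val_castSucc, Fin.val_succ]) <;> omega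
    · rw [Equiv.Perm.mul_apply, ← h1.2 x]
      by_cases h2 : τ x = j.castSucc
      · rw [h2, Equiv.swap_apply_left, hj]
      · by_cases h3 : τ x = j.succ
        · rw [h3, Equiv.swap_apply_right, hj]
        · rw [Equiv.swap_apply_of_ne_of_ne h2 h3]
    · simpa [mul_inv_rev, eq_comm] using h2
  · intro τ _
    rw [← mul_assoc, Equiv.swap_mul_self, one_mul]

theorem card_glueLeaves {p q : ℕ} (f : TwoTree (p + 1) q) (a : Fin (p + 1))
    (h : f.1 a.castSucc = f.1 a.succ) (i : Fin (q + 1)) :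
    (Finset.univ.filter fun x => f.1 x ≤ i).card =
      (Finset.univ.filter fun x => (f.glueLeaves a h).1 x ≤ i).card +
        if f.1 a.castSucc ≤ i then 1 else 0 := by
  simp only [Finset.card_filter]
  rw [Fin.sum_univ_succAbove _ a.succ, add_comm, h]
  rfl

theorem leafD_shuffleD_aux {p q : ℕ} (f : TwoTree (p + 1) (q + 1)) (i : Fin (q + 1)) :
    (∑ j : Fin (p + 1), ∑ τ ∈ f.shuffles i,
      if h : (f.glueVertices i).1 j.castSucc = (f.glueVertices i).1 j.succ then
        ((-1 : k) ^ f.vertexLabel i.castSucc * (-1) ^ (f.glueVertices i).leafLabel j.castSucc *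
          ((Equiv.Perm.sign τ : ℤ) : k)) •
          pushTo k A ((f.glueVertices i).glueLeaves j h) (j.predAbove ∘ τ) else 0) +
    (∑ a : Fin (p + 1), if h : f.1 a.castSucc = f.1 a.succ then
      ∑ τ' ∈ (f.glueLeaves a h).shuffles i,
        ((-1 : k) ^ f.leafLabel a.castSucc * (-1) ^ (f.glueLeaves a h).vertexLabel i.castSucc *
          ((Equiv.Perm.sign τ' : ℤ) : k)) •
          pushTo k A ((f.glueLeaves a h).glueVertices i) (τ' ∘ a.predAbove) else 0) = 0 := by
  classical
  have step : ∀ j : Fin (p + 1), (∑ τ ∈ f.shuffles i,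
      if h : (f.glueVertices i).1 j.castSucc = (f.glueVertices i).1 j.succ then
        ((-1 : k) ^ f.vertexLabel i.castSucc * (-1) ^ (f.glueVertices i).leafLabel j.castSucc *
          ((Equiv.Perm.sign τ : ℤ) : k)) •
          pushTo k A ((f.glueVertices i).glueLeaves j h) (j.predAbove ∘ τ) else 0) =
      if h : (f.glueVertices i).1 j.castSucc = (f.glueVertices i).1 j.succ then
      ∑ τ ∈ (f.shuffles i).filter (fun τ => f.1 (τ⁻¹ j.castSucc) = f.1 (τ⁻¹ j.succ)),
        ((-1 : k) ^ f.vertexLabel i.castSucc * (-1) ^ (f.glueVertices i).leafLabel j.castSucc *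
          ((Equiv.Perm.sign τ : ℤ) : k)) •
          pushTo k A ((f.glueVertices i).glueLeaves j h) (j.predAbove ∘ τ) else 0 := by
    intro j
    split_ifs with h
    · rw [← Finset.sum_filter_add_sum_filter_not (f.shuffles i)
        (fun τ => f.1 (τ⁻¹ j.castSucc) = f.1 (τ⁻¹ j.succ))]
      convert add_zero _
      have := sum_split_zero k f.1 (f.glueVertices i).1 j h
        (fun σ => pushTo k A ((f.glueVertices i).glueLeaves j h) σ)
      simp only [mul_smul]
      rw [← Finset.smul_sum, ← Finset.smul_sum]
      erw [this]
      simp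
    · simp
  rw [Finset.sum_congr rfl fun j _ => step j]
  have e1 : ∀ (j : Fin (p + 1)), (if h : (f.glueVertices i).1 j.castSucc =
        (f.glueVertices i).1 j.succ then
      ∑ τ ∈ (f.shuffles i).filter (fun τ => f.1 (τ⁻¹ j.castSucc) = f.1 (τ⁻¹ j.succ)),
        ((-1 : k) ^ f.vertexLabel i.castSucc * (-1) ^ (f.glueVertices i).leafLabel j.castSucc *
          ((Equiv.Perm.sign τ : ℤ) : k)) •
          pushTo k A ((f.glueVertices i).glueLeaves j h) (j.predAbove ∘ τ) else 0) =
      ∑ τ ∈ (f.shuffles i).filter (fun τ => f.1 (τ⁻¹ j.castSucc) = f.1 (τ⁻¹ j.succ) ∧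
          (f.glueVertices i).1 j.castSucc = (f.glueVertices i).1 j.succ),
        if h : (f.glueVertices i).1 j.castSucc = (f.glueVertices i).1 j.succ then
        ((-1 : k) ^ f.vertexLabel i.castSucc * (-1) ^ (f.glueVertices i).leafLabel j.castSucc *
          ((Equiv.Perm.sign τ : ℤ) : k)) •
          pushTo k A ((f.glueVertices i).glueLeaves j h) (j.predAbove ∘ τ) else 0 := by
    intro j
    by_cases h : (f.glueVertices i).1 j.castSucc = (f.glueVertices i).1 j.succ
    · simp [h]
    · simp [h]
  have e2 : ∀ (a : Fin (p + 1)), (if h : f.1 a.castSucc = f.1 a.succ then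
      ∑ τ' ∈ (f.glueLeaves a h).shuffles i,
        ((-1 : k) ^ f.leafLabel a.castSucc * (-1) ^ (f.glueLeaves a h).vertexLabel i.castSucc *
          ((Equiv.Perm.sign τ' : ℤ) : k)) •
          pushTo k A ((f.glueLeaves a h).glueVertices i) (τ' ∘ a.predAbove) else 0) =
      ∑ τ' ∈ Finset.univ.filter (fun τ' : Equiv.Perm (Fin (p + 1)) =>
          ∃ h : f.1 a.castSucc = f.1 a.succ, τ' ∈ (f.glueLeaves a h).shuffles i),
        if h : f.1 a.castSucc = f.1 a.succ then
        ((-1 : k) ^ f.leafLabel a.castSucc * (-1) ^ (f.glueLeaves a h).vertexLabel i.castSucc *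
          ((Equiv.Perm.sign τ' : ℤ) : k)) •
          pushTo k A ((f.glueLeaves a h).glueVertices i) (τ' ∘ a.predAbove) else 0 := by
    intro a
    by_cases h : f.1 a.castSucc = f.1 a.succ
    · simp only [h, dite_true, exists_true_left]
      refine Finset.sum_congr ?_ fun _ _ => rfl
      ext; simp
    · simp [h]
  rw [Finset.sum_congr rfl fun j _ => e1 j, Finset.sum_congr rfl fun j _ => e2 j,
    Finset.sum_sigma', Finset.sum_sigma']
  have hfw : ∀ (a : Fin (p + 1)) (τ' : Equiv.Perm (Fin (p + 1)))
      (h : f.1 a.castSucc = f.1 a.succ), τ' ∈ (f.glueLeaves a h).shuffles i →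
      insertPerm a.succ (τ' a).succ τ' ∈ f.shuffles i ∧
      (f.glueVertices i).1 (τ' a).castSucc = (f.glueVertices i).1 (τ' a).succ ∧
      ((f.glueLeaves a h).glueVertices i).1 =
        (f.glueVertices i).1 ∘ (τ' a).succ.succAbove := fun a τ' h hτ' =>
    glue_forward f.2.1 (predAbove_monotone i) h hτ'
  have hinv : ∀ (a : Fin (p + 1)) (τ' : Equiv.Perm (Fin (p + 1))),
      (insertPerm a.succ (τ' a).succ τ')⁻¹ (τ' a).castSucc = a.castSucc ∧
      (insertPerm a.succ (τ' a).succ τ')⁻¹ (τ' a).succ = a.succ := fun a τ' => by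
    rw [Equiv.Perm.inv_eq_iff_eq, Equiv.Perm.inv_eq_iff_eq, insertPerm_castSucc, insertPerm_self]
    exact ⟨rfl, rfl⟩
  refine sum_add_sum_eq_zero (M := (⨂[k]^(p + 2) A) →ₗ[k] BiModule k A p q)
    (fun x _ => ⟨x.2 x.1, insertPerm x.1.succ (x.2 x.1).succ x.2⟩) ?_ ?_ ?_ ?_
  · rintro ⟨a, τ'⟩ hx
    simp only [Finset.mem_sigma, Finset.mem_univ, true_and, Finset.mem_filter] at hx ⊢
    obtain ⟨h, hτ'⟩ := hx
    obtain ⟨h1, h2, -⟩ := hfw a τ' h hτ'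
    refine ⟨h1, ?_, h2⟩
    rw [(hinv a τ').1, (hinv a τ').2, h]
  · rintro ⟨a, τ₁⟩ hx ⟨b, τ₂⟩ hy e
    simp only [Sigma.mk.injEq, heq_eq_eq] at e
    obtain ⟨h1, h2⟩ := e
    have h3 := (hinv a τ₁).2
    rw [h2, h1, (hinv b τ₂).2] at h3
    have h4 := Fin.succ_injective _ h3
    subst h4
    congr 1
    ext1 u
    have h5 := insertPerm_succAbove b.succ (τ₁ b).succ τ₁ u
    rw [h2, h1, insertPerm_succAbove] at h5
    exact (Fin.succAbove_right_injective h5).symm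
  · rintro ⟨j, τ⟩ hx
    simp only [Finset.mem_sigma, Finset.mem_univ, true_and, Finset.mem_filter] at hx
    obtain ⟨a, τ', h1, h2, h3, h4⟩ := glue_backward f.2.1 (predAbove_monotone i) hx.1 hx.2.2 hx.2.1
    refine ⟨⟨a, τ'⟩, ?_, ?_⟩
    · simp only [Finset.mem_sigma, Finset.mem_univ, true_and, Finset.mem_filter]
      exact ⟨h1, h2⟩
    · simp only [h3]
      rw [h3] at h4
      rw [h4]
  · rintro ⟨a, τ'⟩ hx
    simp only [Finset.mem_sigma, Finset.mem_univ, true_and, Finset.mem_filter] at hx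
    obtain ⟨h, hτ'⟩ := hx
    obtain ⟨h1, h2, h3⟩ := hfw a τ' h hτ'
    rw [dif_pos h, dif_pos h2, predAbove_comp_insertPerm]
    have ht : (f.glueLeaves a h).glueVertices i = (f.glueVertices i).glueLeaves (τ' a) h2 :=
      Subtype.ext h3
    rw [ht]
    refine smul_eq_neg_smul (M := (⨂[k]^(p + 2) A) →ₗ[k] BiModule k A p q) ?_ _
    have hs := congrArg (Int.cast : ℤ → k) (sign_insertPerm a.succ (τ' a).succ τ')
    push_cast at hs
    rw [hs]
    have hg : (f.glueVertices i).1 (τ' a).castSucc = i.predAbove (f.1 a.castSucc) := by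
      have := (mem_fibreShuffles.1 h1).2 a.castSucc
      rw [insertPerm_castSucc] at this
      exact this
    have hc := card_glueLeaves f a h i.castSucc
    have hfi : (f.1 a.castSucc : ℕ) + (if f.1 a.castSucc ≤ i.castSucc then 1 else 0) =
        (i.predAbove (f.1 a.castSucc) : ℕ) + 1 := by
      rw [val_predAbove]
      simp only [Fin.le_def, Fin.val_castSucc]
      split_ifs <;> omega
    simp only [TwoTree.leafLabel, TwoTree.vertexLabel, hg, hc, Fin.val_castSucc, Fin.val_succ]
    have hfi' := congrArg (fun n : ℕ => (-1 : k) ^ n) hfi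
    have hsq : ∀ n : ℕ, ((-1 : k) ^ n) * (-1) ^ n = 1 := fun n => by rw [← mul_pow]; simp
    have hJ := hsq (τ' a : ℕ)
    have hD := hsq (if f.1 a.castSucc ≤ i.castSucc then 1 else 0)
    simp only [pow_add, pow_one] at hfi' ⊢
    generalize ((Equiv.Perm.sign τ' : ℤ) : k) = S
    generalize (-1 : k) ^ (Finset.univ.filter fun x => (f.glueLeaves a h).1 x ≤ i.castSucc).card = C
    generalize (-1 : k) ^ (if f.1 a.castSucc ≤ i.castSucc then 1 else 0) = D at *
    generalize (-1 : k) ^ (i.predAbove (f.1 a.castSucc) : ℕ) = P at *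
    generalize (-1 : k) ^ (f.1 a.castSucc : ℕ) = U at *
    generalize (-1 : k) ^ (τ' a : ℕ) = J at *
    generalize (-1 : k) ^ (a : ℕ) = A'
    generalize (-1 : k) ^ (i : ℕ) = I
    linear_combination (-I * C * D * A' * S * J * J) * hfi' + I * C * A' * S * U * D * D * hJ +
      I * C * A' * S * U * hD

theorem leafD_shuffleD (p q : ℕ) :
    leafD k A p q ∘ₗ shuffleD k A (p + 1) q + shuffleD k A p q ∘ₗ leafD k A p (q + 1) = 0 := by
  refine DirectSum.linearMap_ext _ fun f => ?_
  rw [LinearMap.add_comp, LinearMap.comp_assoc, LinearMap.comp_assoc, leafD_lof, shuffleD_lof,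
    lin_comp_sum, lin_comp_sum, LinearMap.zero_comp]
  have h1 : ∀ i : Fin (q + 1), leafD k A p q ∘ₗ ((-1 : k) ^ f.vertexLabel i.castSucc •
      ∑ τ ∈ f.shuffles i, ((Equiv.Perm.sign τ : ℤ) : k) • pushTo k A (f.glueVertices i) τ) =
      ∑ j : Fin (p + 1), ∑ τ ∈ f.shuffles i,
      if h : (f.glueVertices i).1 j.castSucc = (f.glueVertices i).1 j.succ then
        ((-1 : k) ^ f.vertexLabel i.castSucc * (-1) ^ (f.glueVertices i).leafLabel j.castSucc *
          ((Equiv.Perm.sign τ : ℤ) : k)) •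
          pushTo k A ((f.glueVertices i).glueLeaves j h) (j.predAbove ∘ τ) else 0 := by
    intro i
    rw [LinearMap.comp_smul, lin_comp_sum, Finset.sum_comm, Finset.smul_sum]
    refine Finset.sum_congr rfl fun τ _ => ?_
    rw [LinearMap.comp_smul, leafD_pushTo _ _ _ τ.surjective, Finset.smul_sum, Finset.smul_sum]
    refine Finset.sum_congr rfl fun j _ => ?_
    split_ifs
    · rw [smul_smul, smul_smul]; congr 1; ring
    · simp
  have h2 : ∀ a : Fin (p + 1), (shuffleD k A p q ∘ₗ if h : f.1 a.castSucc = f.1 a.succ then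
      (-1 : k) ^ f.leafLabel a.castSucc • pushTo k A (f.glueLeaves a h) a.predAbove else 0) =
      ∑ i : Fin (q + 1), if h : f.1 a.castSucc = f.1 a.succ then
      ∑ τ' ∈ (f.glueLeaves a h).shuffles i,
        ((-1 : k) ^ f.leafLabel a.castSucc * (-1) ^ (f.glueLeaves a h).vertexLabel i.castSucc *
          ((Equiv.Perm.sign τ' : ℤ) : k)) •
          pushTo k A ((f.glueLeaves a h).glueVertices i) (τ' ∘ a.predAbove) else 0 := by
    intro a
    split_ifs with h
    · rw [LinearMap.comp_smul, shuffleD_pushTo _ _ _ (predAbove_surjective _), Finset.smul_sum]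
      refine Finset.sum_congr rfl fun i _ => ?_
      rw [smul_smul, Finset.smul_sum]
      refine Finset.sum_congr rfl fun τ' _ => ?_
      rw [smul_smul]
    · simp
  rw [Finset.sum_congr rfl fun i _ => h1 i, Finset.sum_congr rfl fun a _ => h2 a]
  conv_lhs => enter [2]; rw [Finset.sum_comm]
  rw [← Finset.sum_add_distrib]
  exact Finset.sum_eq_zero fun i _ => leafD_shuffleD_aux k A f i

/-- The row of the double complex with `q + 1` height-one vertices, with differential `leafD`. -/
noncomputable def rowComplex (q : ℕ) : ChainComplex (ModuleCat.{max u v} k) ℕ :=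
  ChainComplex.of (fun p => ModuleCat.of k (BiModule k A p q))
    (fun p => ModuleCat.ofHom (leafD k A p q)) fun p => by
      rw [← ModuleCat.ofHom_comp, leafD_comp]; rfl

/-- `⨁_{p+q=n} C_{(p,q)}`. -/
abbrev TotModule (n : ℕ) : Type (max u v) :=
  ⨁ x : {x : ℕ × ℕ // x.1 + x.2 = n}, BiModule k A x.1.1 x.1.2

/-- The inclusion `C_{(p,q)} → Tot_n`, for `p + q = n`. -/
noncomputable def toTot (n p q : ℕ) (h : p + q = n) : BiModule k A p q →ₗ[k] TotModule k A n :=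
  DirectSum.lof k {x : ℕ × ℕ // x.1 + x.2 = n} (fun x => BiModule k A x.1.1 x.1.2)
    ⟨(p, q), h⟩

/-- `leafD` as a map to the total complex; it vanishes on `C_{(0,q)}`. -/
noncomputable def leafTot (n : ℕ) :
    ∀ p q : ℕ, p + q = n + 1 → (BiModule k A p q →ₗ[k] TotModule k A n)
  | 0, _, _ => 0
  | p + 1, q, h => toTot k A n p q (by omega) ∘ₗ leafD k A p q

/-- `shuffleD` as a map to the total complex; it vanishes on `C_{(p,0)}`. -/
noncomputable def shuffleTot (n : ℕ) :
    ∀ p q : ℕ, p + q = n + 1 → (BiModule k A p q →ₗ[k] TotModule k A n)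
  | _, 0, _ => 0
  | p, q + 1, h => toTot k A n p q (by omega) ∘ₗ shuffleD k A p q

/-- The total differential, the sum of the two differentials of the double complex. -/
noncomputable def totD (n : ℕ) : TotModule k A (n + 1) →ₗ[k] TotModule k A n :=
  DirectSum.toModule k _ _ fun x =>
    leafTot k A n x.1.1 x.1.2 x.2 +
      shuffleTot k A n x.1.1 x.1.2 x.2

theorem totD_toTot (n p q : ℕ) (h : p + q = n + 1) :
    totD k A n ∘ₗ toTot k A (n + 1) p q h = leafTot k A n p q h + shuffleTot k A n p q h := by
  refine LinearMap.ext fun x => ?_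
  rw [LinearMap.comp_apply, totD, toTot, DirectSum.toModule_lof]

theorem totD_comp (n : ℕ) : totD k A n ∘ₗ totD k A (n + 1) = 0 := by
  refine DirectSum.linearMap_ext _ fun ⟨⟨p, q⟩, hx⟩ => ?_
  have h : p + q = n + 1 + 1 := hx
  change (totD k A n ∘ₗ totD k A (n + 1)) ∘ₗ toTot k A (n + 1 + 1) p q h = 0 ∘ₗ _
  rw [LinearMap.comp_assoc, totD_toTot, LinearMap.zero_comp, LinearMap.comp_add]
  have a0 := fun p q => leafD_comp k A p q
  have a1 := fun p q => shuffleD_comp k A p q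
  have a2 := fun p q => (add_comm (shuffleD k A p q ∘ₗ leafD k A p (q + 1)) _).trans
    (leafD_shuffleD k A p q)
  have e1 : ∀ (m p q : ℕ) (h : p + q = m + 1) {N : Type (max u v)} [AddCommGroup N] [Module k N]
      (g : N →ₗ[k] BiModule k A p q), totD k A m ∘ₗ toTot k A (m + 1) p q h ∘ₗ g =
        leafTot k A m p q h ∘ₗ g + shuffleTot k A m p q h ∘ₗ g := fun m p q h N _ _ g => by
    rw [← LinearMap.comp_assoc, totD_toTot, LinearMap.add_comp]
  rcases p with _ | _ | p <;> rcases q with _ | _ | q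
  · omega
  · omega
  · simp only [leafTot, shuffleTot, e1, LinearMap.comp_zero, LinearMap.zero_comp,
      LinearMap.comp_assoc, a1, add_zero]
  · omega
  · simp only [leafTot, shuffleTot, e1, LinearMap.comp_assoc, LinearMap.zero_comp, add_zero,
      zero_add]
    rw [← LinearMap.comp_add, a2, LinearMap.comp_zero]
  · simp only [leafTot, shuffleTot, e1, LinearMap.comp_assoc, LinearMap.zero_comp, add_zero,
      zero_add, a1, LinearMap.comp_zero]
    rw [← LinearMap.comp_add, a2, LinearMap.comp_zero]
  · simp only [leafTot, shuffleTot, e1, LinearMap.comp_assoc, LinearMap.zero_comp, add_zero,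
      a0, LinearMap.comp_zero]
  · simp only [leafTot, shuffleTot, e1, LinearMap.comp_assoc, LinearMap.zero_comp, add_zero,
      zero_add, a0, LinearMap.comp_zero]
    rw [← LinearMap.comp_add, a2, LinearMap.comp_zero]
  · simp only [leafTot, shuffleTot, e1, LinearMap.comp_assoc, a0, a1, LinearMap.comp_zero,
      add_zero, zero_add]
    rw [← LinearMap.comp_add, a2, LinearMap.comp_zero]

/-- The total complex of the double complex. -/
noncomputable def totalComplex : ChainComplex (ModuleCat.{max u v} k) ℕ :=
  ChainComplex.of (fun n => ModuleCat.of k (TotModule k A n))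
    (fun n => ModuleCat.ofHom (totD k A n)) fun n => by
      rw [← ModuleCat.ofHom_comp, totD_comp]; rfl

/-- Bar homology `H^bar_n(A)`. -/
noncomputable abbrev barHomology (n : ℕ) : ModuleCat.{max u v} k := (barComplex k A).homology n

/-- `E_2`-homology `H^{E_2}_n(A)`. -/
noncomputable abbrev e2Homology (n : ℕ) : ModuleCat.{max u v} k := (totalComplex k A).homology n

/-- The filtration of `Tot_n` by the number of height-one vertices: elements with components only
in the spots `(p, q)` with `q ≤ s`. -/
noncomputable def totFiltration (n : ℕ) (s : ℤ) : Submodule k (TotModule k A n) :=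
  ⨅ x : {x : ℕ × ℕ // x.1 + x.2 = n}, ⨅ _ : s < (x.1.2 : ℤ),
    LinearMap.ker (DirectSum.component k _ (fun x => BiModule k A x.1.1 x.1.2) x)

/-- The induced filtration of `E_2`-homology: classes that are represented by a cycle in
`totFiltration`. -/
noncomputable def e2Filtration (n : ℕ) (s : ℤ) : Submodule k (e2Homology k A n) :=
  ((totFiltration k A n s).comap ((totalComplex k A).iCycles n).hom).map
    ((totalComplex k A).homologyπ n).hom

end Complexes

/-- The tuples `(ℓ_0, …, ℓ_q)` of natural numbers with `ℓ_0 + ⋯ + ℓ_q = p - q`. -/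
abbrev Degrees (p q : ℕ) : Type := {l : Fin (q + 1) → ℕ // ∑ i, l i + q = p}

/-- The juxtaposition `z_0 ⊗ ⋯ ⊗ z_q ∈ A^{⊗(p+1)}` of tensors `z_i ∈ A^{⊗(ℓ_i+1)}`, that is, their
product in the tensor algebra `⨁ n, A^{⊗n}`. -/
noncomputable def juxtapose (k : Type u) [CommRing k] {A : Type v} [NonUnitalCommRing A]
    [Module k A] {p q : ℕ} (l : Degrees p q) (z : ∀ i, ⨂[k]^(l.1 i + 1) A) : ⨂[k]^(p + 1) A :=
  (List.ofFn fun i => DirectSum.of (fun n => ⨂[k]^n A) (l.1 i + 1) (z i)).prod (p + 1)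

/-- First quadrant homological spectral sequences of `k`-modules, starting with `E^1`, with
`d^r : E^r_{p,q} → E^r_{p+r-1,q-r}`. -/
abbrev E1SpectralSequence (k : Type u) [CommRing k] :=
  SpectralSequence (ModuleCat.{max u v} k)
    (fun r => ComplexShape.spectralSequenceNat ((r - 1, -r) : ℤ × ℤ)) 1

/-- Convergence of `E` to graded modules `H` with filtration `F`. No nonzero differential starts or
ends at `E^r_{p,q}` for `r ≥ max(p + 2, q + 1)`, so that `E^r_{p,q} = E^∞_{p,q}`. -/
def ConvergesTo {k : Type u} [CommRing k] (E : E1SpectralSequence.{u, v} k)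
    (H : ℕ → ModuleCat.{max u v} k) (F : ∀ n, ℤ → Submodule k (H n)) : Prop :=
  (∀ n, Monotone (F n)) ∧ (∀ n, F n (-1) = ⊥) ∧ (∀ n : ℕ, F n n = ⊤) ∧
    ∀ (p q : ℕ) (r : ℤ) (hr : 1 ≤ r), (p : ℤ) + 2 ≤ r → (q : ℤ) + 1 ≤ r →
      Nonempty ((E.page r hr).X (p, q) ≃ₗ[k]
        (F (p + q) q ⧸ (F (p + q) (q - 1)).submoduleOf (F (p + q) q)))

end E2Homology

open E2Homology

/-!
The spectral sequence is that of the total complex, filtered by the number `q + 1` of height-one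
vertices. The differential `leafD` preserves `q` and `shuffleD` lowers it by one, so the graded
pieces of the filtration are the rows `rowComplex k A q`; the first page is their homology
(`exists_row_equiv_page`), and `d¹` is induced by `shuffleD` (`exists_page_d_eq`). The filtration of
the total complex in degree `n` is bounded by `0 ≤ q ≤ n`. Hence the pages become stationary and give
the graded pieces of the homology (`FilteredComplex.exists_page_iso`,
`FilteredComplex.exists_equiv_graded`).

It remains to identify the homology of a row. Cutting off the leaves over the leftmost height-one
vertex of a tree identifies the row `q + 1` with the tensor product of the bar complex and the row
`q` (`graftMul`). This is compatible with the differentials: `leafD` never multiplies leaves over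
different vertices, and the part of its sign that depends on the vertex is the Koszul sign
(`rowSumD_graftMul`). The row `0` is the bar complex. As `A` and its bar homology are flat, so are
the cycles and boundaries of the bar complex (`flat_cycles`, `flat_boundaries`), and the Künneth
theorem (`IsHomology.exists_kunneth`) gives by induction on `q` the isomorphism of the homology of
the row `q` with the tensor power of bar homology (`exists_total_kunneth`).

The Künneth theorem is stated and applied for differential modules without grading, that is, for the
direct sums of the terms of the complexes. The grading only enters through the sign involution `ε`,
and it is recovered at the end, because the isomorphism respects the degree (`exists_fibre_equiv`).
-/

namespace E2Homology

/-! ### Homology of complexes of modules in terms of elements -/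

section ElementwiseHomology

variable {k : Type u} [Ring k] {ι : Type*} {c : ComplexShape ι}
  (K : HomologicalComplex (ModuleCat.{v} k) c)

theorem iCycles_injective (i : ι) : Function.Injective (K.iCycles i).hom :=
  (ModuleCat.mono_iff_injective _).1 inferInstance

theorem homologyπ_surjective (i : ι) : Function.Surjective (K.homologyπ i).hom :=
  (ModuleCat.epi_iff_surjective _).1 inferInstance

theorem d_iCycles_apply (i j : ι) (z : K.cycles i) : (K.d i j).hom ((K.iCycles i).hom z) = 0 :=
  congrArg (fun f => f.hom z) (K.iCycles_d i j)

theorem d_d_apply (i j l : ι) (x : K.X i) : (K.d j l).hom ((K.d i j).hom x) = 0 :=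
  congrArg (fun f => f.hom x) (K.d_comp_d i j l)

theorem exists_iCycles_eq {i : ι} {x : K.X i} (hx : ∀ j, (K.d i j).hom x = 0) :
    ∃ z, (K.iCycles i).hom z = x := by
  have := (ShortComplex.moduleCat_exact_iff _).1
    (ShortComplex.exact_of_f_is_kernel (ShortComplex.mk _ _ (K.iCycles_d i (c.next i)))
      (K.cyclesIsKernel i _ rfl)) x (hx _)
  exact this

theorem homologyπ_eq_zero_iff {i : ι} (z : K.cycles i) :
    (K.homologyπ i).hom z = 0 ↔ ∃ j y, (K.d j i).hom y = (K.iCycles i).hom z := by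
  constructor
  · intro h
    obtain ⟨y, hy⟩ := (ShortComplex.moduleCat_exact_iff _).1
      (ShortComplex.exact_of_g_is_cokernel (ShortComplex.mk _ _
        (K.toCycles_comp_homologyπ (c.prev i) i)) (K.homologyIsCokernel _ i rfl)) z h
    refine ⟨c.prev i, y, ?_⟩
    rw [← K.toCycles_i]
    exact congrArg (K.iCycles i).hom hy
  · rintro ⟨j, y, hy⟩
    have : z = (K.toCycles j i).hom y := iCycles_injective K i (by
      rw [← hy, ← K.toCycles_i]; rfl)
    rw [this]
    exact congrArg (fun f => f.hom y) (K.toCycles_comp_homologyπ j i)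

/-- A presentation `X ⧸ W` of the homology of `K` in degree `i`, from a linear map `φ` onto the
cycles up to boundaries such that `W` consists of the elements that are mapped to boundaries. -/
theorem exists_homologyEquiv {X : Type*} [AddCommGroup X] [Module k X] (i : ι)
    (φ : X →ₗ[k] K.X i) (W : Submodule k X) (h0 : ∀ x j, (K.d i j).hom (φ x) = 0)
    (h1 : ∀ y, (∀ j, (K.d i j).hom y = 0) → ∃ x j w, y = φ x + (K.d j i).hom w)
    (h2 : ∀ x, x ∈ W ↔ ∃ j w, (K.d j i).hom w = φ x) :
    ∃ e : (X ⧸ W) ≃ₗ[k] K.homology i, ∀ x z, (K.iCycles i).hom z = φ x →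
      e (Submodule.Quotient.mk x) = (K.homologyπ i).hom z := by
  let ι' : K.cycles i ≃ₗ[k] LinearMap.range (K.iCycles i).hom :=
    LinearEquiv.ofInjective _ (iCycles_injective K i)
  let ψ : X →ₗ[k] K.homology i := (K.homologyπ i).hom ∘ₗ ι'.symm.toLinearMap ∘ₗ
    φ.codRestrict _ fun x => exists_iCycles_eq K (h0 x)
  have hψ : ∀ x z, (K.iCycles i).hom z = φ x → ψ x = (K.homologyπ i).hom z := by
    intro x z h
    refine congrArg (K.homologyπ i).hom (ι'.symm_apply_eq.2 (Subtype.ext ?_))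
    exact h.symm
  have hker : W = LinearMap.ker ψ := by
    ext x
    obtain ⟨z, hz⟩ := exists_iCycles_eq K (h0 x)
    rw [h2, LinearMap.mem_ker, hψ x z hz, homologyπ_eq_zero_iff, hz]
  have hsurj : Function.Surjective ψ := by
    intro y
    obtain ⟨z, rfl⟩ := homologyπ_surjective K i y
    obtain ⟨x, j, w, h⟩ := h1 _ fun j => d_iCycles_apply K i j z
    refine ⟨x, ?_⟩
    obtain ⟨z', hz'⟩ := exists_iCycles_eq K (h0 x)
    rw [hψ x z' hz', ← sub_eq_zero, ← map_sub, homologyπ_eq_zero_iff]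
    refine ⟨j, -w, ?_⟩
    rw [map_sub, hz', h, map_neg]
    abel
  subst hker
  exact ⟨ψ.quotKerEquivOfSurjective hsurj, fun x z h => hψ x z h⟩

end ElementwiseHomology

/-! ### The spectral sequence of a filtered complex -/

section Filtered

variable {k : Type u} [Ring k]

/-- A chain complex of modules with an increasing filtration by subcomplexes `F s`, such that
`F s` vanishes for `s < 0` and is everything in degrees `n ≤ s`. -/
structure FilteredComplex (k : Type u) [Ring k] where
  /-- the underlying complex -/
  K : ChainComplex (ModuleCat.{v} k) ℕ
  /-- the filtration -/
  F : ∀ n, ℤ → Submodule k (K.X n)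
  mono : ∀ n, Monotone (F n)
  d_mem : ∀ i j s x, x ∈ F i s → (K.d i j).hom x ∈ F j s
  eq_bot : ∀ n s, s < 0 → F n s = ⊥
  eq_top : ∀ (n : ℕ) (s : ℤ), n ≤ s → F n s = ⊤

namespace FilteredComplex

variable (T : FilteredComplex.{u, v} k)

theorem d_eq_zero {i j : ℕ} (h : i ≠ j + 1) : T.K.d i j = 0 :=
  T.K.shape _ _ fun h' => h h'.symm

/-- The elements of filtration `s` whose differential has filtration `s - r`. -/
def Z (r s : ℤ) (n : ℕ) : Submodule k (T.K.X n) :=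
  T.F n s ⊓ ⨅ j, (T.F j (s - r)).comap (T.K.d n j).hom

/-- The denominator of `E r s n`: elements of lower filtration, and boundaries of elements whose
filtration is less than `s + r`. -/
def B (r s : ℤ) (n : ℕ) : Submodule k (T.K.X n) :=
  T.Z (r - 1) (s - 1) n ⊔ (T.Z (r - 1) (s + r - 1) (n + 1)).map (T.K.d (n + 1) n).hom

theorem mem_Z {r s : ℤ} {n : ℕ} {x : T.K.X n} :
    x ∈ T.Z r s n ↔ x ∈ T.F n s ∧ ∀ j, (T.K.d n j).hom x ∈ T.F j (s - r) := by
  simp [Z]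

/-- The degree of `y` is arbitrary: outside degree `n + 1` its differential in degree `n`
is zero. -/
theorem mem_B {r s : ℤ} {n : ℕ} {x : T.K.X n} :
    x ∈ T.B r s n ↔ ∃ a ∈ T.Z (r - 1) (s - 1) n, ∃ m, ∃ y ∈ T.Z (r - 1) (s + r - 1) m,
      x = a + (T.K.d m n).hom y := by
  constructor
  · intro h
    obtain ⟨a, ha, b, ⟨y, hy, rfl⟩, rfl⟩ := Submodule.mem_sup.1 h
    exact ⟨a, ha, n + 1, y, hy, rfl⟩
  · rintro ⟨a, ha, m, y, hy, rfl⟩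
    refine add_mem (Submodule.mem_sup_left ha) ?_
    by_cases hm : m = n + 1
    · subst hm
      exact Submodule.mem_sup_right ⟨y, hy, rfl⟩
    · rw [T.d_eq_zero hm]
      exact zero_mem _

theorem Z_mono {r r' s s' : ℤ} {n : ℕ} (h : s ≤ s') (h' : s - r ≤ s' - r') :
    T.Z r s n ≤ T.Z r' s' n := fun x hx => by
  rw [mem_Z] at *
  exact ⟨T.mono _ h hx.1, fun j => T.mono _ h' (hx.2 j)⟩

/-- `d` maps the numerator of one spot into the numerator of the target spot. -/
theorem d_mem_Z {r s s' : ℤ} {n n' : ℕ} (h : s' = s - r) {x : T.K.X n} (hx : x ∈ T.Z r s n)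
    (r' : ℤ) : (T.K.d n n').hom x ∈ T.Z r' s' n' := by
  subst h
  rw [mem_Z] at *
  refine ⟨hx.2 n', fun j => ?_⟩
  rw [d_d_apply]
  exact zero_mem _

theorem d_mem_B {r s s' : ℤ} {n n' : ℕ} (h : s' = s - r) {x : T.K.X n} (hx : x ∈ T.B r s n) :
    (T.K.d n n').hom x ∈ T.B r s' n' := by
  obtain ⟨a, ha, m, y, hy, rfl⟩ := T.mem_B.1 hx
  rw [map_add, d_d_apply, add_zero, mem_B]
  refine ⟨0, zero_mem _, n, a, ?_, (zero_add _).symm⟩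
  convert ha using 2
  omega

/-- The term of the `r`-th page in filtration `s` and total degree `n`. -/
abbrev E (r s : ℤ) (n : ℕ) : Type v := T.Z r s n ⧸ (T.B r s n).submoduleOf (T.Z r s n)

/-- The class in `E r s n` of an element of `Z r s n`. -/
abbrev toE {r s : ℤ} {n : ℕ} : T.Z r s n →ₗ[k] T.E r s n := Submodule.mkQ _

theorem toE_surjective {r s : ℤ} {n : ℕ} : Function.Surjective (T.toE (r := r) (s := s) (n := n)) :=
  Submodule.mkQ_surjective _

theorem toE_eq_zero {r s : ℤ} {n : ℕ} (x : T.Z r s n) : T.toE x = 0 ↔ x.1 ∈ T.B r s n := by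
  rw [Submodule.mkQ_apply, Submodule.Quotient.mk_eq_zero]; rfl

/-- The restriction of the differential to the numerators. -/
def dZ {r s s' : ℤ} (n n' : ℕ) (h : s' = s - r) : T.Z r s n →ₗ[k] T.Z r s' n' :=
  (T.K.d n n').hom.restrict fun _ hx => T.d_mem_Z h hx r

/-- The differential of the `r`-th page. -/
def dE {r s s' : ℤ} (n n' : ℕ) (h : s' = s - r) : T.E r s n →ₗ[k] T.E r s' n' :=
  Submodule.mapQ _ _ (T.dZ n n' h) fun _ hx => T.d_mem_B h hx

/-- The `r`-th page of the spectral sequence. -/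
noncomputable def page (r : ℤ) : HomologicalComplex (ModuleCat.{v} k)
    (ComplexShape.spectralSequenceNat ((r - 1, -r) : ℤ × ℤ)) where
  X x := ModuleCat.of k (T.E r x.2 (x.1 + x.2))
  d x y := if h : (y.2 : ℤ) = x.2 - r then ModuleCat.ofHom (T.dE (x.1 + x.2) (y.1 + y.2) h) else 0
  shape x y hxy := by
    split_ifs with h
    · ext z
      refine (T.toE_eq_zero (T.dZ _ _ h z)).2 ?_
      change (T.K.d _ _).hom z.1 ∈ _
      rw [T.d_eq_zero]
      · exact zero_mem _
      · intro h'
        refine hxy ⟨?_, ?_⟩ <;> simp <;> omega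
    · rfl
  d_comp_d' x y z _ _ := by
    split_ifs with h h'
    · ext w
      refine (T.toE_eq_zero (T.dZ _ _ h' (T.dZ _ _ h w))).2 ?_
      change (T.K.d _ _).hom ((T.K.d _ _).hom w.1) ∈ _
      rw [d_d_apply]
      exact zero_mem _
    all_goals simp

/-- The class in the spot `x` of the `r`-th page of an element of the numerator. -/
noncomputable def toPage (r : ℤ) (x : ℕ × ℕ) :
    T.Z r x.2 (x.1 + x.2) →ₗ[k] (T.page r).X x := T.toE

theorem toPage_surjective (r : ℤ) (x : ℕ × ℕ) : Function.Surjective (T.toPage r x) :=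
  T.toE_surjective

theorem toPage_eq_zero {r : ℤ} {x : ℕ × ℕ} {z : T.Z r x.2 (x.1 + x.2)} :
    T.toPage r x z = 0 ↔ z.1 ∈ T.B r x.2 (x.1 + x.2) := T.toE_eq_zero z

theorem toPage_eq_iff {r : ℤ} {x : ℕ × ℕ} {z w : T.Z r x.2 (x.1 + x.2)} :
    T.toPage r x z = T.toPage r x w ↔ z.1 - w.1 ∈ T.B r x.2 (x.1 + x.2) := by
  rw [← sub_eq_zero, ← map_sub, toPage_eq_zero]; rfl

theorem page_d_toPage {r : ℤ} {x y : ℕ × ℕ} (h : (y.2 : ℤ) = x.2 - r)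
    (z : T.Z r x.2 (x.1 + x.2)) :
    ((T.page r).d x y).hom (T.toPage r x z) = T.toPage r y (T.dZ _ _ h z) := by
  simp only [page, dif_pos h]
  rfl

theorem page_d_eq_zero {r : ℤ} {x y : ℕ × ℕ} (h : ¬ (y.2 : ℤ) = x.2 - r) :
    (T.page r).d x y = 0 := dif_neg h

theorem page_d_toPage_eq_zero_iff {r : ℤ} {x y : ℕ × ℕ} (h : (y.2 : ℤ) = x.2 - r)
    (z : T.Z r x.2 (x.1 + x.2)) :
    ((T.page r).d x y).hom (T.toPage r x z) = 0 ↔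
      (T.K.d _ (y.1 + y.2)).hom z.1 ∈ T.B r y.2 (y.1 + y.2) := by
  rw [page_d_toPage T h, toPage_eq_zero]
  rfl

/-- A cycle of the `r`-th page is represented by an element of the numerator of the next page. -/
theorem exists_mem_Z_succ {r : ℤ} (hr : 1 ≤ r) (x : ℕ × ℕ) (z : T.Z r x.2 (x.1 + x.2))
    (hz : ∀ y, ((T.page r).d x y).hom (T.toPage _ _ z) = 0) :
    ∃ w ∈ T.Z (r + 1) x.2 (x.1 + x.2), z.1 - w ∈ T.B r x.2 (x.1 + x.2) := by
  obtain ⟨z, hz'⟩ := z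
  -- if the target spot lies below the row `0`, the differential of `z` is zero
  rcases lt_or_ge (x.2 : ℤ) r with hq | hq
  · refine ⟨z, ?_, by simp⟩
    rw [mem_Z] at *
    refine ⟨hz'.1, fun j => ?_⟩
    have := hz'.2 j
    rw [T.eq_bot _ _ (by omega), Submodule.mem_bot] at this
    rw [this]
    exact zero_mem _
  · obtain ⟨p, q⟩ := x
    obtain ⟨r, rfl⟩ := Int.eq_ofNat_of_zero_le (show 0 ≤ r by omega)
    simp only at hq hz'
    have h : (((p + r - 1, q - r) : ℕ × ℕ).2 : ℤ) = (p, q).2 - (r : ℤ) := by simp; omega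
    have h1 := (T.page_d_toPage_eq_zero_iff h _).1 (hz (p + r - 1, q - r))
    obtain ⟨a, ha, m, y, hy, e⟩ := T.mem_B.1 h1
    simp only at e
    by_cases hm : m = p + q
    · subst hm
      have hy' : y ∈ T.Z (r - 1) (q - 1) (p + q) := by
        convert hy using 2; push_cast; omega
      have hyB : y ∈ T.B r q (p + q) := Submodule.mem_sup_left hy'
      refine ⟨z - y, ?_, by simpa using hyB⟩
      rw [mem_Z] at *
      refine ⟨sub_mem hz'.1 (T.mono _ (by omega) hy'.1), fun j => ?_⟩
      by_cases hj : j = p + r - 1 + (q - r)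
      · subst hj
        rw [map_sub, e, add_sub_cancel_right]
        exact T.mono _ (by omega) ha.1
      · rw [T.d_eq_zero (by omega)]
        exact zero_mem _
    · refine ⟨z, ?_, by simp⟩
      rw [mem_Z] at *
      refine ⟨hz'.1, fun j => ?_⟩
      by_cases hj : j = p + r - 1 + (q - r)
      · subst hj
        rw [e, T.d_eq_zero (i := m) (by omega)]
        simp only [ModuleCat.hom_zero, LinearMap.zero_apply, add_zero]
        exact T.mono _ (by omega) ha.1
      · rw [T.d_eq_zero (by omega)]
        exact zero_mem _

/-- An element of the numerator of the next page is in the denominator of the next page if and only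
if its class in the `r`-th page is a boundary. -/
theorem mem_B_succ_iff {r : ℤ} (hr : 1 ≤ r) (x : ℕ × ℕ) (z : T.Z r x.2 (x.1 + x.2))
    (hz : z.1 ∈ T.Z (r + 1) x.2 (x.1 + x.2)) :
    z.1 ∈ T.B (r + 1) x.2 (x.1 + x.2) ↔ ∃ y w, ((T.page r).d y x).hom w = T.toPage _ _ z := by
  obtain ⟨z, hz'⟩ := z
  obtain ⟨p, q⟩ := x
  obtain ⟨r, rfl⟩ := Int.eq_ofNat_of_zero_le (show 0 ≤ r by omega)
  simp only at hz hz' ⊢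
  constructor
  · intro h
    obtain ⟨a, ha, m, y, hy, e⟩ := T.mem_B.1 h
    have haB : a ∈ T.B r q (p + q) :=
      Submodule.mem_sup_left (T.Z_mono (by omega) (by omega) ha)
    have hy2 : y ∈ T.Z r (q + r) m := T.Z_mono (by omega) (by omega) hy
    by_cases hm : m = p + q + 1
    swap
    · refine ⟨(0, 0), 0, ?_⟩
      refine (map_zero _).trans (Eq.symm ?_)
      rw [toPage_eq_zero]
      change z ∈ T.B r q (p + q)
      rw [e, T.d_eq_zero hm]
      simpa using haB
    -- if the source spot lies to the left of the column `0`, the filtration of `y` is automatic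
    rcases lt_or_ge (p + 1) r with hp | hp
    · refine ⟨(0, 0), 0, ?_⟩
      refine (map_zero _).trans (Eq.symm ?_)
      rw [toPage_eq_zero]
      change z ∈ T.B r q (p + q)
      rw [e]
      refine add_mem haB (T.mem_B.2 ⟨0, zero_mem _, m, y, ?_, (zero_add _).symm⟩)
      rw [mem_Z] at *
      refine ⟨?_, fun j => T.mono _ (by omega) (hy2.2 j)⟩
      rw [T.eq_top _ _ (by push_cast [hm]; omega)]
      trivial
    · obtain rfl : m = p + 1 - r + (q + r) := by omega
      have h : (((p, q) : ℕ × ℕ).2 : ℤ) = ((p + 1 - r, q + r) : ℕ × ℕ).2 - (r : ℤ) := by simp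
      refine ⟨(p + 1 - r, q + r), T.toPage _ _ ⟨y, by push_cast; exact hy2⟩, ?_⟩
      rw [page_d_toPage T h, toPage_eq_iff]
      change (T.K.d _ _).hom y - z ∈ T.B r q (p + q)
      rw [e]
      simpa using haB
  · rintro ⟨⟨p', q'⟩, w, hw⟩
    have key : ∃ y ∈ T.Z r (q + r) (p' + q'),
        (T.K.d (p' + q') (p + q)).hom y - z ∈ T.B r q (p + q) := by
      by_cases h : (((p, q) : ℕ × ℕ).2 : ℤ) = ((p', q') : ℕ × ℕ).2 - (r : ℤ)
      · obtain ⟨⟨y, hy⟩, rfl⟩ := T.toPage_surjective _ _ w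
        rw [page_d_toPage T h, toPage_eq_iff] at hw
        refine ⟨y, ?_, hw⟩
        convert hy using 2
        simp at h ⊢
        omega
      · rw [page_d_eq_zero T h] at hw
        replace hw := hw.symm
        exact ⟨0, zero_mem _, by simpa using neg_mem (T.toPage_eq_zero.1 hw)⟩
    obtain ⟨y, hy, h⟩ := key
    obtain ⟨a, ha, m, y', hy', e⟩ := T.mem_B.1 h
    have hy'' : y' ∈ T.Z (r + 1 - 1) (q + (r + 1) - 1) m := T.Z_mono (by omega) (by omega) hy'
    have e2 : z = -a + ((T.K.d (p' + q') (p + q)).hom y - (T.K.d m (p + q)).hom y') := by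
      rw [← sub_eq_iff_eq_add] at e
      rw [← e]; abel
    rw [e2]
    refine add_mem (neg_mem (Submodule.mem_sup_left ?_)) (sub_mem (T.mem_B.2 ⟨0, zero_mem _, _, y,
      T.Z_mono (by omega) (by omega) hy, (zero_add _).symm⟩) (T.mem_B.2 ⟨0, zero_mem _, _, y',
      hy'', (zero_add _).symm⟩))
    have e3 : a = ((T.K.d (p' + q') (p + q)).hom y - (T.K.d m (p + q)).hom y') - z := by
      rw [e2]; abel
    rw [mem_Z] at *
    refine ⟨ha.1, fun j => ?_⟩
    rw [e3, map_sub, map_sub, d_d_apply, d_d_apply, sub_zero, zero_sub]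
    exact neg_mem (T.mono _ (by omega) (hz.2 j))

/-- The restriction of `toPage` to the numerator of the next page. -/
noncomputable def toPageSucc (r : ℤ) (x : ℕ × ℕ) :
    T.Z (r + 1) x.2 (x.1 + x.2) →ₗ[k] (T.page r).X x where
  toFun z := T.toPage r x ⟨z.1, T.Z_mono le_rfl (by omega) z.2⟩
  map_add' z w := (T.toPage r x).map_add ⟨z.1, _⟩ ⟨w.1, _⟩
  map_smul' c z := (T.toPage r x).map_smul c ⟨z.1, _⟩

/-- The next page is the homology of the `r`-th page. -/
theorem exists_page_iso {r : ℤ} (hr : 1 ≤ r) (x : ℕ × ℕ) :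
    Nonempty ((T.page r).homology x ≅ (T.page (r + 1)).X x) := by
  refine (exists_homologyEquiv (T.page r) x (T.toPageSucc r x)
    ((T.B (r + 1) x.2 (x.1 + x.2)).submoduleOf (T.Z (r + 1) x.2 (x.1 + x.2))) ?_ ?_ ?_).elim
    fun e _ => ⟨e.symm.toModuleIso⟩
  · intro z y
    by_cases h : (y.2 : ℤ) = x.2 - r
    · refine (T.page_d_toPage_eq_zero_iff h _).2 ?_
      refine Submodule.mem_sup_left ?_
      exact T.d_mem_Z (r := r + 1) (by omega) z.2 _
    · rw [T.page_d_eq_zero h, ModuleCat.hom_zero, LinearMap.zero_apply]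
  · intro y hy
    obtain ⟨z, rfl⟩ := T.toPage_surjective _ _ y
    obtain ⟨w, hw, h⟩ := T.exists_mem_Z_succ hr x z hy
    refine ⟨⟨w, hw⟩, x, 0, ?_⟩
    rw [map_zero, add_zero]
    exact T.toPage_eq_iff.2 h
  · intro z
    rw [Submodule.submoduleOf, Submodule.mem_comap, Submodule.subtype_apply]
    exact T.mem_B_succ_iff hr x ⟨z.1, T.Z_mono le_rfl (by omega) z.2⟩ z.2

/-- The spectral sequence of a bounded filtered complex of modules. -/
noncomputable def spectralSequence : SpectralSequence (ModuleCat.{v} k)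
    (fun r => ComplexShape.spectralSequenceNat ((r - 1, -r) : ℤ × ℤ)) 1 where
  page r _ := T.page r
  iso r r' x h hr := (T.exists_page_iso hr x).some ≪≫ eqToIso (by rw [h])

/-- The induced filtration on homology. -/
noncomputable def homologyF (n : ℕ) (s : ℤ) : Submodule k (T.K.homology n) :=
  ((T.F n s).comap (T.K.iCycles n).hom).map (T.K.homologyπ n).hom

theorem homologyF_mono (n : ℕ) : Monotone (T.homologyF n) := fun _ _ h =>
  Submodule.map_mono (Submodule.comap_mono (T.mono n h))

theorem homologyF_eq_bot (n : ℕ) {s : ℤ} (h : s < 0) : T.homologyF n s = ⊥ := by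
  rw [homologyF, T.eq_bot n s h, Submodule.comap_bot, LinearMap.ker_eq_bot.2 (iCycles_injective _ _),
    Submodule.map_bot]

theorem homologyF_eq_top (n : ℕ) {s : ℤ} (h : n ≤ s) : T.homologyF n s = ⊤ := by
  rw [homologyF, T.eq_top n s h, Submodule.comap_top, Submodule.map_top,
    LinearMap.range_eq_top.2 (homologyπ_surjective _ _)]

/-- From the page `r = max(p + 2, q + 1)` on, the terms are the graded pieces of the homology. -/
theorem exists_equiv_graded (p q : ℕ) {r : ℤ} (hp : (p : ℤ) + 2 ≤ r) (hq : (q : ℤ) + 1 ≤ r) :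
    Nonempty (T.E r q (p + q) ≃ₗ[k] (T.homologyF (p + q) q ⧸
      (T.homologyF (p + q) (q - 1)).submoduleOf (T.homologyF (p + q) q))) := by
  have hZ : ∀ x ∈ T.Z r q (p + q), ∀ j, (T.K.d (p + q) j).hom x = 0 := fun x hx j => by
    have := (T.mem_Z.1 hx).2 j
    rwa [T.eq_bot _ _ (by omega), Submodule.mem_bot] at this
  let ι' : T.K.cycles (p + q) ≃ₗ[k] LinearMap.range (T.K.iCycles (p + q)).hom :=
    LinearEquiv.ofInjective _ (iCycles_injective _ _)
  let c : T.Z r q (p + q) →ₗ[k] T.K.cycles (p + q) := ι'.symm.toLinearMap ∘ₗ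
    (T.Z r q (p + q)).subtype.codRestrict _ fun x => exists_iCycles_eq T.K (hZ x.1 x.2)
  have hc : ∀ x, (T.K.iCycles (p + q)).hom (c x) = x.1 := fun x =>
    congrArg Subtype.val (ι'.apply_symm_apply _)
  let g : T.Z r q (p + q) →ₗ[k] T.homologyF (p + q) q :=
    ((T.K.homologyπ (p + q)).hom ∘ₗ c).codRestrict _ fun x =>
      ⟨c x, by
        change (T.K.iCycles (p + q)).hom (c x) ∈ T.F (p + q) q
        rw [hc]; exact (T.mem_Z.1 x.2).1, rfl⟩
  let ψ := ((T.homologyF (p + q) (q - 1)).submoduleOf (T.homologyF (p + q) q)).mkQ ∘ₗ g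
  have hψ : Function.Surjective ψ := by
    refine (Submodule.mkQ_surjective _).comp ?_
    rintro ⟨_, z, hz, rfl⟩
    have hz' : (T.K.iCycles (p + q)).hom z ∈ T.Z r q (p + q) := T.mem_Z.2 ⟨hz, fun j => by
      rw [d_iCycles_apply]; exact zero_mem _⟩
    refine ⟨⟨_, hz'⟩, Subtype.ext ?_⟩
    refine congrArg (T.K.homologyπ (p + q)).hom (iCycles_injective _ _ ?_)
    rw [hc]
  have hker : (T.B r q (p + q)).submoduleOf (T.Z r q (p + q)) = LinearMap.ker ψ := by
    ext x
    rw [LinearMap.mem_ker]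
    change x.1 ∈ T.B r q (p + q) ↔ Submodule.Quotient.mk (g x) = _
    rw [Submodule.Quotient.mk_eq_zero]
    change _ ↔ (T.K.homologyπ (p + q)).hom (c x) ∈ T.homologyF (p + q) (q - 1)
    constructor
    · intro h
      obtain ⟨a, ha, m, y, hy, e⟩ := T.mem_B.1 h
      have hx := hZ x.1 x.2
      have had : ∀ j, (T.K.d (p + q) j).hom a = 0 := fun j => by
        have := hx j
        rwa [e, map_add, d_d_apply, add_zero] at this
      obtain ⟨z, hz⟩ := exists_iCycles_eq T.K had
      refine ⟨z, ?_, ?_⟩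
      · change (T.K.iCycles (p + q)).hom z ∈ T.F (p + q) (q - 1)
        rw [hz]
        exact (T.mem_Z.1 ha).1
      · rw [← sub_eq_zero, ← map_sub, homologyπ_eq_zero_iff]
        refine ⟨m, -y, ?_⟩
        rw [map_sub, hz, hc, e, map_neg]
        abel
    · rintro ⟨z, hz, e⟩
      change (T.K.iCycles (p + q)).hom z ∈ T.F (p + q) (q - 1) at hz
      rw [← sub_eq_zero, ← map_sub, homologyπ_eq_zero_iff] at e
      obtain ⟨m, y, hy⟩ := e
      rw [map_sub, hc] at hy
      rw [mem_B]
      refine ⟨(T.K.iCycles (p + q)).hom z, T.mem_Z.2 ⟨hz, fun j => ?_⟩, ?_⟩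
      · rw [d_iCycles_apply]; exact zero_mem _
      · by_cases hm : m = p + q + 1
        · refine ⟨m, -y, T.mem_Z.2 ⟨?_, fun j => ?_⟩, ?_⟩
          · rw [T.eq_top _ _ (by push_cast [hm]; omega)]; trivial
          · by_cases hj : j = p + q
            · subst hj
              rw [map_neg, hy, neg_sub]
              exact T.mono _ (by omega)
                (sub_mem (T.mem_Z.1 x.2).1 (T.mono _ (by omega) hz))
            · rw [T.d_eq_zero (by omega)]
              exact zero_mem _
          · rw [map_neg, hy]; abel
        · rw [T.d_eq_zero hm] at hy
          refine ⟨m, 0, zero_mem _, ?_⟩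
          rw [map_zero, add_zero]
          exact (sub_eq_zero.1 hy.symm).symm
  exact ⟨(Submodule.quotEquivOfEq _ _ hker).trans (ψ.quotKerEquivOfSurjective hψ)⟩

end FilteredComplex

end Filtered

/-- A criterion for a spot of a page to be the homology of another complex: `φ` has to map the
numerator onto the cycles and to identify the denominator with the elements that are mapped to
boundaries. -/
theorem FilteredComplex.exists_equiv_page {k : Type u} [Ring k] (T : FilteredComplex.{u, v} k)
    {ι : Type*} {c : ComplexShape ι} (R : HomologicalComplex (ModuleCat.{v} k) c) (i : ι) (r : ℤ)
    (x : ℕ × ℕ) (φ : T.K.X (x.1 + x.2) →ₗ[k] R.X i)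
    (h0 : ∀ a ∈ T.Z r x.2 (x.1 + x.2), ∀ j, (R.d i j).hom (φ a) = 0)
    (h1 : ∀ y, (∀ j, (R.d i j).hom y = 0) → ∃ a ∈ T.Z r x.2 (x.1 + x.2), φ a = y)
    (h2 : ∀ a ∈ T.Z r x.2 (x.1 + x.2), a ∈ T.B r x.2 (x.1 + x.2) ↔
      ∃ j w, (R.d j i).hom w = φ a) :
    ∃ e : R.homology i ≃ₗ[k] (T.page r).X x, ∀ (a : T.Z r x.2 (x.1 + x.2)) (z : R.cycles i),
      (R.iCycles i).hom z = φ a → e ((R.homologyπ i).hom z) = T.toPage r x a := by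
  obtain ⟨e, he⟩ := exists_homologyEquiv R i (φ ∘ₗ (T.Z r x.2 (x.1 + x.2)).subtype)
    ((T.B r x.2 (x.1 + x.2)).submoduleOf (T.Z r x.2 (x.1 + x.2)))
    (fun a j => h0 a.1 a.2 j)
    (fun y hy => by
      obtain ⟨a, ha, rfl⟩ := h1 y hy
      exact ⟨⟨a, ha⟩, i, 0, by rw [map_zero, add_zero]; rfl⟩)
    (fun a => h2 a.1 a.2)
  exact ⟨e.symm, fun a z hz => (LinearEquiv.symm_apply_eq e).2 (he a z hz).symm⟩

theorem FilteredComplex.convergesTo {k : Type u} [CommRing k]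
    (T : FilteredComplex.{u, max u v} k) :
    ConvergesTo T.spectralSequence (fun n => T.K.homology n) T.homologyF :=
  ⟨T.homologyF_mono, fun n => T.homologyF_eq_bot n (by omega),
    fun n => T.homologyF_eq_top n le_rfl, fun p q _ _ hp hq => T.exists_equiv_graded p q hp hq⟩

/-! ### The Künneth theorem for differential modules -/

section Kunneth

/-- `i : Z → M` and `π : Z → H` exhibit `Z` as the cycles and `H` as the homology of the module `M`
with differential `d`. -/
structure IsHomology {k M Z H : Type*} [CommRing k] [AddCommGroup M] [Module k M]
    [AddCommGroup Z] [Module k Z] [AddCommGroup H] [Module k H]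
    (d : M →ₗ[k] M) (i : Z →ₗ[k] M) (π : Z →ₗ[k] H) : Prop where
  comp_self : d ∘ₗ d = 0
  injective : Function.Injective i
  exact : Function.Exact i d
  surjective : Function.Surjective π
  eq_zero_iff : ∀ z, π z = 0 ↔ i z ∈ LinearMap.range d

variable {k : Type*} [CommRing k]

/-- Tensoring preserves the injectivity of the inclusion of a submodule with flat quotient. -/
theorem rTensor_injective_of_exact {X Y F : Type*} [AddCommGroup X] [Module k X]
    [AddCommGroup Y] [Module k Y] [AddCommGroup F] [Module k F] [Module.Flat k F]
    {f : X →ₗ[k] Y} {g : Y →ₗ[k] F} (hf : Function.Injective f) (hg : Function.Surjective g)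
    (h : Function.Exact f g) (P : Type*) [AddCommGroup P] [Module k P] :
    Function.Injective (f.rTensor P) :=
  LinearMap.lTensor_inj_iff_rTensor_inj _ _ |>.1
    (LinearMap.lTensor_injective_of_exact_of_flat g hg f hf h P)

variable {M Z H N Z' H' : Type*} [AddCommGroup M] [Module k M] [AddCommGroup Z] [Module k Z]
  [AddCommGroup H] [Module k H] [AddCommGroup N] [Module k N] [AddCommGroup Z'] [Module k Z']
  [AddCommGroup H'] [Module k H']
  {d : M →ₗ[k] M} {i : Z →ₗ[k] M} {π : Z →ₗ[k] H}
  {d' : N →ₗ[k] N} {i' : Z' →ₗ[k] N} {π' : Z' →ₗ[k] H'} {ε : M →ₗ[k] M}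

theorem IsHomology.d_i (h : IsHomology d i π) (z : Z) : d (i z) = 0 := (h.exact _).2 ⟨z, rfl⟩

theorem IsHomology.d_d (h : IsHomology d i π) (x : M) : d (d x) = 0 :=
  congrArg (fun f => f x) h.comp_self

theorem IsHomology.exact_rangeRestrict (h : IsHomology d i π) :
    Function.Exact i d.rangeRestrict := fun x => by
  rw [← h.exact x, ← Subtype.coe_inj]; rfl

/-- The boundaries as a submodule of the cycles. -/
theorem IsHomology.exists_boundaries (h : IsHomology d i π) :
    ∃ j : LinearMap.range d →ₗ[k] Z, i ∘ₗ j = (LinearMap.range d).subtype ∧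
      Function.Exact j π := by
  let ι' : Z ≃ₗ[k] LinearMap.range i := LinearEquiv.ofInjective _ h.injective
  let j : LinearMap.range d →ₗ[k] Z := ι'.symm.toLinearMap ∘ₗ
    (LinearMap.range d).subtype.codRestrict _ (by
      rintro ⟨_, w, rfl⟩
      exact (h.exact _).1 (h.d_d w))
  have hj : ∀ b, i (j b) = b := fun b => congrArg Subtype.val (ι'.apply_symm_apply _)
  refine ⟨j, LinearMap.ext hj, fun z => ?_⟩
  rw [h.eq_zero_iff]
  constructor
  · intro hz
    exact ⟨⟨_, hz⟩, h.injective (hj _)⟩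
  · rintro ⟨b, rfl⟩
    rw [hj]
    exact b.2

variable (d d' ε) in
/-- The differential `d ⊗ 1 + ε ⊗ d'` of a tensor product, where `ε` is the sign involution. -/
noncomputable def tensorD : M ⊗[k] N →ₗ[k] M ⊗[k] N :=
  TensorProduct.map d LinearMap.id + TensorProduct.map ε d'

theorem tensorD_tmul (x : M) (y : N) : tensorD d d' ε (x ⊗ₜ y) = d x ⊗ₜ y + ε x ⊗ₜ d' y := rfl

/-- The boundaries inject into the whole module after tensoring with anything: both quotients in
`B ⊆ Z ⊆ M` are flat, being `H` and `B`. -/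
theorem IsHomology.rTensor_subtype_injective (h : IsHomology d i π) [Module.Flat k H]
    [Module.Flat k (LinearMap.range d)] (P : Type*) [AddCommGroup P] [Module k P] :
    Function.Injective ((LinearMap.range d).subtype.rTensor P) := by
  obtain ⟨j, hj, hjπ⟩ := h.exists_boundaries
  have hji : Function.Injective j := by
    refine Function.Injective.of_comp (f := i) ?_
    rw [← LinearMap.coe_comp, hj]
    exact Subtype.val_injective
  rw [← hj, LinearMap.rTensor_comp]
  exact (rTensor_injective_of_exact h.injective (LinearMap.surjective_rangeRestrict d)
    h.exact_rangeRestrict P).comp (rTensor_injective_of_exact hji h.surjective hjπ P)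

theorem apply_sign_apply (hdε : d ∘ₗ ε = -(ε ∘ₗ d)) (x : M) : d (ε x) = -ε (d x) :=
  DFunLike.congr_fun hdε x

theorem IsHomology.tensorD_tensorD (h : IsHomology d i π) (h' : IsHomology d' i' π')
    (hdε : d ∘ₗ ε = -(ε ∘ₗ d)) (x : M ⊗[k] N) :
    tensorD d d' ε (tensorD d d' ε x) = 0 := by
  induction x with
  | zero => simp
  | tmul x y =>
    simp [tensorD_tmul, h.d_d, h'.d_d, apply_sign_apply hdε, TensorProduct.neg_tmul]
  | add x y hx hy => rw [map_add, map_add, hx, hy, add_zero]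

theorem lTensor_mkQ_map_eq_zero (x : M ⊗[k] N) :
    ((LinearMap.range d').mkQ).lTensor M (TensorProduct.map ε d' x) = 0 := by
  induction x with
  | zero => simp
  | tmul x y =>
    rw [TensorProduct.map_tmul, LinearMap.lTensor_tmul, show (LinearMap.range d').mkQ (d' y) = 0 from
      (Submodule.Quotient.mk_eq_zero _).2 ⟨y, rfl⟩, TensorProduct.tmul_zero]
  | add x y hx hy => rw [map_add, map_add, hx, hy, add_zero]

/-- Every cycle of `M ⊗ N` is homologous to one that comes from `Z ⊗ Z'`. -/
theorem IsHomology.exists_tensor_cycle (h : IsHomology d i π) (h' : IsHomology d' i' π')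
    (hε : ε ∘ₗ ε = LinearMap.id) (hdε : d ∘ₗ ε = -(ε ∘ₗ d)) [Module.Flat k H] [Module.Flat k Z]
    [Module.Flat k (LinearMap.range d)] (x : M ⊗[k] N) (hx : tensorD d d' ε x = 0) :
    ∃ t w, x = TensorProduct.map i i' t + tensorD d d' ε w := by
  set dB := d.rangeRestrict with hdB
  have hdB' : (LinearMap.range d).subtype ∘ₗ dB = d := rfl
  have hex := rTensor_exact N h.exact_rangeRestrict (LinearMap.surjective_rangeRestrict d)
  have h1 : TensorProduct.map d LinearMap.id x = -TensorProduct.map ε d' x :=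
    eq_neg_of_add_eq_zero_left hx
  -- `(d ⊗ 1) x` vanishes modulo the boundaries of `N`, so it is a boundary there
  have h2 : ((LinearMap.range d').mkQ).lTensor (LinearMap.range d) (dB.rTensor N x) = 0 := by
    apply h.rTensor_subtype_injective
    rw [map_zero]
    have e1 : ∀ x : M ⊗[k] N, (LinearMap.range d).subtype.rTensor _
        (((LinearMap.range d').mkQ).lTensor (LinearMap.range d) (dB.rTensor N x)) =
        ((LinearMap.range d').mkQ).lTensor M (TensorProduct.map d LinearMap.id x) := by
      intro x
      induction x with
      | zero => simp
      | tmul x y => rfl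
      | add x y hx hy => simp only [map_add, hx, hy]
    rw [e1, h1, map_neg, lTensor_mkQ_map_eq_zero, neg_zero]
  have hexact : Function.Exact d' (LinearMap.range d').mkQ :=
    LinearMap.exact_map_mkQ_range d'
  obtain ⟨y', hy'⟩ := (lTensor_exact (LinearMap.range d) hexact
    (Submodule.mkQ_surjective _) _).1 h2
  obtain ⟨x', rfl⟩ := LinearMap.rTensor_surjective N (LinearMap.surjective_rangeRestrict d) y'
  have h3 : ∀ x' : M ⊗[k] N, dB.rTensor N (tensorD d d' ε (TensorProduct.map ε LinearMap.id x')) =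
      d'.lTensor (LinearMap.range d) (dB.rTensor N x') := by
    intro x'
    have hd : ∀ x, dB (ε (d x)) = 0 := fun x => Subtype.ext (by
      change d (ε (d x)) = 0
      rw [apply_sign_apply hdε, h.d_d, map_zero, neg_zero])
    induction x' with
    | zero => simp
    | tmul x y =>
      simp only [TensorProduct.map_tmul, tensorD_tmul, map_add, LinearMap.rTensor_tmul,
        LinearMap.lTensor_tmul, apply_sign_apply hdε, map_neg, hd, LinearMap.id_apply, neg_zero,
        TensorProduct.zero_tmul, zero_add, show ε (ε x) = x from congrArg (fun f => f x) hε]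
    | add x y hx hy => simp only [map_add, hx, hy]
  -- subtracting a boundary, `(d ⊗ 1) x` becomes zero, so that `x` comes from `Z ⊗ N`
  set w := TensorProduct.map ε LinearMap.id x' with hw
  obtain ⟨t₁, ht₁⟩ := (hex (x - tensorD d d' ε w)).1 (by rw [map_sub, h3, hy', sub_self])
  -- there the differential is `1 ⊗ d'` up to sign; as `Z` is flat, its kernel is `Z ⊗ Z'`
  have h4 : d'.lTensor Z t₁ = 0 := by
    apply rTensor_injective_of_exact h.injective (LinearMap.surjective_rangeRestrict d)
      h.exact_rangeRestrict
    rw [map_zero]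
    have h5 := h.tensorD_tensorD h' hdε w
    have h6 : tensorD d d' ε (i.rTensor N t₁) = 0 := by rw [ht₁, map_sub, h5, hx, sub_zero]
    have h7 : ∀ t : Z ⊗[k] N, TensorProduct.map ε LinearMap.id (tensorD d d' ε (i.rTensor N t)) =
        i.rTensor N (d'.lTensor Z t) := by
      intro t
      induction t with
      | zero => simp
      | tmul x y =>
        simp only [TensorProduct.map_tmul, tensorD_tmul, LinearMap.rTensor_tmul,
          LinearMap.lTensor_tmul, h.d_i, LinearMap.id_apply,
          TensorProduct.zero_tmul, zero_add, show ∀ x, ε (ε x) = x from DFunLike.congr_fun hε]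
      | add x y hx hy => simp only [map_add, hx, hy]
    rw [← h7, h6, map_zero]
  obtain ⟨t, rfl⟩ := (Module.Flat.lTensor_exact Z h'.exact t₁).1 h4
  refine ⟨t, w, ?_⟩
  rw [← sub_eq_iff_eq_add, ← ht₁, ← LinearMap.comp_apply, LinearMap.rTensor_comp_lTensor]

/-- A combination of products of cycles that bounds in `M ⊗ N` vanishes in `H ⊗ H'`. -/
theorem IsHomology.map_eq_zero_of_tensorD (h : IsHomology d i π) (h' : IsHomology d' i' π')
    (hε : ε ∘ₗ ε = LinearMap.id) (hdε : d ∘ₗ ε = -(ε ∘ₗ d)) [Module.Flat k H] [Module.Flat k Z]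
    [Module.Flat k (LinearMap.range d)] (t : Z ⊗[k] Z') (w : M ⊗[k] N)
    (ht : TensorProduct.map i i' t = tensorD d d' ε w) : TensorProduct.map π π' t = 0 := by
  obtain ⟨j, hj, hjπ⟩ := h.exists_boundaries
  set dB := d.rangeRestrict with hdB
  -- `(d ⊗ 1) w` is a cycle of `B ⊗ N`, hence comes from `B ⊗ Z'`
  have h1 : d'.lTensor _ (dB.rTensor N w) = 0 := by
    apply h.rTensor_subtype_injective
    rw [map_zero]
    have e1 : ∀ w : M ⊗[k] N, TensorProduct.map ε LinearMap.id (TensorProduct.map d LinearMap.id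
        (tensorD d d' ε w)) =
        -(LinearMap.range d).subtype.rTensor N (d'.lTensor _ (dB.rTensor N w)) := by
      intro w
      induction w with
      | zero => simp
      | tmul x y =>
        simp only [TensorProduct.map_tmul, tensorD_tmul, map_add, LinearMap.rTensor_tmul,
          LinearMap.lTensor_tmul, apply_sign_apply hdε, map_neg, h.d_d, LinearMap.id_apply,
          TensorProduct.zero_tmul, zero_add, TensorProduct.neg_tmul,
          show ∀ x, ε (ε x) = x from DFunLike.congr_fun hε]
        rfl
      | add x y hx hy => simp only [map_add, hx, hy, neg_add]
    have e2 : ∀ t : Z ⊗[k] Z', TensorProduct.map d LinearMap.id (TensorProduct.map i i' t) = 0 := by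
      intro t
      induction t with
      | zero => simp
      | tmul x y => simp [h.d_i]
      | add x y hx hy => rw [map_add, map_add, hx, hy, add_zero]
    rw [← neg_eq_zero, ← e1, ← ht, e2, map_zero]
  obtain ⟨b, hb⟩ := (Module.Flat.lTensor_exact (LinearMap.range d) h'.exact _).1 h1
  -- this part of `t` vanishes in `H ⊗ Z'`; the remaining part is `(ε ⊗ d') w`
  set s := t - j.rTensor Z' b with hs
  have h2 : TensorProduct.map i i' s = TensorProduct.map ε d' w := by
    have e1 : TensorProduct.map i i' (j.rTensor Z' b) = TensorProduct.map d LinearMap.id w := by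
      have e3 : ∀ b : LinearMap.range d ⊗[k] Z', TensorProduct.map i i' (j.rTensor Z' b) =
          (LinearMap.range d).subtype.rTensor N (i'.lTensor _ b) := by
        intro b
        induction b with
        | zero => simp
        | tmul x y =>
          simp only [TensorProduct.map_tmul, LinearMap.rTensor_tmul, LinearMap.lTensor_tmul, ← hj,
            LinearMap.comp_apply]
        | add x y hx hy => simp only [map_add, hx, hy]
      rw [e3, hb, ← LinearMap.rTensor_comp_apply]
      rfl
    rw [hs, map_sub, ht, e1, tensorD, LinearMap.add_apply, add_sub_cancel_left]
  -- so `s` comes from `Z` tensored with the boundaries of `N`, and vanishes in `Z ⊗ H'`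
  have h3 : ((LinearMap.range d').mkQ ∘ₗ i').lTensor Z s = 0 := by
    apply rTensor_injective_of_exact h.injective (LinearMap.surjective_rangeRestrict d)
      h.exact_rangeRestrict
    have e1 : ∀ s : Z ⊗[k] Z', i.rTensor _ (((LinearMap.range d').mkQ ∘ₗ i').lTensor Z s) =
        ((LinearMap.range d').mkQ).lTensor M (TensorProduct.map i i' s) := by
      intro s
      induction s with
      | zero => simp
      | tmul x y => rfl
      | add x y hx hy => simp only [map_add, hx, hy]
    rw [e1, h2, lTensor_mkQ_map_eq_zero, map_zero]
  obtain ⟨c, hc⟩ := (Module.Flat.lTensor_exact Z (LinearMap.exact_subtype_ker_map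
    ((LinearMap.range d').mkQ ∘ₗ i')) s).1 h3
  have h4 : TensorProduct.map π π' s = 0 := by
    rw [← hc, ← LinearMap.comp_apply, LinearMap.map_comp_lTensor]
    have : π' ∘ₗ (LinearMap.ker ((LinearMap.range d').mkQ ∘ₗ i')).subtype = 0 := by
      ext z
      exact (h'.eq_zero_iff _).2 ((Submodule.Quotient.mk_eq_zero _).1 z.2)
    rw [this, TensorProduct.map_zero_right, LinearMap.zero_apply]
  rw [← sub_add_cancel t (j.rTensor Z' b), map_add, h4, zero_add, ← LinearMap.comp_apply,
    LinearMap.map_comp_rTensor, hjπ.linearMap_comp_eq_zero, TensorProduct.map_zero_left,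
    LinearMap.zero_apply]

theorem IsHomology.exists_tensorD_of_map_eq_zero (h : IsHomology d i π)
    (h' : IsHomology d' i' π') (hε : ε ∘ₗ ε = LinearMap.id) (hdε : d ∘ₗ ε = -(ε ∘ₗ d))
    (t : Z ⊗[k] Z') (ht : TensorProduct.map π π' t = 0) :
    ∃ w, TensorProduct.map i i' t = tensorD d d' ε w := by
  have h1 := TensorProduct.map_ker (LinearMap.exact_subtype_ker_map π) h.surjective
    (LinearMap.exact_subtype_ker_map π') h'.surjective
  suffices LinearMap.ker (TensorProduct.map π π') ≤
      (LinearMap.range (tensorD d d' ε)).comap (TensorProduct.map i i') by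
    obtain ⟨w, hw⟩ := this ht
    exact ⟨w, hw.symm⟩
  rw [h1, sup_le_iff]
  constructor
  · rintro _ ⟨x, rfl⟩
    induction x with
    | zero => simp
    | tmul z z' =>
      obtain ⟨w', hw'⟩ := (h'.eq_zero_iff _).1 z'.2
      refine ⟨ε (i z) ⊗ₜ w', ?_⟩
      simp [tensorD_tmul, apply_sign_apply hdε, h.d_i, hw',
        show ∀ x, ε (ε x) = x from DFunLike.congr_fun hε]
    | add x y hx hy => rw [map_add]; exact add_mem hx hy
  · rintro _ ⟨x, rfl⟩
    induction x with
    | zero => simp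
    | tmul z z' =>
      obtain ⟨w, hw⟩ := (h.eq_zero_iff _).1 z.2
      refine ⟨w ⊗ₜ i' z', ?_⟩
      simp [tensorD_tmul, h'.d_i, hw]
    | add x y hx hy => rw [map_add]; exact add_mem hx hy

/-- The Künneth theorem: if the cycles, boundaries and homology of `M` are flat, the homology of
`M ⊗ N` is the tensor product of the homologies. -/
theorem IsHomology.exists_kunneth {L ZL HL : Type*} [AddCommGroup L] [Module k L]
    [AddCommGroup ZL] [Module k ZL] [AddCommGroup HL] [Module k HL] {dL : L →ₗ[k] L}
    {iL : ZL →ₗ[k] L} {πL : ZL →ₗ[k] HL} (h : IsHomology d i π) (h' : IsHomology d' i' π')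
    (hL : IsHomology dL iL πL) (hε : ε ∘ₗ ε = LinearMap.id) (hdε : d ∘ₗ ε = -(ε ∘ₗ d))
    [Module.Flat k H] [Module.Flat k Z] [Module.Flat k (LinearMap.range d)]
    (μ : M ⊗[k] N ≃ₗ[k] L) (hμ : ∀ x, dL (μ x) = μ (tensorD d d' ε x)) :
    ∃ e : H ⊗[k] H' ≃ₗ[k] HL, ∀ z z' zL, iL zL = μ (i z ⊗ₜ i' z') →
      e (π z ⊗ₜ π' z') = πL zL := by
  let ι' : ZL ≃ₗ[k] LinearMap.range iL := LinearEquiv.ofInjective _ hL.injective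
  have hcyc : ∀ t, μ (TensorProduct.map i i' t) ∈ LinearMap.range iL := by
    intro t
    refine (hL.exact _).1 ?_
    rw [hμ]
    induction t with
    | zero => simp
    | tmul x y => simp [tensorD_tmul, h.d_i, h'.d_i]
    | add x y hx hy => simp only [map_add, hx, hy, add_zero]
  let c : Z ⊗[k] Z' →ₗ[k] ZL := ι'.symm.toLinearMap ∘ₗ
    (μ.toLinearMap ∘ₗ TensorProduct.map i i').codRestrict _ hcyc
  have hc : ∀ t, iL (c t) = μ (TensorProduct.map i i' t) := fun t =>
    congrArg Subtype.val (ι'.apply_symm_apply _)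
  have hker : LinearMap.ker (TensorProduct.map π π') = LinearMap.ker (πL ∘ₗ c) := by
    ext t
    rw [LinearMap.mem_ker, LinearMap.mem_ker, LinearMap.comp_apply, hL.eq_zero_iff, hc]
    constructor
    · intro ht
      obtain ⟨w, hw⟩ := h.exists_tensorD_of_map_eq_zero h' hε hdε t ht
      exact ⟨μ w, by rw [hμ, hw]⟩
    · rintro ⟨w, hw⟩
      obtain ⟨w, rfl⟩ := μ.surjective w
      rw [hμ] at hw
      exact h.map_eq_zero_of_tensorD h' hε hdε t w (μ.injective hw.symm)
  have hsurj : Function.Surjective (πL ∘ₗ c) := by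
    intro y
    obtain ⟨z, rfl⟩ := hL.surjective y
    obtain ⟨x, hx⟩ := μ.surjective (iL z)
    have hx0 : tensorD d d' ε x = 0 := by
      apply μ.injective
      rw [← hμ, hx, hL.d_i, map_zero]
    obtain ⟨t, w, rfl⟩ := h.exists_tensor_cycle h' hε hdε x hx0
    refine ⟨t, ?_⟩
    rw [LinearMap.comp_apply, ← sub_eq_zero, ← map_sub, hL.eq_zero_iff, map_sub, hc, ← hx, map_add,
      sub_add_cancel_left, ← hμ, ← map_neg]
    exact ⟨_, rfl⟩
  have hπ := TensorProduct.map_surjective h.surjective h'.surjective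
  refine ⟨((TensorProduct.map π π').quotKerEquivOfSurjective hπ).symm.trans
    ((Submodule.quotEquivOfEq _ _ hker).trans ((πL ∘ₗ c).quotKerEquivOfSurjective hsurj)), ?_⟩
  intro z z' zL hz
  have e1 : ((TensorProduct.map π π').quotKerEquivOfSurjective hπ).symm (π z ⊗ₜ π' z') =
      Submodule.Quotient.mk (z ⊗ₜ z') := by
    rw [LinearEquiv.symm_apply_eq]; rfl
  rw [LinearEquiv.trans_apply, e1]
  refine congrArg πL (hL.injective ?_)
  rw [hc, hz]; rfl

/-- Isomorphic differential modules have isomorphic homology. -/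
theorem IsHomology.exists_equiv {M Z H M' Z' H' : Type*} [AddCommGroup M] [Module k M]
    [AddCommGroup Z] [Module k Z] [AddCommGroup H] [Module k H] [AddCommGroup M'] [Module k M']
    [AddCommGroup Z'] [Module k Z'] [AddCommGroup H'] [Module k H']
    {d : M →ₗ[k] M} {i : Z →ₗ[k] M} {π : Z →ₗ[k] H}
    {d' : M' →ₗ[k] M'} {i' : Z' →ₗ[k] M'} {π' : Z' →ₗ[k] H'}
    (h : IsHomology d i π) (h' : IsHomology d' i' π') (μ : M ≃ₗ[k] M')
    (hμ : ∀ x, d' (μ x) = μ (d x)) :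
    ∃ e : H ≃ₗ[k] H', ∀ z z', i' z' = μ (i z) → e (π z) = π' z' := by
  let T : Z →ₗ[k] Z' := (LinearEquiv.ofInjective i' h'.injective).symm.toLinearMap ∘ₗ
    (μ.toLinearMap ∘ₗ i).codRestrict (LinearMap.range i') fun z =>
      (h'.exact _).1 (by
        change d' (μ (i z)) = 0
        rw [hμ, h.d_i, map_zero])
  have hT : ∀ z, i' (T z) = μ (i z) := fun z =>
    congrArg Subtype.val ((LinearEquiv.ofInjective i' h'.injective).apply_symm_apply _)
  have hTs : Function.Surjective (π' ∘ₗ T) := by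
    intro x
    obtain ⟨z', rfl⟩ := h'.surjective x
    obtain ⟨z, hz⟩ := (h.exact (μ.symm (i' z'))).1 (μ.injective (by
      rw [← hμ, μ.apply_symm_apply, h'.d_i, map_zero]))
    refine ⟨z, congrArg π' (h'.injective ?_)⟩
    rw [hT, hz, μ.apply_symm_apply]
  have hker : LinearMap.ker π = LinearMap.ker (π' ∘ₗ T) := by
    ext z
    rw [LinearMap.mem_ker, LinearMap.mem_ker, LinearMap.comp_apply, h.eq_zero_iff,
      h'.eq_zero_iff, hT]
    constructor
    · rintro ⟨y, hy⟩
      exact ⟨μ y, by rw [hμ, hy]⟩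
    · rintro ⟨y, hy⟩
      exact ⟨μ.symm y, μ.injective (by rw [← hμ, μ.apply_symm_apply, hy])⟩
  refine ⟨(π.quotKerEquivOfSurjective h.surjective).symm ≪≫ₗ Submodule.quotEquivOfEq _ _ hker ≪≫ₗ
    (π' ∘ₗ T).quotKerEquivOfSurjective hTs, fun z z' hz => ?_⟩
  have h1 : (π.quotKerEquivOfSurjective h.surjective).symm (π z) = Submodule.Quotient.mk z := by
    rw [LinearEquiv.symm_apply_eq]; rfl
  rw [LinearEquiv.trans_apply, LinearEquiv.trans_apply, h1]
  refine congrArg π' (h'.injective ?_)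
  rw [hT, hz]
  rfl

end Kunneth

/-! ### Flatness of cycles and boundaries -/

section Flat

/-- The kernel of a surjection of flat modules is flat. -/
theorem flat_of_exact {k X Y F : Type*} [CommRing k] [AddCommGroup X] [Module k X]
    [AddCommGroup Y] [Module k Y] [AddCommGroup F] [Module k F] [Module.Flat k Y]
    [Module.Flat k F] {f : X →ₗ[k] Y} {g : Y →ₗ[k] F} (hf : Function.Injective f)
    (hg : Function.Surjective g) (h : Function.Exact f g) : Module.Flat k X := by
  rw [Module.Flat.iff_rTensor_injectiveₛ]
  intro P _ _ Q
  let := Module.addCommMonoidToAddCommGroup k (M := P)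
  have h1 := (Module.Flat.lTensor_preserves_injective_linearMap (M := Y) Q.subtype
    Subtype.val_injective).comp (rTensor_injective_of_exact hf hg h Q)
  rw [← LinearMap.lTensor_inj_iff_rTensor_inj]
  refine Function.Injective.of_comp (f := f.rTensor P) ?_
  rw [← LinearMap.coe_comp] at h1 ⊢
  rw [LinearMap.rTensor_comp_lTensor]
  rwa [LinearMap.lTensor_comp_rTensor] at h1

variable {k : Type u} [CommRing k] (K : ChainComplex (ModuleCat.{v} k) ℕ)

theorem exact_iCycles_rangeRestrict (n : ℕ) :
    Function.Exact (K.iCycles n).hom (K.d n (n - 1)).hom.rangeRestrict := fun x => by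
  constructor
  · intro hx
    refine exists_iCycles_eq K fun j => ?_
    by_cases hj : n = j + 1
    · subst hj
      exact congrArg Subtype.val hx
    · rw [K.shape n j fun h => hj h.symm]; rfl
  · rintro ⟨z, rfl⟩
    exact Subtype.ext (d_iCycles_apply K _ _ z)

theorem flat_cycles {n : ℕ} (hX : Module.Flat k (K.X n))
    (hB : Module.Flat k (LinearMap.range (K.d n (n - 1)).hom)) : Module.Flat k (K.cycles n) :=
  flat_of_exact (iCycles_injective K n) (LinearMap.surjective_rangeRestrict _)
    (exact_iCycles_rangeRestrict K n)

theorem flat_boundaries_succ {n : ℕ} (hZ : Module.Flat k (K.cycles n))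
    (hH : Module.Flat k (K.homology n)) :
    Module.Flat k (LinearMap.range (K.d (n + 1) n).hom) := by
  let ι' : K.cycles n ≃ₗ[k] LinearMap.range (K.iCycles n).hom :=
    LinearEquiv.ofInjective _ (iCycles_injective K n)
  let j : LinearMap.range (K.d (n + 1) n).hom →ₗ[k] K.cycles n := ι'.symm.toLinearMap ∘ₗ
    (LinearMap.range (K.d (n + 1) n).hom).subtype.codRestrict _ (by
      rintro ⟨_, w, rfl⟩
      exact exists_iCycles_eq K fun l => d_d_apply K _ _ _ w)
  have hj : ∀ b, (K.iCycles n).hom (j b) = b := fun b =>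
    congrArg Subtype.val (ι'.apply_symm_apply _)
  refine flat_of_exact (f := j) (g := (K.homologyπ n).hom) (fun a b hab => ?_)
    (homologyπ_surjective K n) fun z => ?_
  · exact Subtype.ext (by rw [← hj, hab, hj])
  · rw [homologyπ_eq_zero_iff]
    constructor
    · rintro ⟨m, y, hy⟩
      by_cases hm : m = n + 1
      · subst hm
        exact ⟨⟨_, y, rfl⟩, iCycles_injective K n ((hj _).trans hy)⟩
      · rw [K.shape m n fun h => hm h.symm] at hy
        refine ⟨0, iCycles_injective K n ?_⟩
        rw [map_zero, map_zero, ← hy]; rfl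
    · rintro ⟨⟨_, w, rfl⟩, rfl⟩
      exact ⟨n + 1, w, (hj ⟨_, w, rfl⟩).symm⟩

/-- If the terms and the homology are flat, so are the boundaries, and by `flat_cycles` the cycles:
the cycles in degree `n` are the kernel of a surjection from the terms to the boundaries in degree
`n - 1`, and the boundaries in degree `n` are the kernel of the surjection to homology. -/
theorem flat_boundaries (hX : ∀ n, Module.Flat k (K.X n)) (hH : ∀ n, Module.Flat k (K.homology n))
    (n : ℕ) : Module.Flat k (LinearMap.range (K.d n (n - 1)).hom) := by
  induction n with
  | zero =>
    rw [K.shape 0 (0 - 1) (by simp), ModuleCat.hom_zero, LinearMap.range_zero]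
    infer_instance
  | succ n ih => exact flat_boundaries_succ K (flat_cycles K (hX n) ih) (hH n)

end Flat

/-! ### The differential module underlying a chain complex -/

section DirectSumComplex

variable {k : Type u} [CommRing k] (K : ChainComplex (ModuleCat.{v} k) ℕ)

/-- The differential on the direct sum of the terms of a chain complex. In degree `0` it is the
zero map `K.d 0 0`. -/
noncomputable def sumD : (⨁ n, K.X n) →ₗ[k] ⨁ n, K.X n :=
  DirectSum.toModule k ℕ _ fun n => DirectSum.lof k ℕ (fun n => K.X n) (n - 1) ∘ₗ
    (K.d n (n - 1)).hom

theorem sumD_lof (n : ℕ) (x : K.X n) : sumD K (DirectSum.lof k ℕ (fun n => K.X n) n x) =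
    DirectSum.lof k ℕ (fun n => K.X n) (n - 1) ((K.d n (n - 1)).hom x) := by
  rw [sumD, DirectSum.toModule_lof]; rfl

theorem sumD_lof_succ (n : ℕ) (x : K.X (n + 1)) :
    sumD K (DirectSum.lof k ℕ (fun n => K.X n) (n + 1) x) =
    DirectSum.lof k ℕ (fun n => K.X n) n ((K.d (n + 1) n).hom x) := sumD_lof K _ x

theorem sumD_lof_zero (x : K.X 0) :
    sumD K (DirectSum.lof k ℕ (fun n => K.X n) 0 x) = 0 := by
  rw [sumD_lof, K.shape 0 (0 - 1) (by simp)]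
  exact map_zero _

theorem sumD_apply (x : ⨁ n, K.X n) (n : ℕ) : sumD K x n = (K.d (n + 1) n).hom (x (n + 1)) := by
  induction x using DirectSum.induction_on with
  | zero => simp
  | of m x =>
    change sumD K (DirectSum.lof k ℕ (fun n => K.X n) m x) n =
      (K.d (n + 1) n).hom (DirectSum.lof k ℕ (fun n => K.X n) m x (n + 1))
    rcases m with _ | m
    · have h : DirectSum.lof k ℕ (fun n => K.X n) 0 x (n + 1) = 0 :=
        DirectSum.of_eq_of_ne _ _ _ (Nat.succ_ne_zero n)
      rw [sumD_lof, K.shape 0 (0 - 1) (by simp), h, map_zero]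
      simp
    · rw [sumD_lof_succ]
      by_cases h : m = n
      · subst h
        rw [DirectSum.lof_apply, DirectSum.lof_apply]
      · rw [DirectSum.lof_eq_of, DirectSum.lof_eq_of, DirectSum.of_eq_of_ne _ _ _ (Ne.symm h),
          DirectSum.of_eq_of_ne _ _ _ (by omega), map_zero]
  | add x y hx hy => rw [map_add, DirectSum.add_apply, hx, hy, DirectSum.add_apply, map_add]

/-- The homology of the direct sum of the terms is the direct sum of the homology modules. -/
theorem isHomology_sumD : IsHomology (sumD K)
    (DirectSum.lmap fun n => (K.iCycles n).hom) (DirectSum.lmap fun n => (K.homologyπ n).hom) where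
  comp_self := by
    refine LinearMap.ext fun x => DFinsupp.ext fun n => ?_
    rw [LinearMap.comp_apply, sumD_apply, sumD_apply, d_d_apply]; rfl
  injective := (DirectSum.lmap_injective _).2 fun n => iCycles_injective K n
  surjective := (DirectSum.lmap_surjective _).2 fun n => homologyπ_surjective K n
  exact x := by
    rw [← LinearMap.coe_range, SetLike.mem_coe, DirectSum.range_lmap]
    constructor
    · intro hx n _
      refine exists_iCycles_eq K fun j => ?_
      by_cases hj : n = j + 1
      · subst hj
        rw [DirectSum.coeFnLinearMap_apply, ← sumD_apply, hx]; rfl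
      · rw [K.shape n j fun h => hj h.symm]; rfl
    · intro hx
      refine DFinsupp.ext fun n => ?_
      obtain ⟨z, hz⟩ := hx (n + 1) trivial
      rw [sumD_apply]
      exact (congrArg _ hz.symm).trans (d_iCycles_apply K _ _ z)
  eq_zero_iff z := by
    constructor
    · intro hz
      have h : DirectSum.lmap (fun n => (K.iCycles n).hom) z ∈
          LinearMap.range (DirectSum.lmap fun n => (K.d (n + 1) n).hom) := by
        rw [DirectSum.range_lmap]
        intro n _
        obtain ⟨m, y, hy⟩ := (homologyπ_eq_zero_iff K (z n)).1 (DFunLike.congr_fun hz n)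
        by_cases hm : m = n + 1
        · subst hm
          exact ⟨y, hy⟩
        · rw [K.shape m n fun h => hm h.symm] at hy
          exact ⟨0, (map_zero _).trans hy⟩
      obtain ⟨w, hw⟩ := h
      refine ⟨DirectSum.toModule k ℕ _ (fun n => DirectSum.lof k ℕ (fun n => K.X n) (n + 1)) w, ?_⟩
      rw [← hw, ← LinearMap.comp_apply]
      refine DFunLike.congr_fun (DirectSum.linearMap_ext _ fun n => LinearMap.ext fun x => ?_) w
      rw [LinearMap.comp_apply, LinearMap.comp_apply, LinearMap.comp_apply, DirectSum.toModule_lof,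
        sumD_lof_succ, DirectSum.lmap_lof]
    · rintro ⟨w, hw⟩
      refine DFinsupp.ext fun n => (homologyπ_eq_zero_iff K (z n)).2 ⟨n + 1, w (n + 1), ?_⟩
      rw [← sumD_apply, hw]; rfl

theorem flat_range_sumD (hX : ∀ n, Module.Flat k (K.X n))
    (hH : ∀ n, Module.Flat k (K.homology n)) : Module.Flat k (LinearMap.range (sumD K)) := by
  have := flat_boundaries K hX hH
  let g : (⨁ n, K.X n) →ₗ[k] ⨁ n, LinearMap.range (K.d n (n - 1)).hom :=
    DirectSum.lmap fun n => (K.d n (n - 1)).hom.rangeRestrict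
  have hg : Function.Surjective g :=
    (DirectSum.lmap_surjective _).2 fun n => LinearMap.surjective_rangeRestrict _
  have hker : LinearMap.ker (sumD K) = LinearMap.ker g := by
    ext x
    rw [LinearMap.mem_ker, LinearMap.mem_ker]
    constructor
    · intro hx
      refine DFinsupp.ext fun n => Subtype.ext ?_
      rcases n with _ | n
      · change (K.d 0 (0 - 1)).hom (x 0) = 0
        rw [K.shape 0 (0 - 1) (by simp)]; rfl
      · exact (sumD_apply K x n).symm.trans (DFunLike.congr_fun hx n)
    · intro hx
      refine DFinsupp.ext fun n => ?_
      rw [sumD_apply]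
      exact congrArg Subtype.val (DFunLike.congr_fun hx (n + 1))
  exact Module.Flat.of_linearEquiv ((sumD K).quotKerEquivRange.symm.trans
    ((Submodule.quotEquivOfEq _ _ hker).trans (g.quotKerEquivOfSurjective hg)))

theorem flat_sum_cycles (hX : ∀ n, Module.Flat k (K.X n))
    (hH : ∀ n, Module.Flat k (K.homology n)) : Module.Flat k (⨁ n, K.cycles n) := by
  have := fun n => flat_cycles K (hX n) (flat_boundaries K hX hH n)
  infer_instance

/-- The sign involution `(-1)ⁿ` of a graded module. -/
noncomputable def signMap : (⨁ n, K.X n) →ₗ[k] ⨁ n, K.X n :=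
  DirectSum.lmap fun n => ((-1 : k) ^ n) • LinearMap.id

theorem signMap_lof (n : ℕ) (x : K.X n) : signMap K (DirectSum.lof k ℕ (fun n => K.X n) n x) =
    (-1 : k) ^ n • DirectSum.lof k ℕ (fun n => K.X n) n x := by
  rw [signMap, DirectSum.lmap_lof, LinearMap.smul_apply, map_smul]; rfl

theorem signMap_signMap : signMap K ∘ₗ signMap K = LinearMap.id := by
  refine DirectSum.linearMap_ext _ fun n => LinearMap.ext fun x => ?_
  rw [LinearMap.comp_apply, LinearMap.comp_apply, signMap_lof, map_smul, signMap_lof, smul_smul,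
    ← mul_pow]
  simp

theorem sumD_signMap : sumD K ∘ₗ signMap K = -(signMap K ∘ₗ sumD K) := by
  refine DirectSum.linearMap_ext _ fun n => LinearMap.ext fun x => ?_
  simp only [LinearMap.comp_apply, LinearMap.neg_apply, signMap_lof, map_smul, sumD_lof]
  rcases n with _ | n
  · rw [K.shape 0 (0 - 1) (by simp)]; simp
  · rw [pow_succ, add_tsub_cancel_right, mul_neg_one, neg_smul]

end DirectSumComplex

/-! ### Grafting of trees -/

section Graft

/-- The values of a tree as a function on `ℕ`, extended by zero. -/
def TwoTree.val {p q : ℕ} (f : TwoTree p q) (n : ℕ) : ℕ :=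
  if h : n < p + 1 then f.1 ⟨n, h⟩ else 0

theorem TwoTree.val_of_lt {p q : ℕ} (f : TwoTree p q) {n : ℕ} (h : n < p + 1) :
    f.val n = f.1 ⟨n, h⟩ := dif_pos h

theorem TwoTree.val_coe {p q : ℕ} (f : TwoTree p q) (i : Fin (p + 1)) :
    f.val i = f.1 i := dif_pos i.2

theorem TwoTree.val_zero {p q : ℕ} (f : TwoTree p q) : f.val 0 = 0 := by
  rw [f.val_of_lt (Nat.succ_pos p)]
  obtain ⟨i, hi⟩ := f.2.2 0
  have : f.1 ⟨0, Nat.succ_pos p⟩ ≤ f.1 i := f.2.1 (Nat.zero_le _)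
  rw [hi] at this
  exact Nat.le_zero.1 this

theorem TwoTree.val_mono {p q : ℕ} (f : TwoTree p q) {m n : ℕ} (h : m ≤ n) (hn : n < p + 1) :
    f.val m ≤ f.val n := by
  rw [f.val_of_lt hn, f.val_of_lt (lt_of_le_of_lt h hn)]
  exact f.2.1 (Fin.mk_le_mk.2 h)

/-- The underlying function of `TwoTree.graft`. -/
def graftFun (a : ℕ) (f : ℕ → ℕ) (n : ℕ) : ℕ := if n ≤ a then 0 else f (n - (a + 1)) + 1

/-- The tree obtained from `f` by adding a leftmost height-one vertex with `a + 1` leaves. -/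
def TwoTree.graft (a : ℕ) {b q : ℕ} (f : TwoTree b q) : TwoTree (a + 1 + b) (q + 1) :=
  ⟨fun i => ⟨graftFun a f.val i, by
    have := i.2
    unfold graftFun
    split_ifs with h
    · exact Nat.succ_pos _
    · rw [f.val_of_lt (by omega)]
      exact Nat.succ_lt_succ (Fin.is_lt _)⟩, by
    constructor
    · intro i j hij
      have hj := j.2
      rw [Fin.le_def] at hij
      change graftFun a f.val i ≤ graftFun a f.val j
      unfold graftFun
      split_ifs
      · exact le_rfl
      · exact Nat.zero_le _
      · omega
      · exact Nat.succ_le_succ (f.val_mono (by omega) (by omega))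
    · intro m
      refine Fin.cases ⟨0, ?_⟩ (fun m => ?_) m
      · exact Fin.ext (by simp [graftFun])
      · obtain ⟨i, hi⟩ := f.2.2 m
        refine ⟨⟨a + 1 + i, by omega⟩, Fin.ext ?_⟩
        change graftFun a f.val (a + 1 + i) = m + 1
        rw [graftFun, if_neg (by omega), Nat.add_sub_cancel_left, f.val_coe, hi]⟩

theorem TwoTree.graft_val (a : ℕ) {b q : ℕ} (f : TwoTree b q) {n : ℕ} (h : n < a + 1 + b + 1) :
    (f.graft a).val n = graftFun a f.val n := by
  rw [TwoTree.val_of_lt _ h]; rfl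

/-- Cutting off the leaves over the leftmost vertex shows that every tree with at least two height-one
vertices is obtained by grafting. -/
theorem TwoTree.exists_graft {p q : ℕ} (f : TwoTree p (q + 1)) :
    ∃ (a b : ℕ) (g : TwoTree b q) (h : a + 1 + b = p), (h ▸ g.graft a) = f := by
  classical
  obtain ⟨a, ha0, hap, hlt⟩ : ∃ a, f.val a = 0 ∧ a ≤ p ∧ ∀ n, a < n → n ≤ p → f.val n ≠ 0 :=
    ⟨Nat.findGreatest (fun n => f.val n = 0) p,
      Nat.findGreatest_spec (P := fun n => f.val n = 0) (Nat.zero_le p) f.val_zero,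
      Nat.findGreatest_le p,
      fun n h h' => Nat.findGreatest_is_greatest (P := fun n => f.val n = 0) h h'⟩
  have hap' : a < p := by
    obtain ⟨i, hi⟩ := f.2.2 (Fin.last _)
    rcases hap.lt_or_eq with h | h
    · exact h
    · have := f.val_mono (m := i) (n := a) (by omega) (by omega)
      rw [f.val_coe, hi, ha0, Fin.val_last] at this
      omega
  obtain ⟨b, hb⟩ : ∃ b, a + 1 + b = p := ⟨p - (a + 1), by omega⟩
  subst hb
  have hval : ∀ i : Fin (b + 1), f.val (a + 1 + i) - 1 < q + 1 := fun i => by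
    rw [f.val_of_lt (by omega)]
    have := (f.1 ⟨a + 1 + i, by omega⟩).2
    omega
  refine ⟨a, b, ⟨fun i => ⟨f.val (a + 1 + i) - 1, hval i⟩, fun i j hij => ?_, fun m => ?_⟩,
    rfl, ?_⟩
  · rw [Fin.le_def] at hij
    exact Nat.sub_le_sub_right (f.val_mono (by omega) (by omega)) 1
  · obtain ⟨i, hi⟩ := f.2.2 m.succ
    have h1 : f.val i = m + 1 := by rw [f.val_coe, hi]; rfl
    have h2 : a < i := by
      by_contra h
      have := f.val_mono (m := i) (n := a) (by omega) (by omega)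
      omega
    refine ⟨⟨i - (a + 1), by omega⟩, Fin.ext ?_⟩
    change f.val (a + 1 + (i - (a + 1))) - 1 = m
    rw [Nat.add_sub_cancel' h2, h1, Nat.add_sub_cancel]
  · refine Subtype.ext (funext fun n => Fin.ext ?_)
    change graftFun a _ n = _
    rw [← f.val_coe, graftFun]
    split_ifs with h
    · have := f.val_mono (m := n) (n := a) h (by omega)
      omega
    · rw [TwoTree.val_of_lt _ (by omega)]
      have := hlt n (by omega) (by omega)
      simp only [Nat.add_sub_cancel' (show a + 1 ≤ n by omega)]
      omega

/-- Every tree with at least two height-one vertices is obtained by grafting in a unique way. -/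
theorem graft_bijective (q : ℕ) : Function.Bijective
    (fun x : ℕ × (Σ b, TwoTree b q) =>
      (⟨x.1 + 1 + x.2.1, x.2.2.graft x.1⟩ : Σ p, TwoTree p (q + 1))) := by
  constructor
  · have key : ∀ {a b a' b' : ℕ} {f : TwoTree b q} {f' : TwoTree b' q},
        a + 1 + b = a' + 1 + b' → (f.graft a).val = (f'.graft a').val → ¬ a < a' := by
      intro a b a' b' f f' h hv hlt
      have := congrFun hv (a + 1)
      rw [TwoTree.graft_val _ _ (by omega), TwoTree.graft_val _ _ (by omega), graftFun, graftFun,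
        if_neg (by omega), if_pos (by omega)] at this
      omega
    rintro ⟨a, b, f⟩ ⟨a', b', f'⟩ h
    have h1 : a + 1 + b = a' + 1 + b' := congrArg Sigma.fst h
    have hv : (f.graft a).val = (f'.graft a').val :=
      congrArg (fun x : Σ p, TwoTree p (q + 1) => x.2.val) h
    obtain rfl : a = a' := le_antisymm (not_lt.1 (key h1.symm hv.symm)) (not_lt.1 (key h1 hv))
    obtain rfl : b = b' := by omega
    obtain rfl : f = f' := by
      refine Subtype.ext (funext fun i => Fin.ext ?_)
      have := congrFun hv (a + 1 + i)
      rw [TwoTree.graft_val _ _ (by omega), TwoTree.graft_val _ _ (by omega), graftFun, graftFun,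
        if_neg (by omega), if_neg (by omega), Nat.add_sub_cancel_left, f.val_coe,
        f'.val_coe] at this
      omega
    rfl
  · rintro ⟨p, f⟩
    obtain ⟨a, b, g, rfl, rfl⟩ := f.exists_graft
    exact ⟨⟨a, b, g⟩, rfl⟩

/-- The equivalence `(a, b, f) ↦ (a + 1 + b, f.graft a)`. -/
noncomputable def graftEquiv (q : ℕ) : (ℕ × (Σ b, TwoTree b q)) ≃ Σ p, TwoTree p (q + 1) :=
  Equiv.ofBijective _ (graft_bijective q)

end Graft

section Product

variable (k : Type u) [CommRing k] (A : Type v) [NonUnitalCommRing A] [Module k A]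

/-- The direct sum of the terms of the bar complex. -/
def BarSum : Type (max u v) := ⨁ n, ⨂[k]^(n + 1) A

noncomputable instance : AddCommGroup (BarSum k A) :=
  inferInstanceAs (AddCommGroup (⨁ n, ⨂[k]^(n + 1) A))

noncomputable instance : Module k (BarSum k A) :=
  inferInstanceAs (Module k (⨁ n, ⨂[k]^(n + 1) A))

/-- The direct sum of the terms of a row of the double complex. -/
def RowSum (q : ℕ) : Type (max u v) := ⨁ p, BiModule k A p q

noncomputable instance (q : ℕ) : AddCommGroup (RowSum k A q) :=
  inferInstanceAs (AddCommGroup (⨁ p, BiModule k A p q))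

noncomputable instance (q : ℕ) : Module k (RowSum k A q) :=
  inferInstanceAs (Module k (⨁ p, BiModule k A p q))

/-- `BarSum` is a direct sum. -/
noncomputable def barSumEquiv : BarSum k A ≃ₗ[k] ⨁ n, ⨂[k]^(n + 1) A :=
  LinearEquiv.refl k (⨁ n, ⨂[k]^(n + 1) A)

/-- `RowSum` is a direct sum. -/
noncomputable def rowSumEquiv (q : ℕ) : RowSum k A q ≃ₗ[k] ⨁ p, BiModule k A p q :=
  LinearEquiv.refl k (⨁ p, BiModule k A p q)

/-- The inclusion of the tensors of degree `n` in the bar complex. -/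
noncomputable def barLof (n : ℕ) : (⨂[k]^(n + 1) A) →ₗ[k] BarSum k A :=
  (barSumEquiv k A).symm.toLinearMap ∘ₗ DirectSum.lof k ℕ (fun n => ⨂[k]^(n + 1) A) n

/-- The inclusion of the summand of the tree `f` in the row complex. -/
noncomputable def rowLof {p q : ℕ} (f : TwoTree p q) : (⨂[k]^(p + 1) A) →ₗ[k] RowSum k A q :=
  (rowSumEquiv k A q).symm.toLinearMap ∘ₗ DirectSum.lof k ℕ (fun p => BiModule k A p q) p ∘ₗ
    DirectSum.lof k (TwoTree p q) (fun _ => ⨂[k]^(p + 1) A) f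

/-- The reindexing of the summands of a row along `graftEquiv`. -/
noncomputable def graftSum (q : ℕ) :
    (⨁ x : ℕ × (Σ b, TwoTree b q), ⨂[k]^((x.1 + 1) + (x.2.1 + 1)) A) ≃ₗ[k]
      ⨁ z : Σ p, TwoTree p (q + 1), ⨂[k]^(z.1 + 1) A :=
  (DirectSum.lequivCongrLeft k (M := fun z : Σ p, TwoTree p (q + 1) => ⨂[k]^(z.1 + 1) A)
    (graftEquiv q).symm).symm

theorem graftSum_lof (q a b : ℕ) (f : TwoTree b q) (x : ⨂[k]^((a + 1) + (b + 1)) A) :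
    graftSum k A q (DirectSum.lof k _ (fun x : ℕ × (Σ b, TwoTree b q) =>
      ⨂[k]^((x.1 + 1) + (x.2.1 + 1)) A) (a, ⟨b, f⟩) x) =
      DirectSum.lof k _ (fun z : Σ p, TwoTree p (q + 1) => ⨂[k]^(z.1 + 1) A)
        ⟨a + 1 + b, f.graft a⟩ x :=
  DirectSum.lequivCongrLeft_symm_lof k
    (M := fun z : Σ p, TwoTree p (q + 1) => ⨂[k]^(z.1 + 1) A) (h := (graftEquiv q).symm)
    (k := (a, ⟨b, f⟩)) (x := x)

/-- The isomorphism of the tensor product of the bar complex and a row with the next row, given by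
juxtaposition of tensors and grafting of trees. -/
noncomputable def graftMul (q : ℕ) : BarSum k A ⊗[k] RowSum k A q ≃ₗ[k] RowSum k A (q + 1) :=
  (TensorProduct.congr (barSumEquiv k A) ((rowSumEquiv k A q).trans
    (DirectSum.sigmaLcurryEquiv k (δ := fun p (_ : TwoTree p q) => ⨂[k]^(p + 1) A)).symm)).trans <|
  (TensorProduct.directSum k k (fun n => ⨂[k]^(n + 1) A)
    (fun σ : Σ p, TwoTree p q => ⨂[k]^(σ.1 + 1) A)).trans <|
  (DirectSum.congrLinearEquiv fun x : ℕ × (Σ p, TwoTree p q) =>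
    (TensorPower.mulEquiv : _ ≃ₗ[k] ⨂[k]^((x.1 + 1) + (x.2.1 + 1)) A)).trans <|
  (graftSum k A q).trans <|
  (DirectSum.sigmaLcurryEquiv k (δ := fun p (_ : TwoTree p (q + 1)) => ⨂[k]^(p + 1) A)).trans
  (rowSumEquiv k A (q + 1)).symm

theorem graftMul_tmul (q a b : ℕ) (f : TwoTree b q) (z : ⨂[k]^(a + 1) A) (w : ⨂[k]^(b + 1) A) :
    graftMul k A q (barLof k A a z ⊗ₜ rowLof k A f w) =
      rowLof k A (f.graft a) (TensorPower.mulEquiv (n := a + 1) (m := b + 1) (z ⊗ₜ w)) := by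
  have h1 : (DirectSum.sigmaLcurryEquiv k
      (δ := fun p (_ : TwoTree p q) => ⨂[k]^(p + 1) A)).symm
      (rowSumEquiv k A q (rowLof k A f w)) =
      DirectSum.lof k (Σ p, TwoTree p q) (fun σ => ⨂[k]^(σ.1 + 1) A) ⟨b, f⟩ w :=
    DFinsupp.sigmaUncurry_single _ _ _
  have h2 : ∀ (z : Σ p, TwoTree p (q + 1)) (w : ⨂[k]^(z.1 + 1) A),
      (rowSumEquiv k A (q + 1)).symm (DirectSum.sigmaLcurryEquiv k
        (δ := fun p (_ : TwoTree p (q + 1)) => ⨂[k]^(p + 1) A)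
        (DirectSum.lof k (Σ p, TwoTree p (q + 1)) (fun σ => ⨂[k]^(σ.1 + 1) A) z w)) =
      rowLof k A z.2 w := fun z w => congrArg (rowSumEquiv k A (q + 1)).symm
    (DFinsupp.sigmaCurry_single (δ := fun p (_ : TwoTree p (q + 1)) => ⨂[k]^(p + 1) A) z w)
  have h0 : barSumEquiv k A (barLof k A a z) = DirectSum.lof k ℕ (fun n => ⨂[k]^(n + 1) A) a z :=
    rfl
  simp only [graftMul, LinearEquiv.trans_apply, TensorProduct.congr_tmul, h0, h1]
  rw [TensorProduct.directSum_lof_tmul_lof]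
  have h3 : (DirectSum.congrLinearEquiv fun x : ℕ × (Σ p, TwoTree p q) =>
    (TensorPower.mulEquiv : _ ≃ₗ[k] ⨂[k]^((x.1 + 1) + (x.2.1 + 1)) A))
    (DirectSum.lof k (ℕ × (Σ p, TwoTree p q)) (fun x => (⨂[k]^(x.1 + 1) A) ⊗[k] ⨂[k]^(x.2.1 + 1) A)
      (a, ⟨b, f⟩) (z ⊗ₜ w)) = DirectSum.lof k (ℕ × (Σ p, TwoTree p q))
        (fun x => ⨂[k]^((x.1 + 1) + (x.2.1 + 1)) A) (a, ⟨b, f⟩)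
        (TensorPower.mulEquiv (z ⊗ₜ w)) := by
    rw [DirectSum.coe_congrLinearEquiv, DirectSum.lmap_lof]; rfl
  rw [h3, graftSum_lof]
  exact h2 ⟨a + 1 + b, f.graft a⟩ _

end Product

/-! ### The Leibniz rule for grafting -/

section Sequences

/-- The tree `g` with `g ∘ d_i = f`, as a function on `ℕ`. -/
def glueFun (i : ℕ) (f : ℕ → ℕ) (n : ℕ) : ℕ := if n ≤ i then f n else f (n + 1)

/-- The sequence with the entries `i` and `i + 1` replaced by their product. -/
def mergeSeq {A : Type*} [Mul A] (i : ℕ) (c : ℕ → A) (n : ℕ) : A :=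
  if n < i then c n else if n = i then c i * c (i + 1) else c (n + 1)

/-- The sequence with the entries `c 0, …, c a, d 0, d 1, …`. -/
def concatSeq {A : Type*} (a : ℕ) (c d : ℕ → A) (n : ℕ) : A :=
  if n ≤ a then c n else d (n - (a + 1))

theorem glueFun_graftFun_of_lt {i a : ℕ} (h : i < a) (f : ℕ → ℕ) :
    glueFun i (graftFun a f) = graftFun (a - 1) f := by
  funext n
  simp only [glueFun, graftFun]
  split_ifs <;> first | rfl | omega | (congr 2; omega)

theorem glueFun_graftFun_add (a j : ℕ) (f : ℕ → ℕ) :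
    glueFun (a + 1 + j) (graftFun a f) = graftFun a (glueFun j f) := by
  funext n
  simp only [glueFun, graftFun]
  split_ifs <;> first | rfl | omega | (congr 2; omega)

theorem mergeSeq_concatSeq_of_lt {A : Type*} [Mul A] {i a : ℕ} (h : i < a) (c d : ℕ → A) :
    mergeSeq i (concatSeq a c d) = concatSeq (a - 1) (mergeSeq i c) d := by
  funext n
  simp only [mergeSeq, concatSeq]
  split_ifs <;> first | rfl | omega | (congr 1; omega)

theorem mergeSeq_concatSeq_add {A : Type*} [Mul A] (a j : ℕ) (c d : ℕ → A) :
    mergeSeq (a + 1 + j) (concatSeq a c d) = concatSeq a c (mergeSeq j d) := by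
  funext n
  simp only [mergeSeq, concatSeq]
  split_ifs <;> first | rfl | omega | (congr 2 <;> omega)

theorem TwoTree.glueLeaves_coe {p q : ℕ} (f : TwoTree (p + 1) q) (i : Fin (p + 1))
    (h : f.1 i.castSucc = f.1 i.succ) (j : Fin (p + 1)) :
    ((f.glueLeaves i h).1 j : ℕ) = glueFun i f.val j := by
  change (f.1 (i.succ.succAbove j) : ℕ) = _
  rw [← f.val_coe]
  unfold glueFun
  split_ifs with hi
  · rw [Fin.succAbove_of_castSucc_lt _ _ (by rw [Fin.lt_def]; exact Nat.lt_succ_of_le hi)]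
    rfl
  · rw [Fin.succAbove_of_le_castSucc _ _ (by rw [Fin.le_def]; exact not_le.1 hi)]
    rfl

theorem TwoTree.exists_glue {p q : ℕ} (f : TwoTree p q) {j : ℕ} (hj : j < p)
    (h : f.val j = f.val (j + 1)) :
    ∃ g : TwoTree (p - 1) q, ∀ i : Fin (p - 1 + 1), (g.1 i : ℕ) = glueFun j f.val i := by
  obtain ⟨p, rfl⟩ : ∃ p', p = p' + 1 := ⟨p - 1, by omega⟩
  have h' : f.1 (Fin.castSucc ⟨j, hj⟩) = f.1 (Fin.succ ⟨j, hj⟩) := by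
    refine Fin.ext ?_
    rw [← f.val_coe, ← f.val_coe]
    exact h
  exact ⟨f.glueLeaves ⟨j, hj⟩ h', f.glueLeaves_coe ⟨j, hj⟩ h'⟩

end Sequences

/-- The extension of a tuple by zero. -/
def extendZero {A : Type*} [Zero A] {n : ℕ} (v : Fin n → A) (m : ℕ) : A :=
  if h : m < n then v ⟨m, h⟩ else 0

theorem extendZero_comp {A : Type*} [Zero A] {n : ℕ} (v : Fin n → A) :
    (fun i : Fin n => extendZero v i) = v :=
  funext fun i => dif_pos i.2

section Generators

variable (k : Type u) [CommRing k] {A : Type v} [NonUnitalCommRing A] [Module k A]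

/-- On sequences, `push` along `d_i` multiplies neighbouring entries. -/
theorem fibreProd_predAbove [IsScalarTower k A A] [SMulCommClass k A A] {n : ℕ} (i : Fin n)
    (c : ℕ → A) : fibreProd k i.predAbove (fun j => c j) = fun j : Fin n => mergeSeq i c j := by
  rcases n with _ | n
  · exact i.elim0
  funext j
  apply Unitization.inr_injective (R := k)
  rw [inr_fibreProd k (predAbove_surjective i), Finset.prod_filter, Fin.prod_univ_succAbove _ i.succ]
  simp only [predAbove_succAbove, Finset.prod_ite_eq', Finset.mem_univ, if_true]
  have h1 : i.predAbove i.succ = i := by simp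
  have hs : ((i.succ.succAbove j : Fin (n + 2)) : ℕ) = if (j : ℕ) ≤ i then (j : ℕ) else j + 1 := by
    split_ifs with hi
    · rw [Fin.succAbove_of_castSucc_lt _ _ (by rw [Fin.lt_def]; exact Nat.lt_succ_of_le hi)]; rfl
    · rw [Fin.succAbove_of_le_castSucc _ _ (by rw [Fin.le_def]; exact not_le.1 hi)]; rfl
  rw [h1, hs, Fin.val_succ, mergeSeq]
  split_ifs with h2 h3 h4 h5 h6 h7
  all_goals first
    | (exfalso; simp only [Fin.ext_iff] at *; omega)
    | simp
  rw [← h2, mul_comm]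

variable (A) in
/-- The elementary tensor `c 0 ⊗ ⋯ ⊗ c n` in the bar complex. -/
noncomputable def barE (n : ℕ) (c : ℕ → A) : BarSum k A :=
  barLof k A n (PiTensorProduct.tprod k fun i => c i)

variable (A) in
open Classical in
/-- The elementary tensor `c 0 ⊗ ⋯ ⊗ c p` in the summand of the tree `[p] → [q]` with values
`f 0, …, f p`. The value is zero if there is no such tree; as `f` is an arbitrary function, the
type does not depend on `p`. -/
noncomputable def rowE (q p : ℕ) (f : ℕ → ℕ) (c : ℕ → A) : RowSum k A q :=
  if h : ∃ g : TwoTree p q, ∀ i : Fin (p + 1), (g.1 i : ℕ) = f i then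
    rowLof k A h.choose (PiTensorProduct.tprod k fun i => c i) else 0

theorem rowE_eq {p q : ℕ} (g : TwoTree p q) {f : ℕ → ℕ}
    (h : ∀ i : Fin (p + 1), (g.1 i : ℕ) = f i) (c : ℕ → A) :
    rowE k A q p f c = rowLof k A g (PiTensorProduct.tprod k fun i => c i) := by
  have h' : ∃ g : TwoTree p q, ∀ i : Fin (p + 1), (g.1 i : ℕ) = f i := ⟨g, h⟩
  rw [rowE, dif_pos h']
  have : h'.choose = g :=
    Subtype.ext (funext fun i => Fin.ext ((h'.choose_spec i).trans (h i).symm))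
  rw [this]

theorem rowE_congr {p q : ℕ} {f g : ℕ → ℕ} (h : ∀ n < p + 1, f n = g n) (c : ℕ → A) :
    rowE k A q p f c = rowE k A q p g c := by
  by_cases hg : ∃ t : TwoTree p q, ∀ i : Fin (p + 1), (t.1 i : ℕ) = g i
  · obtain ⟨t, ht⟩ := hg
    rw [rowE_eq k t ht, rowE_eq k t fun i => (ht i).trans (h i i.2).symm]
  · rw [rowE, rowE, dif_neg hg, dif_neg]
    exact fun ⟨t, ht⟩ => hg ⟨t, fun i => (ht i).trans (h i i.2)⟩

theorem graftMul_barE_rowE {a b q : ℕ} (g : TwoTree b q) {f : ℕ → ℕ}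
    (h : ∀ i : Fin (b + 1), (g.1 i : ℕ) = f i) (c d : ℕ → A) :
    graftMul k A q (barE k A a c ⊗ₜ rowE k A q b f d) =
      rowE k A (q + 1) (a + 1 + b) (graftFun a f) (concatSeq a c d) := by
  rw [rowE_eq k g h, rowE_eq k (g.graft a), barE, graftMul_tmul]
  · refine congrArg _ ((TensorPower.tprod_mul_tprod k _ _).trans (congrArg _ (funext fun i => ?_)))
    refine Fin.addCases (fun i => ?_) (fun i => ?_) i
    · rw [Fin.append_left, concatSeq, if_pos (by simp; omega)]; rfl
    · rw [Fin.append_right, concatSeq, if_neg (by simp; omega)]; simp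
  · intro i
    change graftFun a g.val i = graftFun a f i
    unfold graftFun
    split_ifs with hi
    · rfl
    · rw [g.val_of_lt (by omega), h]

theorem barSum_ext {M : Type*} [AddCommGroup M] [Module k M] {φ ψ : BarSum k A →ₗ[k] M}
    (h : ∀ n c, φ (barE k A n c) = ψ (barE k A n c)) : φ = ψ := by
  refine DirectSum.linearMap_ext _ fun n => PiTensorProduct.ext (MultilinearMap.ext fun v => ?_)
  rw [← extendZero_comp v]
  exact h n (extendZero v)

theorem rowSum_ext {q : ℕ} {M : Type*} [AddCommGroup M] [Module k M] {φ ψ : RowSum k A q →ₗ[k] M}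
    (h : ∀ p (g : TwoTree p q) c, φ (rowE k A q p g.val c) = ψ (rowE k A q p g.val c)) :
    φ = ψ := by
  refine DirectSum.linearMap_ext _ fun p => DirectSum.linearMap_ext _ fun g =>
    PiTensorProduct.ext (MultilinearMap.ext fun v => ?_)
  rw [← extendZero_comp v]
  have := h p g (extendZero v)
  rw [rowE_eq k g fun i => (g.val_coe i).symm] at this
  exact this

end Generators

section Leibniz

variable (k : Type u) [CommRing k] (A : Type v) [NonUnitalCommRing A] [Module k A]
  [IsScalarTower k A A] [SMulCommClass k A A]

/-- The differential of the bar complex on the direct sum of its terms. -/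
noncomputable def barSumD : BarSum k A →ₗ[k] BarSum k A :=
  sumD (barComplex k A)

/-- The differential of a row on the direct sum of its terms. -/
noncomputable def rowSumD (q : ℕ) : RowSum k A q →ₗ[k] RowSum k A q := sumD (rowComplex k A q)

/-- The sign involution of the bar complex. -/
noncomputable def barSign : BarSum k A →ₗ[k] BarSum k A := signMap (barComplex k A)

theorem barComplex_d (n : ℕ) : (barComplex k A).d (n + 1) n = ModuleCat.ofHom (barD k A n) :=
  ChainComplex.of_d (fun n => ModuleCat.of k (⨂[k]^(n + 1) A))
    (fun n => ModuleCat.ofHom (barD k A n)) n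

theorem rowComplex_d (p q : ℕ) :
    (rowComplex k A q).d (p + 1) p = ModuleCat.ofHom (leafD k A p q) :=
  ChainComplex.of_d (fun p => ModuleCat.of k (BiModule k A p q))
    (fun p => ModuleCat.ofHom (leafD k A p q)) p

theorem barSumD_barE (n : ℕ) (c : ℕ → A) : barSumD k A (barE k A n c) =
    ∑ i ∈ Finset.range n, (-1 : k) ^ i • barE k A (n - 1) (mergeSeq i c) := by
  rcases n with _ | n
  · exact sumD_lof_zero (barComplex k A) _
  · refine (sumD_lof_succ (barComplex k A) n _).trans ?_
    rw [barComplex_d]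
    change barLof k A n (barD k A n _) = _
    rw [barD, LinearMap.sum_apply, map_sum, Finset.sum_range]
    refine Finset.sum_congr rfl fun i _ => ?_
    rw [LinearMap.smul_apply, map_smul, push_tprod, fibreProd_predAbove]
    rfl

theorem rowSumD_rowE {p q : ℕ} (g : TwoTree p q) (c : ℕ → A) :
    rowSumD k A q (rowE k A q p g.val c) = ∑ i ∈ Finset.range p,
      if g.val i = g.val (i + 1) then
        (-1 : k) ^ (i + g.val i) • rowE k A q (p - 1) (glueFun i g.val) (mergeSeq i c) else 0 := by
  rw [rowE_eq k g fun i => (g.val_coe i).symm]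
  rcases p with _ | p
  · exact sumD_lof_zero (rowComplex k A q) _
  · refine (sumD_lof_succ (rowComplex k A q) p _).trans ?_
    rw [rowComplex_d]
    change ((rowSumEquiv k A q).symm.toLinearMap ∘ₗ
      DirectSum.lof k ℕ (fun p => BiModule k A p q) p)
      ((leafD k A p q ∘ₗ DirectSum.lof k _ (fun _ => ⨂[k]^(p + 2) A) g) _) = _
    rw [leafD_lof]
    rw [LinearMap.sum_apply, map_sum, Finset.sum_range]
    refine Finset.sum_congr rfl fun i _ => ?_
    have h1 : g.val i = g.1 i.castSucc := g.val_coe i.castSucc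
    have h2 : g.val (i + 1) = g.1 i.succ := g.val_coe i.succ
    by_cases h3 : g.1 i.castSucc = g.1 i.succ
    · rw [dif_pos h3, if_pos (by rw [h1, h2, h3]), add_tsub_cancel_right,
        rowE_eq k (g.glueLeaves i h3) (g.glueLeaves_coe i h3), LinearMap.smul_apply, map_smul,
        pushTo, LinearMap.comp_apply, LinearMap.comp_apply,
        push_tprod, fibreProd_predAbove, h1]
      have h5 : (-1 : k) ^ g.leafLabel i.castSucc = (-1) ^ ((i : ℕ) + g.1 i.castSucc) := by
        rw [TwoTree.leafLabel, Fin.val_castSucc]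
        ring
      rw [h5]
      rfl
    · rw [dif_neg h3, if_neg (by rw [h1, h2]; exact fun h => h3 (Fin.ext h))]
      simp

/-- Grafting is compatible with the differentials: the differential of a row never multiplies
leaves over different vertices, and the summand `f(i)` in the exponent of its sign is the Koszul
sign. -/
theorem rowSumD_graftMul (q : ℕ) (x : BarSum k A ⊗[k] RowSum k A q) :
    rowSumD k A (q + 1) (graftMul k A q x) =
      graftMul k A q (tensorD (barSumD k A) (rowSumD k A q)
        (barSign k A) x) := by
  suffices h : rowSumD k A (q + 1) ∘ₗ (graftMul k A q).toLinearMap =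
      (graftMul k A q).toLinearMap ∘ₗ tensorD (barSumD k A) (rowSumD k A q) (barSign k A) from
    LinearMap.congr_fun h x
  refine TensorProduct.ext (barSum_ext k fun a c => rowSum_ext k fun b g d => ?_)
  change rowSumD k A (q + 1) (graftMul k A q (barE k A a c ⊗ₜ rowE k A q b g.val d)) =
    graftMul k A q (tensorD (barSumD k A) (rowSumD k A q) (barSign k A)
      (barE k A a c ⊗ₜ rowE k A q b g.val d))
  have hg : ∀ i : Fin (b + 1), (g.1 i : ℕ) = g.val i := fun i => (g.val_coe i).symm
  have hsign : barSign k A (barE k A a c) = (-1 : k) ^ a • barE k A a c :=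
    signMap_lof (barComplex k A) a _
  have hgr : ∀ i : Fin (a + 1 + b + 1), ((g.graft a).1 i : ℕ) = graftFun a g.val i := fun i => rfl
  have hrow : rowE k A (q + 1) (a + 1 + b) (graftFun a g.val) (concatSeq a c d) =
      rowE k A (q + 1) (a + 1 + b) (g.graft a).val (concatSeq a c d) := by
    rw [rowE_eq k _ hgr, rowE_eq k _ fun i => ((g.graft a).val_coe i).symm]
  rw [tensorD_tmul, map_add, barSumD_barE, rowSumD_rowE, hsign, graftMul_barE_rowE k g hg, hrow,
    rowSumD_rowE, TensorProduct.sum_tmul, TensorProduct.tmul_sum, map_sum, map_sum,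
    Finset.sum_range_add, Finset.sum_range_succ]
  have hval : ∀ n, n < a + 1 + b + 1 → (g.graft a).val n = graftFun a g.val n :=
    fun n hn => g.graft_val a hn
  have hzero : ∀ n, n ≤ a → graftFun a g.val n = 0 := fun n hn => if_pos hn
  have hsucc : ∀ n, graftFun a g.val (a + 1 + n) = g.val n + 1 := fun n => by
    rw [graftFun, if_neg (by omega), Nat.add_sub_cancel_left]
  have hfun : ∀ (i : ℕ) (x : ℕ → A), i < a + 1 + b →
      rowE k A (q + 1) (a + 1 + b - 1) (glueFun i (g.graft a).val) x =
        rowE k A (q + 1) (a + 1 + b - 1) (glueFun i (graftFun a g.val)) x := fun i x hi => by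
    refine rowE_congr k (fun n hn => ?_) x
    unfold glueFun
    split_ifs <;> exact hval _ (by omega)
  rw [hval a (by omega), hval (a + 1) (by omega), hzero a le_rfl, hsucc 0, if_neg (by omega),
    add_zero]
  -- the leaves `a` and `a + 1` lie over different vertices; the remaining terms multiply two
  -- entries of `c`, or two entries of `d`
  congr 1
  · refine Finset.sum_congr rfl fun i hi => ?_
    have hi := Finset.mem_range.1 hi
    rw [hval i (by omega), hval (i + 1) (by omega), hzero i (by omega), hzero (i + 1) (by omega),
      if_pos rfl, hfun i _ (by omega), glueFun_graftFun_of_lt hi, mergeSeq_concatSeq_of_lt hi,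
      ← TensorProduct.smul_tmul', map_smul, graftMul_barE_rowE k g hg, add_zero,
      show a + 1 + b - 1 = a - 1 + 1 + b by omega]
  · refine Finset.sum_congr rfl fun j hj => ?_
    have hj := Finset.mem_range.1 hj
    rw [hval (a + 1 + j) (by omega), hval (a + 1 + j + 1) (by omega), hsucc,
      show a + 1 + j + 1 = a + 1 + (j + 1) by omega, hsucc]
    by_cases h : g.val j = g.val (j + 1)
    · obtain ⟨g', hg'⟩ := g.exists_glue hj h
      rw [if_pos (by rw [h]), if_pos h, hfun _ _ (by omega), glueFun_graftFun_add,
        mergeSeq_concatSeq_add, ← TensorProduct.smul_tmul', TensorProduct.tmul_smul, map_smul,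
        map_smul, graftMul_barE_rowE k g' hg', smul_smul,
        show a + 1 + b - 1 = a + 1 + (b - 1) by omega]
      congr 1
      ring
    · rw [if_neg (by omega), if_neg h, TensorProduct.tmul_zero, map_zero]

end Leibniz

/-! ### Iterated tensor products and graded isomorphisms -/

section General

variable {k : Type*} [CommRing k]

/-- Splitting off the first factor of a tensor power. -/
noncomputable def consEquiv (k : Type*) [CommRing k] (M : Type*) [AddCommMonoid M] [Module k M]
    (n : ℕ) : (⨂[k]^(n + 1) M) ≃ₗ[k] M ⊗[k] ⨂[k]^n M :=
  (PiTensorProduct.reindex k (fun _ => M)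
    ((finCongr (Nat.add_comm n 1)).trans finSumFinEquiv.symm)) ≪≫ₗ
  (PiTensorProduct.tmulEquiv k M).symm ≪≫ₗ
  TensorProduct.congr (PiTensorProduct.subsingletonEquiv (0 : Fin 1)) (LinearEquiv.refl k _)

theorem consEquiv_tprod {M : Type*} [AddCommMonoid M] [Module k M] {n : ℕ} (v : Fin (n + 1) → M) :
    consEquiv k M n (PiTensorProduct.tprod k v) =
      v 0 ⊗ₜ PiTensorProduct.tprod k (Fin.tail v) := by
  rw [consEquiv, LinearEquiv.trans_apply, LinearEquiv.trans_apply, PiTensorProduct.reindex_tprod]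
  erw [PiTensorProduct.tmulEquiv_symm_apply]
  rw [TensorProduct.congr_tmul, PiTensorProduct.subsingletonEquiv_apply_tprod]
  refine congrArg (_ ⊗ₜ ·) (congrArg (PiTensorProduct.tprod k) (funext fun i => ?_))
  exact congrArg v (Fin.ext (by simp))

theorem flat_tensorPower (M : Type*) [AddCommGroup M] [Module k M] [Module.Flat k M] (n : ℕ) :
    Module.Flat k (⨂[k]^n M) := by
  induction n with
  | zero => exact Module.Flat.of_linearEquiv (PiTensorProduct.isEmptyEquiv (Fin 0))
  | succ n ih => exact Module.Flat.of_linearEquiv (consEquiv k M n)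

/-- An isomorphism of direct sums that maps the summand `i` to the summand `deg i` restricts to an
isomorphism between the sum over each fibre of `deg` and the corresponding summand. -/
theorem exists_fibre_equiv {ι κ : Type*} [DecidableEq ι] [DecidableEq κ] {X : ι → Type*}
    {Y : κ → Type*} [∀ i, AddCommGroup (X i)] [∀ i, Module k (X i)] [∀ j, AddCommGroup (Y j)]
    [∀ j, Module k (Y j)] (deg : ι → κ) (e : (⨁ i, X i) ≃ₗ[k] ⨁ j, Y j)
    (he : ∀ i x, ∃ y, e (DirectSum.lof k ι X i x) = DirectSum.lof k κ Y (deg i) y) (j : κ) :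
    ∃ e' : (⨁ i : {i // deg i = j}, X i) ≃ₗ[k] Y j, ∀ i x,
      DirectSum.lof k κ Y j (e' (DirectSum.lof k _ (fun i : {i // deg i = j} => X i) i x)) =
        e (DirectSum.lof k ι X i x) := by
  let incl : ∀ j, (⨁ i : {i // deg i = j}, X i) →ₗ[k] ⨁ i, X i := fun j =>
    DirectSum.toModule k _ _ fun i => DirectSum.lof k ι X i
  let res : ∀ j, (⨁ i, X i) →ₗ[k] ⨁ i : {i // deg i = j}, X i := fun j =>
    DirectSum.toModule k _ _ fun i => if h : deg i = j then
      DirectSum.lof k _ (fun i : {i // deg i = j} => X i) ⟨i, h⟩ else 0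
  let φ : ∀ j, (⨁ i : {i // deg i = j}, X i) →ₗ[k] Y j := fun j =>
    DirectSum.component k κ Y j ∘ₗ e.toLinearMap ∘ₗ incl j
  have hincl : ∀ j (i : {i // deg i = j}) x,
      incl j (DirectSum.lof k _ (fun i : {i // deg i = j} => X i) i x) =
        DirectSum.lof k ι X i x := fun j i x =>
    DirectSum.toModule_lof k (ι := {i // deg i = j}) (M := fun i => X i) i x
  have hres : ∀ j i (h : deg i = j) x, res j (DirectSum.lof k ι X i x) =
      DirectSum.lof k _ (fun i : {i // deg i = j} => X i) ⟨i, h⟩ x := fun j i h x => by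
    rw [show res j _ = _ from DirectSum.toModule_lof k i x, dif_pos h]
  have hres' : ∀ j i (h : deg i ≠ j) x, res j (DirectSum.lof k ι X i x) = 0 := fun j i h x => by
    rw [show res j _ = _ from DirectSum.toModule_lof k i x, dif_neg h, LinearMap.zero_apply]
  have hri : ∀ j, res j ∘ₗ incl j = LinearMap.id := fun j => by
    refine DirectSum.linearMap_ext _ fun i => LinearMap.ext fun x => ?_
    rw [LinearMap.comp_apply, LinearMap.comp_apply, hincl, hres j i i.2]; rfl
  have hri' : ∀ j j', j ≠ j' → res j' ∘ₗ incl j = 0 := fun j j' hj => by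
    refine DirectSum.linearMap_ext _ fun i => LinearMap.ext fun x => ?_
    rw [LinearMap.comp_apply, LinearMap.comp_apply, hincl, hres' j' i (by rw [i.2]; exact hj)]; rfl
  have hφ : ∀ j, DirectSum.component k κ Y j ∘ₗ e.toLinearMap = φ j ∘ₗ res j := fun j => by
    refine DirectSum.linearMap_ext _ fun i => LinearMap.ext fun x => ?_
    change DirectSum.component k κ Y j (e _) =
      DirectSum.component k κ Y j (e (incl j (res j _)))
    by_cases h : deg i = j
    · rw [hres j i h, hincl]
    · rw [hres' j i h, map_zero, map_zero, map_zero]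
      obtain ⟨y, hy⟩ := he i x
      rw [hy, DirectSum.component.of, dif_neg h]
  have hφ' : ∀ j x, (e x) j = φ j (res j x) := fun j x => LinearMap.congr_fun (hφ j) x
  have hbij : Function.Bijective (φ j) := by
    constructor
    · refine (injective_iff_map_eq_zero _).2 fun x hx => ?_
      have h1 : e (incl j x) = 0 := by
        refine DFunLike.ext _ _ fun j' => ?_
        rw [hφ']
        by_cases h : j = j'
        · subst h
          rw [← LinearMap.comp_apply (res j), hri]
          exact hx
        · rw [← LinearMap.comp_apply (res j'), hri' j j' h, LinearMap.zero_apply, map_zero]; rfl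
      rw [← LinearMap.id_apply (R := k) x, ← hri j, LinearMap.comp_apply,
        (LinearEquiv.map_eq_zero_iff e).1 h1, map_zero]
    · intro y
      refine ⟨res j (e.symm (DirectSum.lof k κ Y j y)), ?_⟩
      rw [← hφ', e.apply_symm_apply, DirectSum.lof_apply]
  refine ⟨LinearEquiv.ofBijective _ hbij, fun ⟨i, hi⟩ x => ?_⟩
  subst hi
  obtain ⟨y, hy⟩ := he i x
  change DirectSum.lof k κ Y _ (DirectSum.component k κ Y _ (e (incl _ _))) = _
  rw [hincl, hy]
  exact congrArg _ (DirectSum.component.lof_self k _ y)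

end General

/-! ### The homology of the rows -/

section BaseRow

variable (k : Type u) [CommRing k] (A : Type v) [NonUnitalCommRing A] [Module k A]

instance (p : ℕ) : Unique (TwoTree p 0) where
  default := ⟨fun _ => 0, fun _ _ _ => le_rfl, fun _ => ⟨0, Subsingleton.elim (α := Fin 1) _ _⟩⟩
  uniq _ := Subtype.ext (funext fun _ => Subsingleton.elim (α := Fin 1) _ _)

/-- The row of the trees with one height-one vertex is the bar complex. -/
noncomputable def barEquivRow : BarSum k A ≃ₗ[k] RowSum k A 0 :=
  barSumEquiv k A ≪≫ₗ LinearEquiv.ofLinearMap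
    (DirectSum.toModule k ℕ (RowSum k A 0) fun p => rowLof k A (default : TwoTree p 0))
    (DirectSum.lmap (fun p => DirectSum.toModule k (TwoTree p 0) (⨂[k]^(p + 1) A) fun _ =>
      LinearMap.id) ∘ₗ (rowSumEquiv k A 0).toLinearMap)
    (by
      refine DirectSum.linearMap_ext _ fun p => DirectSum.linearMap_ext _ fun f =>
        LinearMap.ext fun x => ?_
      obtain rfl : f = default := Subsingleton.elim _ _
      change DirectSum.toModule k ℕ (RowSum k A 0) (fun p => rowLof k A (default : TwoTree p 0))
        (DirectSum.lmap (fun p => DirectSum.toModule k (TwoTree p 0) (⨂[k]^(p + 1) A) fun _ =>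
          LinearMap.id) (DirectSum.lof k ℕ (fun p => BiModule k A p 0) p
          (DirectSum.lof k _ (fun _ => ⨂[k]^(p + 1) A) default x))) = rowLof k A default x
      rw [DirectSum.lmap_lof, DirectSum.toModule_lof, DirectSum.toModule_lof]
      rfl)
    (by
      refine DirectSum.linearMap_ext _ fun p => LinearMap.ext fun x => ?_
      rw [LinearMap.comp_apply, LinearMap.comp_apply, DirectSum.toModule_lof]
      change DirectSum.lmap (fun p => DirectSum.toModule k (TwoTree p 0) (⨂[k]^(p + 1) A) fun _ =>
          LinearMap.id) (DirectSum.lof k ℕ (fun p => BiModule k A p 0) p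
          (DirectSum.lof k _ (fun _ => ⨂[k]^(p + 1) A) default x)) = _
      rw [DirectSum.lmap_lof, DirectSum.toModule_lof]
      rfl)

theorem barEquivRow_barLof {p : ℕ} (f : TwoTree p 0) (x : ⨂[k]^(p + 1) A) :
    barEquivRow k A (barLof k A p x) = rowLof k A f x := by
  obtain rfl : f = default := Subsingleton.elim _ _
  exact DirectSum.toModule_lof k (M := fun p => ⨂[k]^(p + 1) A) p x

theorem barEquivRow_barE (p : ℕ) {f : ℕ → ℕ} (hf : ∀ n < p + 1, f n = 0) (c : ℕ → A) :
    barEquivRow k A (barE k A p c) = rowE k A 0 p f c := by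
  rw [rowE_eq k (default : TwoTree p 0) (fun i => (hf i i.2).symm)]
  exact barEquivRow_barLof k A _ _

theorem rowSumD_barEquivRow [IsScalarTower k A A] [SMulCommClass k A A] (x : BarSum k A) :
    rowSumD k A 0 (barEquivRow k A x) = barEquivRow k A (barSumD k A x) := by
  suffices h : rowSumD k A 0 ∘ₗ (barEquivRow k A).toLinearMap =
      (barEquivRow k A).toLinearMap ∘ₗ barSumD k A from LinearMap.congr_fun h x
  refine barSum_ext k fun p c => ?_
  rw [LinearMap.comp_apply, LinearMap.comp_apply, LinearEquiv.coe_coe]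
  have hv : ∀ n, (default : TwoTree p 0).val n = 0 := fun n => by
    unfold TwoTree.val
    split_ifs <;> rfl
  rw [barEquivRow_barE k A p (fun n _ => hv n), rowSumD_rowE, barSumD_barE, map_sum]
  refine Finset.sum_congr rfl fun i _ => ?_
  rw [hv, hv, if_pos rfl, map_smul, add_zero, barEquivRow_barE k A (p - 1) fun n _ => ?_]
  unfold glueFun
  split_ifs <;> exact hv _

end BaseRow

section Juxtapose

variable (k : Type u) [CommRing k] {A : Type v} [NonUnitalCommRing A] [Module k A]

variable (A) in
/-- The product of `q + 1` elements of the bar complex in the row of trees with `q + 1` height-one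
vertices. -/
noncomputable def graftProd : ∀ q : ℕ, (Fin (q + 1) → BarSum k A) → RowSum k A q
  | 0, x => barEquivRow k A (x 0)
  | q + 1, x => graftMul k A q (x 0 ⊗ₜ graftProd q (Fin.tail x))

theorem rowSumD_graftProd [IsScalarTower k A A] [SMulCommClass k A A] (q : ℕ)
    (x : Fin (q + 1) → BarSum k A) (hx : ∀ i, barSumD k A (x i) = 0) :
    rowSumD k A q (graftProd k A q x) = 0 := by
  induction q with
  | zero => rw [graftProd, rowSumD_barEquivRow, hx, map_zero]
  | succ q ih =>
    rw [graftProd, rowSumD_graftMul, tensorD_tmul, hx, ih (Fin.tail x) fun i => hx i.succ,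
      TensorProduct.zero_tmul, TensorProduct.tmul_zero, add_zero, map_zero]

theorem exists_prod_ofFn_eq {n : ℕ} (l : Fin n → ℕ) (z : ∀ i, ⨂[k]^(l i) A) :
    ∃ t, (List.ofFn fun i => DirectSum.of (fun n => ⨂[k]^n A) (l i) (z i)).prod =
      DirectSum.of (fun n => ⨂[k]^n A) (∑ i, l i) t := by
  induction n with
  | zero => exact ⟨_, rfl⟩
  | succ n ih =>
    obtain ⟨t, ht⟩ := ih (Fin.tail l) fun i => z i.succ
    rw [Fin.sum_univ_succ, List.ofFn_succ, List.prod_cons]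
    exact ⟨_, (congrArg _ ht).trans (DirectSum.of_mul_of (A := fun n => ⨂[k]^n A) (z 0) t)⟩

/-- The product in the tensor algebra that defines `juxtapose` is homogeneous of degree `p + 1`. -/
theorem prod_ofFn_eq_juxtapose {p q : ℕ} (l : Degrees p q) (z : ∀ i, ⨂[k]^(l.1 i + 1) A) :
    (List.ofFn fun i => DirectSum.of (fun n => ⨂[k]^n A) (l.1 i + 1) (z i)).prod =
      DirectSum.of (fun n => ⨂[k]^n A) (p + 1) (juxtapose k l z) := by
  have h : ∑ i, (l.1 i + 1) = p + 1 := by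
    rw [Finset.sum_add_distrib, Finset.sum_const, Finset.card_fin, smul_eq_mul, mul_one,
      ← add_assoc, l.2]
  obtain ⟨t, ht⟩ := exists_prod_ofFn_eq k (fun i => l.1 i + 1) z
  rw [juxtapose]
  revert t
  rw [h]
  intro t ht
  rw [ht, DirectSum.of_eq_same]

theorem juxtapose_succ {b q : ℕ} (l : Fin (q + 1 + 1) → ℕ)
    (hl : ∑ i, l i + (q + 1) = l 0 + 1 + b) (hl' : ∑ i, Fin.tail l i + q = b)
    (z : ∀ i, ⨂[k]^(l i + 1) A) :
    juxtapose k (⟨l, hl⟩ : Degrees (l 0 + 1 + b) (q + 1)) z =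
      TensorPower.mulEquiv (n := l 0 + 1) (m := b + 1)
        (z 0 ⊗ₜ juxtapose k (⟨Fin.tail l, hl'⟩ : Degrees b q) fun i => z i.succ) := by
  apply DirectSum.of_injective (β := fun n => ⨂[k]^n A) (l 0 + 1 + b + 1)
  rw [← prod_ofFn_eq_juxtapose, List.ofFn_succ, List.prod_cons]
  refine (congrArg _ (prod_ofFn_eq_juxtapose k (⟨Fin.tail l, hl'⟩ : Degrees b q)
    fun i => z i.succ)).trans ?_
  exact DirectSum.of_mul_of (A := fun n => ⨂[k]^n A) (z 0) _

theorem TwoTree.graft_castAdd (a : ℕ) {b q : ℕ} (f : TwoTree b q) (i : Fin (a + 1)) :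
    (f.graft a).1 (Fin.castAdd (b + 1) i) = 0 :=
  Fin.ext (if_pos (Nat.le_of_lt_succ i.2))

theorem TwoTree.graft_natAdd (a : ℕ) {b q : ℕ} (f : TwoTree b q) (i : Fin (b + 1)) :
    (f.graft a).1 (Fin.natAdd (a + 1) i) = (f.1 i).succ := by
  refine Fin.ext ?_
  change graftFun a f.val (a + 1 + i) = f.1 i + 1
  rw [graftFun, if_neg (by omega), Nat.add_sub_cancel_left, f.val_coe]

theorem TwoTree.card_graft (a : ℕ) {b q : ℕ} (f : TwoTree b q) (m : Fin (q + 2)) :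
    (Finset.univ.filter fun x => (f.graft a).1 x = m).card =
      (if m = 0 then a + 1 else 0) + (Finset.univ.filter fun x => (f.1 x).succ = m).card := by
  rw [Finset.card_filter, Finset.card_filter]
  refine (Fin.sum_univ_add (a := a + 1) (b := b + 1) _).trans ?_
  simp only [TwoTree.graft_castAdd, TwoTree.graft_natAdd, eq_comm (a := (0 : Fin (q + 2)))]
  simp

theorem TwoTree.card_graft_zero (a : ℕ) {b q : ℕ} (f : TwoTree b q) :
    (Finset.univ.filter fun x => (f.graft a).1 x = 0).card = a + 1 := by
  rw [f.card_graft]; simp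

theorem TwoTree.card_graft_succ (a : ℕ) {b q : ℕ} (f : TwoTree b q) (i : Fin (q + 1)) :
    (Finset.univ.filter fun x => (f.graft a).1 x = i.succ).card =
      (Finset.univ.filter fun x => f.1 x = i).card := by
  rw [f.card_graft]; simp

/-- For elementary factors, `graftProd` is the juxtaposition of tensors. -/
theorem graftProd_barLof {p q : ℕ} (f : TwoTree p q) (l : Degrees p q)
    (hf : ∀ i, (Finset.univ.filter fun x => f.1 x = i).card = l.1 i + 1)
    (z : ∀ i, ⨂[k]^(l.1 i + 1) A) :
    graftProd k A q (fun i => barLof k A (l.1 i) (z i)) = rowLof k A f (juxtapose k l z) := by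
  induction q generalizing p with
  | zero =>
    obtain ⟨l, hl⟩ := l
    have hl' : l 0 = p := by simpa using hl
    subst hl'
    have h := prod_ofFn_eq_juxtapose k ⟨l, hl⟩ z
    simp only [List.ofFn_succ, List.ofFn_zero, List.prod_cons, List.prod_nil, mul_one] at h
    rw [← DirectSum.of_injective _ h]
    exact barEquivRow_barLof k A f _
  | succ q ih =>
    obtain ⟨a, b, g, rfl, rfl⟩ := f.exists_graft
    obtain ⟨l, hl⟩ := l
    obtain rfl : a = l 0 := by
      have := hf 0
      rw [TwoTree.card_graft_zero] at this
      exact Nat.succ.inj this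
    have hl' : ∑ i, Fin.tail l i + q = b := by
      rw [Fin.sum_univ_succ] at hl
      simp only [Fin.tail]
      omega
    rw [juxtapose_succ k l hl hl']
    refine Eq.trans ?_ (graftMul_tmul k A q _ _ g _ _)
    rw [graftProd]
    refine congrArg (fun t => graftMul k A q (barLof k A (l 0) (z 0) ⊗ₜ t)) ?_
    refine ih g ⟨Fin.tail l, hl'⟩ (fun i => ?_) fun i => z i.succ
    rw [← TwoTree.card_graft_succ]
    exact hf i.succ

end Juxtapose

theorem TwoTree.exists_card_fibre_eq {p q : ℕ} (l : Degrees p q) :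
    ∃ f : TwoTree p q, ∀ i, (Finset.univ.filter fun x => f.1 x = i).card = l.1 i + 1 := by
  induction q generalizing p with
  | zero =>
    obtain ⟨l, rfl⟩ := l
    refine ⟨default, fun i => ?_⟩
    obtain rfl : i = 0 := Subsingleton.elim (α := Fin 1) _ _
    rw [Finset.filter_true_of_mem fun x _ => show (default : TwoTree _ 0).1 x = 0 from rfl,
      Finset.card_univ, Fintype.card_fin]
    simp
  | succ q ih =>
    obtain ⟨l, hl⟩ := l
    obtain ⟨g, hg⟩ := ih ⟨Fin.tail l, rfl⟩
    obtain rfl : l 0 + 1 + (∑ i, Fin.tail l i + q) = p := by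
      rw [← hl, Fin.sum_univ_succ l]
      simp only [Fin.tail]
      omega
    refine ⟨g.graft (l 0), fun i => ?_⟩
    refine Fin.cases (g.card_graft_zero (l 0)) (fun i => ?_) i
    exact (g.card_graft_succ (l 0) i).trans (hg i)

section RowHomology

variable (k : Type u) [CommRing k] (A : Type v) [NonUnitalCommRing A] [Module k A]
  [IsScalarTower k A A] [SMulCommClass k A A]

/-- The inclusion of the cycles of the bar complex. -/
noncomputable def barCycles : (⨁ n, (barComplex k A).cycles n) →ₗ[k] BarSum k A :=
  DirectSum.lmap fun n => ((barComplex k A).iCycles n).hom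

/-- The projection from the cycles of the bar complex to bar homology. -/
noncomputable def barClass :
    (⨁ n, (barComplex k A).cycles n) →ₗ[k] ⨁ n, barHomology k A n :=
  DirectSum.lmap fun n => ((barComplex k A).homologyπ n).hom

theorem isHomology_bar : IsHomology (barSumD k A) (barCycles k A) (barClass k A) :=
  isHomology_sumD (barComplex k A)

/-- The inclusion of the cycles of a row. -/
noncomputable def rowCycles (q : ℕ) : (⨁ p, (rowComplex k A q).cycles p) →ₗ[k] RowSum k A q :=
  DirectSum.lmap fun p => ((rowComplex k A q).iCycles p).hom

/-- The projection from the cycles of a row to its homology. -/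
noncomputable def rowClass (q : ℕ) :
    (⨁ p, (rowComplex k A q).cycles p) →ₗ[k] ⨁ p, (rowComplex k A q).homology p :=
  DirectSum.lmap fun p => ((rowComplex k A q).homologyπ p).hom

theorem isHomology_row (q : ℕ) :
    IsHomology (rowSumD k A q) (rowCycles k A q) (rowClass k A q) :=
  isHomology_sumD (rowComplex k A q)

/-- The Künneth isomorphism of the homology of a row with the tensor product of bar homology and the
homology of the row with one vertex less. -/
theorem exists_row_kunneth (hA : Module.Flat k A) (hH : ∀ n, Module.Flat k (barHomology k A n))
    (q : ℕ) :
    ∃ e : (⨁ n, barHomology k A n) ⊗[k] (⨁ p, (rowComplex k A q).homology p) ≃ₗ[k]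
        ⨁ p, (rowComplex k A (q + 1)).homology p,
      ∀ z z' w, rowCycles k A (q + 1) w =
        graftMul k A q (barCycles k A z ⊗ₜ rowCycles k A q z') →
      e (barClass k A z ⊗ₜ rowClass k A q z') = rowClass k A (q + 1) w := by
  have hX : ∀ n, Module.Flat k ((barComplex k A).X n) := fun n => flat_tensorPower A (n + 1)
  have h1 : Module.Flat k (⨁ n, (barComplex k A).cycles n) :=
    flat_sum_cycles (barComplex k A) hX hH
  have h2 : Module.Flat k (LinearMap.range (barSumD k A)) :=
    flat_range_sumD (barComplex k A) hX hH
  have h3 : Module.Flat k (⨁ n, barHomology k A n) := inferInstance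
  exact (isHomology_bar k A).exists_kunneth (ε := barSign k A) (isHomology_row k A q)
    (isHomology_row k A (q + 1))
    (signMap_signMap (barComplex k A)) (sumD_signMap (barComplex k A)) (graftMul k A q)
    (rowSumD_graftMul k A q)

/-- The iterated Künneth isomorphism. -/
theorem exists_total_kunneth (hA : Module.Flat k A) (hH : ∀ n, Module.Flat k (barHomology k A n))
    (q : ℕ) :
    ∃ e : (⨂[k]^(q + 1) (⨁ n, barHomology k A n)) ≃ₗ[k] ⨁ p, (rowComplex k A q).homology p,
      ∀ (z : Fin (q + 1) → ⨁ n, (barComplex k A).cycles n) w,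
        rowCycles k A q w = graftProd k A q (fun i => barCycles k A (z i)) →
        e (PiTensorProduct.tprod k fun i => barClass k A (z i)) = rowClass k A q w := by
  induction q with
  | zero =>
    obtain ⟨e, he⟩ := (isHomology_bar k A).exists_equiv (isHomology_row k A 0)
      (barEquivRow k A) (rowSumD_barEquivRow k A)
    refine ⟨PiTensorProduct.subsingletonEquiv (0 : Fin 1) ≪≫ₗ e, fun z w hw => ?_⟩
    rw [LinearEquiv.trans_apply, PiTensorProduct.subsingletonEquiv_apply_tprod]
    exact he (z 0) w hw
  | succ q ih =>
    obtain ⟨e, he⟩ := ih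
    obtain ⟨e', he'⟩ := exists_row_kunneth k A hA hH q
    refine ⟨consEquiv k _ (q + 1) ≪≫ₗ TensorProduct.congr (LinearEquiv.refl k _) e ≪≫ₗ e',
      fun z w hw => ?_⟩
    obtain ⟨w', hw'⟩ := ((isHomology_row k A q).exact _).1
      (rowSumD_graftProd k q (fun i => barCycles k A (z i.succ)) fun i =>
        (isHomology_bar k A).d_i _)
    rw [LinearEquiv.trans_apply, LinearEquiv.trans_apply, consEquiv_tprod,
      TensorProduct.congr_tmul, LinearEquiv.refl_apply]
    have h := he (fun i => z i.succ) w' hw'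
    refine (congrArg (fun t => e' (barClass k A (z 0) ⊗ₜ t)) h).trans (he' _ _ _ ?_)
    rw [hw, hw']
    rfl

/-- The iterated Künneth isomorphism on products of homogeneous classes. -/
theorem exists_total_kunneth_lof (hA : Module.Flat k A)
    (hH : ∀ n, Module.Flat k (barHomology k A n)) (q : ℕ) :
    ∃ e : (⨁ l : Fin (q + 1) → ℕ, ⨂[k] i, barHomology k A (l i)) ≃ₗ[k]
        ⨁ p, (rowComplex k A q).homology p,
      ∀ (p : ℕ) (f : TwoTree p q) (l : Degrees p q),
        (∀ i, (Finset.univ.filter fun x => f.1 x = i).card = l.1 i + 1) →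
        ∀ z : ∀ i, (barComplex k A).cycles (l.1 i), ∃ w : (rowComplex k A q).cycles p,
          (rowComplex k A q).iCycles p w =
            DirectSum.lof k (TwoTree p q) (fun _ => ⨂[k]^(p + 1) A) f
              (juxtapose k l fun i => (barComplex k A).iCycles (l.1 i) (z i)) ∧
          e (DirectSum.lof k _ (fun l : Fin (q + 1) → ℕ => ⨂[k] i, barHomology k A (l i)) l.1
              (PiTensorProduct.tprod k fun i => (barComplex k A).homologyπ (l.1 i) (z i))) =
            DirectSum.lof k ℕ (fun p => (rowComplex k A q).homology p) p
              ((rowComplex k A q).homologyπ p w) := by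
  obtain ⟨e, he⟩ := exists_total_kunneth k A hA hH q
  refine ⟨(PiTensorProduct.ofDirectSumEquiv (R := k) (κ := fun _ : Fin (q + 1) => ℕ)
    (M := fun _ n => barHomology k A n)).symm ≪≫ₗ e, fun p f l hf z => ?_⟩
  let Z : Fin (q + 1) → ⨁ n, (barComplex k A).cycles n := fun i =>
    DirectSum.lof k ℕ (fun n => (barComplex k A).cycles n) (l.1 i) (z i)
  have hZ : ∀ i, barCycles k A (Z i) =
      barLof k A (l.1 i) ((barComplex k A).iCycles (l.1 i) (z i)) := fun i =>
    DirectSum.lmap_lof _ _ _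
  have hZ' : ∀ i, barClass k A (Z i) = DirectSum.lof k ℕ (fun n => barHomology k A n) (l.1 i)
      ((barComplex k A).homologyπ (l.1 i) (z i)) := fun i =>
    DirectSum.lmap_lof _ _ _
  have hprod : graftProd k A q (fun i => barCycles k A (Z i)) = rowLof k A f
      (juxtapose k l fun i => (barComplex k A).iCycles (l.1 i) (z i)) := by
    rw [funext hZ]
    exact graftProd_barLof k f l hf _
  obtain ⟨W, hW⟩ := ((isHomology_row k A q).exact _).1
    (rowSumD_graftProd k q (fun i => barCycles k A (Z i)) fun i => (isHomology_bar k A).d_i _)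
  rw [hprod] at hW
  have hw : (rowComplex k A q).iCycles p (W p) =
      DirectSum.lof k (TwoTree p q) (fun _ => ⨂[k]^(p + 1) A) f
        (juxtapose k l fun i => (barComplex k A).iCycles (l.1 i) (z i)) := by
    have h := congrArg (fun x => rowSumEquiv k A q x p) hW
    refine Eq.trans ?_ (h.trans ?_)
    · exact (DirectSum.lmap_apply (fun p => ((rowComplex k A q).iCycles p).hom) W p).symm
    · exact DirectSum.lof_apply k (M := fun p => BiModule k A p q) p _
  refine ⟨W p, hw, ?_⟩
  rw [LinearEquiv.trans_apply, PiTensorProduct.ofDirectSumEquiv_symm_lof_tprod, ← funext hZ']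
  refine (he Z (DirectSum.lof k ℕ (fun p => (rowComplex k A q).cycles p) p (W p)) ?_).trans
    (DirectSum.lmap_lof _ _ _)
  rw [hprod]
  refine (DirectSum.lmap_lof _ _ _).trans ?_
  exact congrArg (DirectSum.lof k ℕ (fun p => BiModule k A p q) p) hw

/-- The homology of a row in degree `p` is the part of the iterated Künneth isomorphism with
`ℓ_0 + ⋯ + ℓ_q = p - q`. -/
theorem exists_kappa (hA : Module.Flat k A) (hH : ∀ n, Module.Flat k (barHomology k A n))
    (p q : ℕ) :
    ∃ κ : (⨁ l : Degrees p q, ⨂[k] i, barHomology k A (l.1 i)) ≃ₗ[k]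
        (rowComplex k A q).homology p,
      ∀ (f : TwoTree p q) (l : Degrees p q),
        (∀ i, (Finset.univ.filter fun x => f.1 x = i).card = l.1 i + 1) →
        ∀ z : ∀ i, (barComplex k A).cycles (l.1 i), ∃ w : (rowComplex k A q).cycles p,
          (rowComplex k A q).iCycles p w =
            DirectSum.lof k (TwoTree p q) (fun _ => ⨂[k]^(p + 1) A) f
              (juxtapose k l fun i => (barComplex k A).iCycles (l.1 i) (z i)) ∧
          κ (DirectSum.lof k (Degrees p q) (fun l => ⨂[k] i, barHomology k A (l.1 i)) l
              (PiTensorProduct.tprod k fun i => (barComplex k A).homologyπ (l.1 i) (z i))) =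
            (rowComplex k A q).homologyπ p w := by
  obtain ⟨e, he⟩ := exists_total_kunneth_lof k A hA hH q
  have hdeg : ∀ (l : Fin (q + 1) → ℕ) (x : ⨂[k] i, barHomology k A (l i)),
      ∃ y, e (DirectSum.lof k _ (fun l : Fin (q + 1) → ℕ => ⨂[k] i, barHomology k A (l i)) l x) =
        DirectSum.lof k ℕ (fun p => (rowComplex k A q).homology p) (∑ i, l i + q) y := by
    intro l x
    induction x using PiTensorProduct.induction_on with
    | smul_tprod r y =>
      choose z hz using fun i => homologyπ_surjective (barComplex k A) (l i) (y i)
      obtain ⟨f, hf⟩ := TwoTree.exists_card_fibre_eq (⟨l, rfl⟩ : Degrees _ q)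
      obtain ⟨w, -, h⟩ := he _ f ⟨l, rfl⟩ hf z
      refine ⟨r • (rowComplex k A q).homologyπ _ w, ?_⟩
      rw [map_smul, map_smul, map_smul, ← h, ← funext hz]
    | add x y hx hy =>
      obtain ⟨x', hx⟩ := hx
      obtain ⟨y', hy⟩ := hy
      exact ⟨x' + y', by rw [map_add, map_add, map_add, hx, hy]⟩
  obtain ⟨κ, hκ⟩ := exists_fibre_equiv (fun l : Fin (q + 1) → ℕ => ∑ i, l i + q) e hdeg p
  refine ⟨κ, fun f l hf z => ?_⟩
  obtain ⟨w, hw, h⟩ := he p f l hf z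
  exact ⟨w, hw, DirectSum.of_injective (β := fun p => (rowComplex k A q).homology p) p
    ((hκ l _).trans h)⟩

end RowHomology

/-! ### The filtration of the total complex -/

section Total

variable (k : Type u) [CommRing k] (A : Type v) [NonUnitalCommRing A] [Module k A]

/-- The component of an element of the total complex in the spot `(p, q)`. -/
noncomputable def totComponent (n p q : ℕ) (h : p + q = n) :
    TotModule k A n →ₗ[k] BiModule k A p q :=
  DirectSum.component k {x : ℕ × ℕ // x.1 + x.2 = n} (fun x => BiModule k A x.1.1 x.1.2)
    ⟨(p, q), h⟩

theorem totComponent_toTot (n p q : ℕ) (h : p + q = n) (x : BiModule k A p q) :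
    totComponent k A n p q h (toTot k A n p q h x) = x :=
  DirectSum.component.lof_self k (ι := {x : ℕ × ℕ // x.1 + x.2 = n})
    (M := fun x => BiModule k A x.1.1 x.1.2) ⟨(p, q), h⟩ x

theorem totComponent_toTot_ne (n p q p' q' : ℕ) (h : p + q = n) (h' : p' + q' = n) (hq : q ≠ q')
    (x : BiModule k A p q) : totComponent k A n p' q' h' (toTot k A n p q h x) = 0 := by
  rw [totComponent, toTot, DirectSum.component.of, dif_neg]
  exact fun e => hq (congrArg (fun x => x.1.2) e)

theorem totModule_ext {n : ℕ} {x y : TotModule k A n}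
    (h : ∀ p q h, totComponent k A n p q h x = totComponent k A n p q h y) : x = y :=
  DFunLike.ext _ _ fun ⟨⟨p, q⟩, hx⟩ => h p q hx

theorem mem_totFiltration {n : ℕ} {s : ℤ} {x : TotModule k A n} :
    x ∈ totFiltration k A n s ↔
      ∀ (p q : ℕ) (h : p + q = n), s < (q : ℤ) → totComponent k A n p q h x = 0 := by
  simp only [totFiltration, Submodule.mem_iInf, LinearMap.mem_ker]
  exact ⟨fun H p q h hs => H ⟨(p, q), h⟩ hs, fun H x hs => H x.1.1 x.1.2 x.2 hs⟩

theorem toTot_mem_totFiltration {n p q : ℕ} (h : p + q = n) (x : BiModule k A p q) :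
    toTot k A n p q h x ∈ totFiltration k A n q :=
  (mem_totFiltration k A).2 fun p' q' h' hs => totComponent_toTot_ne k A n p q p' q' h h'
    (by omega) x

variable [IsScalarTower k A A] [SMulCommClass k A A]

theorem totComponent_totD (n p q : ℕ) (h : p + q = n) (x : TotModule k A (n + 1)) :
    totComponent k A n p q h (totD k A n x) =
      leafD k A p q (totComponent k A (n + 1) (p + 1) q (by omega) x) +
        shuffleD k A p q (totComponent k A (n + 1) p (q + 1) (by omega) x) := by
  suffices H : totComponent k A n p q h ∘ₗ totD k A n =
      leafD k A p q ∘ₗ totComponent k A (n + 1) (p + 1) q (by omega) +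
        shuffleD k A p q ∘ₗ totComponent k A (n + 1) p (q + 1) (by omega) from
    LinearMap.congr_fun H x
  refine DirectSum.linearMap_ext _ fun ⟨⟨p', q'⟩, h'⟩ => LinearMap.ext fun y => ?_
  replace h' : p' + q' = n + 1 := h'
  have hy := LinearMap.congr_fun (totD_toTot k A n p' q' h') y
  change totComponent k A n p q h ((totD k A n ∘ₗ toTot k A (n + 1) p' q' h') y) =
    leafD k A p q (totComponent k A (n + 1) (p + 1) q _ (toTot k A (n + 1) p' q' h' y)) +
      shuffleD k A p q (totComponent k A (n + 1) p (q + 1) _ (toTot k A (n + 1) p' q' h' y))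
  rw [hy, LinearMap.add_apply, map_add]
  congr 1
  · rcases p' with _ | p'
    · rw [totComponent_toTot_ne _ _ _ _ _ _ _ _ _ (by omega)]
      simp [leafTot]
    · rw [leafTot, LinearMap.comp_apply]
      by_cases hq : q' = q
      · subst hq
        obtain rfl : p' = p := by omega
        rw [totComponent_toTot, totComponent_toTot]
      · rw [totComponent_toTot_ne _ _ _ _ _ _ _ _ _ hq, totComponent_toTot_ne _ _ _ _ _ _ _ _ _ hq,
          map_zero]
  · rcases q' with _ | q'
    · rw [totComponent_toTot_ne _ _ _ _ _ _ _ _ _ (by omega)]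
      simp [shuffleTot]
    · rw [shuffleTot, LinearMap.comp_apply]
      by_cases hq : q' = q
      · subst hq
        obtain rfl : p' = p := by omega
        rw [totComponent_toTot, totComponent_toTot]
      · rw [totComponent_toTot_ne _ _ _ _ _ _ _ _ _ hq,
          totComponent_toTot_ne _ _ _ _ _ _ _ _ _ (by omega), map_zero]

theorem totalComplex_d (n : ℕ) : (totalComplex k A).d (n + 1) n = ModuleCat.ofHom (totD k A n) :=
  ChainComplex.of_d (fun n => ModuleCat.of k (TotModule k A n))
    (fun n => ModuleCat.ofHom (totD k A n)) n

theorem totD_mem_totFiltration {n : ℕ} {s : ℤ} {x : TotModule k A (n + 1)}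
    (hx : x ∈ totFiltration k A (n + 1) s) : totD k A n x ∈ totFiltration k A n s := by
  rw [mem_totFiltration] at *
  intro p q h hs
  rw [totComponent_totD, hx (p + 1) q _ hs, hx p (q + 1) _ (by omega), map_zero, map_zero,
    add_zero]

/-- The total complex, filtered by the number of height-one vertices. -/
noncomputable def totFilteredComplex : FilteredComplex.{u, max u v} k where
  K := totalComplex k A
  F := totFiltration k A
  mono n s s' h x hx := by
    exact (mem_totFiltration k A).2 fun p q hpq hs =>
      (mem_totFiltration k A).1 hx p q hpq (h.trans_lt hs)
  d_mem i j s x hx := by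
    by_cases h : i = j + 1
    · subst h
      rw [totalComplex_d]
      exact totD_mem_totFiltration k A hx
    · rw [(totalComplex k A).shape i j fun h' => h h'.symm]
      exact zero_mem _
  eq_bot n s hs := by
    refine (Submodule.eq_bot_iff _).2 fun x hx => ?_
    refine totModule_ext k A fun p q h => ?_
    rw [(mem_totFiltration k A).1 hx p q h (by omega)]
    exact (map_zero _).symm
  eq_top n s hs := by
    refine eq_top_iff.2 fun x _ => (mem_totFiltration k A).2 fun p q h hs' => ?_
    omega

theorem totFilteredComplex_d (n : ℕ) (x : TotModule k A (n + 1)) :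
    ((totFilteredComplex k A).K.d (n + 1) n).hom x = totD k A n x :=
  congrArg (fun f => f.hom x) (totalComplex_d k A n)

/-- The numerator of the first page as a submodule of the total complex. -/
noncomputable def totZ (s : ℤ) (n : ℕ) : Submodule k (TotModule k A n) :=
  (totFilteredComplex k A).Z 1 s n

/-- The denominator of the first page as a submodule of the total complex. -/
noncomputable def totB (s : ℤ) (n : ℕ) : Submodule k (TotModule k A n) :=
  (totFilteredComplex k A).B 1 s n

theorem totZ_le (s : ℤ) (n : ℕ) : totZ k A s n ≤ totFiltration k A n s := inf_le_left

theorem mem_totZ_zero {s : ℤ} {x : TotModule k A 0} :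
    x ∈ totZ k A s 0 ↔ x ∈ totFiltration k A 0 s := by
  refine ((totFilteredComplex k A).mem_Z (n := 0)).trans (and_iff_left fun j => ?_)
  rw [(totFilteredComplex k A).d_eq_zero (by omega)]
  exact zero_mem _

theorem mem_totZ_succ {s : ℤ} {n : ℕ} {x : TotModule k A (n + 1)} :
    x ∈ totZ k A s (n + 1) ↔
      x ∈ totFiltration k A (n + 1) s ∧ totD k A n x ∈ totFiltration k A n (s - 1) := by
  refine ((totFilteredComplex k A).mem_Z (n := n + 1)).trans
    (and_congr_right fun _ => ⟨fun h => ?_, fun h j => ?_⟩)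
  · rw [← totFilteredComplex_d]
    exact h n
  · by_cases hj : j = n
    · subst hj
      rw [← totFilteredComplex_d] at h
      exact h
    · rw [(totFilteredComplex k A).d_eq_zero (by omega)]
      exact zero_mem _

theorem mem_totB {s : ℤ} {n : ℕ} {x : TotModule k A n} :
    x ∈ totB k A s n ↔ ∃ a ∈ totFiltration k A n (s - 1), ∃ y ∈ totFiltration k A (n + 1) s,
      a + totD k A n y = x := by
  have hZ : ∀ s n, (totFilteredComplex k A).Z (1 - 1) s n = (totFilteredComplex k A).F n s := by
    intro s n
    refine le_antisymm inf_le_left fun x hx => (totFilteredComplex k A).mem_Z.2 ⟨hx, fun j => ?_⟩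
    rw [sub_self, sub_zero]
    exact (totFilteredComplex k A).d_mem _ _ _ _ hx
  have hB : (totFilteredComplex k A).B 1 s n = (totFilteredComplex k A).F n (s - 1) ⊔
      ((totFilteredComplex k A).F (n + 1) s).map ((totFilteredComplex k A).K.d (n + 1) n).hom := by
    rw [FilteredComplex.B, hZ, hZ, add_sub_cancel_right]
  have hx : x ∈ totB k A s n ↔ x ∈ totFiltration k A n (s - 1) ⊔
      (totFiltration k A (n + 1) s).map (totD k A n) := by
    have h : ((totFilteredComplex k A).K.d (n + 1) n).hom = totD k A n :=
      LinearMap.ext (totFilteredComplex_d k A n)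
    rw [h] at hB
    exact iff_of_eq (congrArg (fun W : Submodule k (TotModule k A n) => x ∈ W) hB)
  rw [hx, Submodule.mem_sup]
  simp only [Submodule.mem_map, exists_exists_and_eq_and]

/-- The component in the spot `(p, q)` of an element of the numerator of the first page is a cycle of
the row `q`. -/
theorem rowComplex_d_totComponent {n p q : ℕ} (h : p + q = n) {x : TotModule k A n}
    (hx : x ∈ totZ k A q n) (j : ℕ) :
    ((rowComplex k A q).d p j).hom (totComponent k A n p q h x) = 0 := by
  by_cases hj : p = j + 1
  · subst hj
    obtain ⟨n, rfl⟩ : ∃ m, n = m + 1 := ⟨j + q, by omega⟩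
    rw [mem_totZ_succ] at hx
    have h1 := (mem_totFiltration k A).1 hx.2 j q (by omega) (by omega)
    rw [totComponent_totD, (mem_totFiltration k A).1 hx.1 j (q + 1) _ (by omega), map_zero,
      add_zero] at h1
    rw [rowComplex_d]
    exact h1
  · rw [(rowComplex k A q).shape p j fun h' => hj h'.symm]
    rfl

/-- Conversely, a cycle of the row `q` is in the numerator of the first page, since `shuffleD` lowers
the filtration. -/
theorem toTot_mem_totZ {n p q : ℕ} (h : p + q = n) {y : BiModule k A p q}
    (hy : ∀ j, ((rowComplex k A q).d p j).hom y = 0) :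
    toTot k A n p q h y ∈ totZ k A q n := by
  rcases n with _ | n
  · exact (mem_totZ_zero k A).2 (toTot_mem_totFiltration k A h y)
  · rw [mem_totZ_succ]
    refine ⟨toTot_mem_totFiltration k A h y, (mem_totFiltration k A).2 fun p' q' h' hs => ?_⟩
    rw [totComponent_totD, totComponent_toTot_ne k A (n + 1) p q p' (q' + 1) _ _ (by omega),
      map_zero, add_zero]
    by_cases hq : q = q'
    · subst hq
      obtain rfl : p = p' + 1 := by omega
      have := hy p'
      rw [rowComplex_d] at this
      rw [totComponent_toTot]
      exact this
    · rw [totComponent_toTot_ne k A (n + 1) p q (p' + 1) q' _ _ hq, map_zero]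

/-- An element of the numerator of the first page is in the denominator if and only if its component
is a boundary of the row. -/
theorem mem_totB_iff_exists_rowComplex_d {n p q : ℕ} (h : p + q = n) {x : TotModule k A n}
    (hx : x ∈ totZ k A q n) : x ∈ totB k A q n ↔
      ∃ j w, ((rowComplex k A q).d j p).hom w = totComponent k A n p q h x := by
  rw [mem_totB]
  constructor
  · rintro ⟨a, ha, y, hy, rfl⟩
    refine ⟨p + 1, totComponent k A (n + 1) (p + 1) q (by omega) y, ?_⟩
    rw [rowComplex_d, map_add, (mem_totFiltration k A).1 ha p q h (by omega), zero_add,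
      totComponent_totD, (mem_totFiltration k A).1 hy p (q + 1) _ (by omega), map_zero, add_zero]
    rfl
  · rintro ⟨j, w, hw⟩
    obtain ⟨w, hw⟩ : ∃ w, leafD k A p q w = totComponent k A n p q h x := by
      by_cases hj : j = p + 1
      · subst hj
        rw [rowComplex_d] at hw
        exact ⟨w, hw⟩
      · rw [(rowComplex k A q).shape j p fun h' => hj h'.symm] at hw
        exact ⟨0, (map_zero _).trans hw⟩
    have h' : p + 1 + q = n + 1 := by omega
    have hy := toTot_mem_totFiltration k A h' w
    refine ⟨x - totD k A n (toTot k A (n + 1) (p + 1) q h' w), (mem_totFiltration k A).2 ?_,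
      _, hy, sub_add_cancel _ _⟩
    intro p' q' h' hs
    by_cases hq : q = q'
    · subst hq
      obtain rfl : p = p' := by omega
      rw [map_sub, totComponent_totD, totComponent_toTot,
        totComponent_toTot_ne k A (n + 1) (p + 1) q p (q + 1) _ _ (by omega), map_zero, add_zero,
        hw, sub_self]
    · rw [map_sub, (mem_totFiltration k A).1 (totD_mem_totFiltration k A hy) p' q' h' (by omega),
        (mem_totFiltration k A).1 (totZ_le k A _ _ hx) p' q' h' (by omega), sub_zero]

/-- The first page consists of the homology of the rows: the class of a cycle of a row corresponds
to the class of any element of the total complex with this component. -/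
theorem exists_row_equiv_page (p q : ℕ) :
    ∃ e : (rowComplex k A q).homology p ≃ₗ[k] ((totFilteredComplex k A).page 1).X (p, q),
      ∀ (x : totZ k A q (p + q)) (z : (rowComplex k A q).cycles p),
        (rowComplex k A q).iCycles p z = totComponent k A (p + q) p q rfl x.1 →
        e ((rowComplex k A q).homologyπ p z) = (totFilteredComplex k A).toPage 1 (p, q) x := by
  exact (totFilteredComplex k A).exists_equiv_page (rowComplex k A q) p 1 (p, q)
    (totComponent k A (p + q) p q rfl)
    (fun _ hx => rowComplex_d_totComponent k A rfl hx)
    (fun _ hy => ⟨_, toTot_mem_totZ k A rfl hy, totComponent_toTot k A _ _ _ _ _⟩)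
    (fun _ hx => mem_totB_iff_exists_rowComplex_d k A rfl hx)

/-- Under the isomorphism of the first page with the homology of the rows, the differential is
induced by the shuffle differential. -/
theorem exists_page_d_eq (p q : ℕ)
    (e : (rowComplex k A q).homology p ≃ₗ[k] ((totFilteredComplex k A).page 1).X (p, q))
    (he : ∀ (x : totZ k A q (p + q)) (z : (rowComplex k A q).cycles p),
      (rowComplex k A q).iCycles p z = totComponent k A (p + q) p q rfl x.1 →
      e ((rowComplex k A q).homologyπ p z) = (totFilteredComplex k A).toPage 1 (p, q) x)
    (e' : (rowComplex k A (q + 1)).homology p ≃ₗ[k]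
      ((totFilteredComplex k A).page 1).X (p, q + 1))
    (he' : ∀ (x : totZ k A (q + 1 : ℕ) (p + (q + 1))) (z : (rowComplex k A (q + 1)).cycles p),
      (rowComplex k A (q + 1)).iCycles p z = totComponent k A (p + (q + 1)) p (q + 1) rfl x.1 →
      e' ((rowComplex k A (q + 1)).homologyπ p z) =
        (totFilteredComplex k A).toPage 1 (p, q + 1) x)
    (z : (rowComplex k A (q + 1)).cycles p) : ∃ w : (rowComplex k A q).cycles p,
      (rowComplex k A q).iCycles p w =
        shuffleD k A p q ((rowComplex k A (q + 1)).iCycles p z) ∧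
      ((totFilteredComplex k A).page 1).d (p, q + 1) (p, q)
        (e' ((rowComplex k A (q + 1)).homologyπ p z)) =
        e ((rowComplex k A q).homologyπ p w) := by
  let x : totZ k A (q + 1 : ℕ) (p + (q + 1)) :=
    ⟨_, toTot_mem_totZ k A rfl fun j => d_iCycles_apply (rowComplex k A (q + 1)) p j z⟩
  have hs : ((p, q).2 : ℤ) = ((p, q + 1).2 : ℕ) - (1 : ℤ) := by simp
  let y : totZ k A q (p + q) := (totFilteredComplex k A).dZ (p + (q + 1)) (p + q) hs x
  have hy : totComponent k A (p + q) p q rfl y.1 =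
      shuffleD k A p q ((rowComplex k A (q + 1)).iCycles p z) := by
    have h : y.1 = totD k A (p + q) x.1 := totFilteredComplex_d k A (p + q) x.1
    rw [h, totComponent_totD]
    refine (congrArg₂ (leafD k A p q · + shuffleD k A p q ·)
      (totComponent_toTot_ne k A _ p (q + 1) (p + 1) q _ _ (Nat.succ_ne_self q) _)
      (totComponent_toTot k A _ p (q + 1) _ _)).trans ?_
    rw [map_zero, zero_add]
  obtain ⟨w, hw⟩ := exists_iCycles_eq (rowComplex k A q) fun j =>
    rowComplex_d_totComponent k A rfl y.2 j
  refine ⟨w, hw.trans hy, ?_⟩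
  rw [he y w hw, he' x z (totComponent_toTot k A _ _ _ _ _).symm]
  exact (totFilteredComplex k A).page_d_toPage hs x

/-- The filtration `homologyF` of the homology of the total complex is `e2Filtration`. -/
theorem convergesTo_totFilteredComplex :
    ConvergesTo (totFilteredComplex k A).spectralSequence (e2Homology k A) (e2Filtration k A) :=
  (totFilteredComplex k A).convergesTo

end Total

end E2Homology

theorem mainTheorem5 (k : Type u) [CommRing k] (A : Type v) [NonUnitalCommRing A] [Module k A]
    [IsScalarTower k A A] [SMulCommClass k A A] (hA : Module.Flat k A)
    (hH : ∀ n, Module.Flat k (barHomology k A n)) :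
    ∃ (E : E1SpectralSequence.{u, v} k)
      (κ : ∀ p q : ℕ, (⨁ l : Degrees p q, ⨂[k] i, barHomology k A (l.1 i)) ≃ₗ[k]
        (rowComplex k A q).homology p)
      (e : ∀ p q : ℕ, (rowComplex k A q).homology p ≃ₗ[k] (E.page 1).X (p, q)),
      (∀ (p q : ℕ) (f : TwoTree p q) (l : Degrees p q),
        (∀ i, (Finset.univ.filter fun x => f.1 x = i).card = l.1 i + 1) →
        ∀ z : ∀ i, (barComplex k A).cycles (l.1 i), ∃ w : (rowComplex k A q).cycles p,
          (rowComplex k A q).iCycles p w =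
            DirectSum.lof k (TwoTree p q) (fun _ => ⨂[k]^(p + 1) A) f
              (juxtapose k l fun i => (barComplex k A).iCycles (l.1 i) (z i)) ∧
          κ p q (DirectSum.lof k (Degrees p q) (fun l => ⨂[k] i, barHomology k A (l.1 i)) l
              (PiTensorProduct.tprod k fun i => (barComplex k A).homologyπ (l.1 i) (z i))) =
            (rowComplex k A q).homologyπ p w) ∧
      (∀ (p q : ℕ) (z : (rowComplex k A (q + 1)).cycles p), ∃ w : (rowComplex k A q).cycles p,
          (rowComplex k A q).iCycles p w =
            shuffleD k A p q ((rowComplex k A (q + 1)).iCycles p z) ∧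
          (E.page 1).d (p, q + 1) (p, q) (e p (q + 1) ((rowComplex k A (q + 1)).homologyπ p z)) =
            e p q ((rowComplex k A q).homologyπ p w)) ∧
      ConvergesTo E (e2Homology k A) (e2Filtration k A) := by
  choose κ hκ using exists_kappa k A hA hH
  choose e he using exists_row_equiv_page k A
  exact ⟨(totFilteredComplex k A).spectralSequence, κ, e, hκ,
    fun p q z => exists_page_d_eq k A p q (e p q) (he p q) (e p (q + 1)) (he p (q + 1)) z,
    convergesTo_totFilteredComplex k A⟩
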